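/- Let $d\ge 1$, $\mathbb{T}^d=\mathbb{R}^d/\mathbb{Z}^d$ and $0<\alpha<1$. There is a constant $C=C_{\alpha,d}$, depending only on $\alpha$ and $d$, such that the following holds for every viscosity $\nu>0$ and every $T\in(0,\infty]$. Let $u_0:\mathbb{T}^d\to\mathbb{R}^d$ be continuous with $\operatorname{div}u_0=0$ in the sense of distributions, and let $u:(0,T)\times\mathbb{T}^d\to\mathbb{R}^d$ be measurable with $$\|u\|_{L^\infty_tC^\alpha_x}=\operatorname*{ess\,sup}_{0<t<T}\bigl(\|u(t)\|_{L^\infty}+\|u(t)\|_{\dot C^\alpha}\bigr)<\infty,$$ where $\|f\|_{\dot C^\alpha}=\sup_{x\ne y}|f(x)-f(y)|/|x-y|^\alpha$. Suppose that $u$ is a weak solution of the incompressible Navier–Stokes equations $$\partial_tu+u\cdot\nabla u+\nabla p-\nu\Delta u=0,\qquad \operatorname{div}u=0,\qquad u(0,x)=u_0(x),$$ i.e. $\operatorname{div}u(t)=0$ in the sense of distributions for a.e. $t$, and $$\int_0^T\!\!\int_{\mathbb{T}^d}\bigl(u\cdot\partial_t\varphi+(u\otimes u):\nabla\varphi+\nu\,u\cdot\Delta\varphi\bigr)\,dx\,dt+\int_{\mathbb{T}^d}u_0\cdot\varphi(0,\cdot)\,dx=0$$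 for all divergence-free $\varphi\in C_c^\infty([0,T)\times\mathbb{T}^d;\mathbb{R}^d)$. Then, after modification of $u$ on a null set of times, $u$ extends to a continuous function on $[0,T)\times\mathbb{T}^d$ with $u(0)=u_0$, and for this continuous function the following estimates hold. The difference $\tilde u(t)=u(t)-e^{\nu t\Delta}u_0$ between $u$ and the free heat solution with the same initial data satisfies $$\sup_{x\in\mathbb{T}^d}\ \sup_{\substack{t,s\in[0,T)\\ t\ne s}}\frac{|\tilde u(t,x)-\tilde u(s,x)|}{|t-s|^\alpha}\le C\,\|u\|_{L^\infty_{t,x}}^\alpha\,\|u\|_{L^\infty_t\dot C^\alpha_x},$$ and, for every $a>0$, $$\|u\|_{C^\alpha_{t,x}((a\nu,T)\times\mathbb{T}^d)}\le C\Bigl(\|u\|_{L^\infty_{t,x}}^\alpha\|u\|_{L^\infty_t\dot C^\alpha_x}+\|u\|_{L^\infty_tC^\alpha_x}+a^{-\alpha/2}\|u_0\|_{\dot C^\alpha_x}\Bigr),$$ where the left-hand side is the supremum of $|u|$ plus the $\alpha$-Hölder seminorm of $u$ jointly in $(t,x)$. In particular $C$ is independent of $\nu$, $a$, $T$, $u_0$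 and $u$. -/

import Mathlib

open MeasureTheory Set
open scoped ENNReal NNReal ContDiff

/-- Euclidean space `ℝ^d`. Functions on the torus `𝕋^d = ℝ^d / ℤ^d` are `ℤ^d`-periodic functions
on it. -/
abbrev Sp (d : ℕ) : Type := EuclideanSpace ℝ (Fin d)

/-- `f` is `ℤ^d`-periodic, i.e. a function on the torus `𝕋^d = ℝ^d / ℤ^d`. -/
def IsPeriodic {d : ℕ} {F : Type*} (f : Sp d → F) : Prop :=
  ∀ (i : Fin d) (x : Sp d), f (x + EuclideanSpace.single i 1) = f x

/-- The fundamental cell `[0,1)^d`; integrals over `𝕋^d` are integrals over it. -/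
def unitCell (d : ℕ) : Set (Sp d) := {x | ∀ i, x i ∈ Ico (0 : ℝ) 1}

/-- The open time interval `(s, T)`, where `T = ∞` is allowed. -/
def openTime (s : ℝ) (T : EReal) : Set ℝ := {t | s < t ∧ (t : EReal) < T}

/-- The half-open time interval `[0, T)`, where `T = ∞` is allowed. -/
def halfOpenTime (T : EReal) : Set ℝ := {t | 0 ≤ t ∧ (t : EReal) < T}

/-- Divergence of a differentiable vector field. -/
noncomputable def divergence {d : ℕ} (f : Sp d → Sp d) (x : Sp d) : ℝ :=
  ∑ i, (fderiv ℝ f x (EuclideanSpace.single i 1)) i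

/-- `div f = 0` in the sense of distributions on `𝕋^d`. -/
def IsWeaklyDivFree {d : ℕ} (f : Sp d → Sp d) : Prop :=
  ∀ ψ : Sp d → ℝ, ContDiff ℝ ∞ ψ → IsPeriodic ψ →
    ∫ x in unitCell d, fderiv ℝ ψ x (f x) = 0

/-- Divergence-free test fields in `C_c^∞([0,T) × 𝕋^d; ℝ^d)` (restrictions to `[0,T)` of fields
that are smooth for all times and vanish from some time before `T` on). -/
structure IsTestField {d : ℕ} (T : EReal) (φ : ℝ → Sp d → Sp d) : Prop where
  smooth : ContDiff ℝ ∞ (Function.uncurry φ)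
  periodic : ∀ t, IsPeriodic (φ t)
  divFree : ∀ t x, divergence (φ t) x = 0
  support : ∃ T' : ℝ, (T' : EReal) < T ∧ ∀ t, T' ≤ t → ∀ x, φ t x = 0

/-- The full Hölder norm `‖f‖_{C^α} = sup |f| + [f]_α` (possibly `∞`); the seminorm
`‖f‖_{Ċ^α} = [f]_α` is `eHolderNorm α f`. -/
noncomputable def holderFullNorm {X F : Type*} [MetricSpace X] [NormedAddCommGroup F]
    (α : ℝ≥0) (f : X → F) : ℝ≥0∞ :=
  (⨆ x, ‖f x‖ₑ) + eHolderNorm α f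

/-- `‖u‖_{L^∞_{t,x}}` on `(0,T) × 𝕋^d`. -/
noncomputable def normLinfty {d : ℕ} (T : EReal) (u : ℝ → Sp d → Sp d) : ℝ≥0∞ :=
  eLpNorm (Function.uncurry u) ⊤ (volume.restrict (openTime 0 T ×ˢ univ))

/-- `‖u‖_{L^∞_t Ċ^α_x}` on `(0,T) × 𝕋^d`. -/
noncomputable def normLinftyHolderDot {d : ℕ} (α : ℝ≥0) (T : EReal) (u : ℝ → Sp d → Sp d) :
    ℝ≥0∞ :=
  essSup (fun t => eHolderNorm α (u t)) (volume.restrict (openTime 0 T))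

/-- `‖u‖_{L^∞_t C^α_x}` on `(0,T) × 𝕋^d`. -/
noncomputable def normLinftyHolder {d : ℕ} (α : ℝ≥0) (T : EReal) (u : ℝ → Sp d → Sp d) :
    ℝ≥0∞ :=
  essSup (fun t => holderFullNorm α (u t)) (volume.restrict (openTime 0 T))

/-- `‖w‖_{L^∞_x Ċ^α_t}` on `[0,T) × 𝕋^d`: the supremum over `x` of the Hölder seminorm in time. -/
noncomputable def normLinftySpaceHolderTime {d : ℕ} (α : ℝ≥0) (T : EReal)
    (w : ℝ → Sp d → Sp d) : ℝ≥0∞ :=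
  ⨆ x, eHolderNorm α ((halfOpenTime T).domRestrict fun t => w t x)

/-- `‖w‖_{C^α_{t,x}}` on `(s,T) × 𝕋^d`, with respect to the distance
`max(|t - t'|, |x - x'|)`. -/
noncomputable def normJointHolder {d : ℕ} (α : ℝ≥0) (s : ℝ) (T : EReal)
    (w : ℝ → Sp d → Sp d) : ℝ≥0∞ :=
  holderFullNorm α ((openTime s T ×ˢ (univ : Set (Sp d))).domRestrict (Function.uncurry w))

/-- The heat semigroup `e^{sΔ} f` for `s ≥ 0`, as convolution with the Gaussian heat kernel. -/
noncomputable def heatFlow {d : ℕ} (s : ℝ) (f : Sp d → Sp d) (x : Sp d) : Sp d :=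
  if 0 < s then
    ∫ y, ((4 * Real.pi * s) ^ (-(d : ℝ) / 2) * Real.exp (-‖y‖ ^ 2 / (4 * s))) • f (x - y)
  else f x

/-- `u` is a weak solution, of class `L^∞_t C^α_x`, of the incompressible Navier–Stokes equations
with viscosity `ν` on `[0,T) × 𝕋^d` with initial velocity `u₀`. The pressure is eliminated by
testing with divergence-free fields, and the initial condition is part of the weak formulation. -/
structure IsHolderWeakSolution {d : ℕ} (α : ℝ≥0) (ν : ℝ) (T : EReal) (u₀ : Sp d → Sp d)
    (u : ℝ → Sp d → Sp d) : Prop where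
  init_continuous : Continuous u₀
  init_periodic : IsPeriodic u₀
  init_divFree : IsWeaklyDivFree u₀
  measurable : AEStronglyMeasurable (Function.uncurry u)
    (volume.restrict (openTime 0 T ×ˢ (univ : Set (Sp d))))
  periodic : ∀ t ∈ openTime 0 T, IsPeriodic (u t)
  holder : normLinftyHolder α T u < ⊤
  divFree : ∀ᵐ t ∂(volume.restrict (openTime 0 T)), IsWeaklyDivFree (u t)
  momentum : ∀ φ : ℝ → Sp d → Sp d, IsTestField T φ →
    (∫ z in openTime 0 T ×ˢ unitCell d,
        (inner ℝ (u z.1 z.2) (deriv (fun s => φ s z.2) z.1)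
          + inner ℝ (u z.1 z.2) (fderiv ℝ (φ z.1) z.2 (u z.1 z.2))
          + ν * inner ℝ (u z.1 z.2) (Laplacian.laplacian (φ z.1) z.2)))
      + ∫ x in unitCell d, inner ℝ (u₀ x) (φ 0 x) = 0

/-! ### Integration over the unit cell -/

/-! The solution is tested with trigonometric polynomials `ψ`, and every bound is proportional to
the `L¹` norm of `ψ`; by duality such bounds are sup bounds in `x` (`abs_le_of_forall_trig`).
Solving the equation mode by mode gives, for every additional heat time `σ > 0`, the identity
(`duhamel`) ⟨u(t), e^{σΔ}ψ⟩ - ⟨u₀, e^{(σ+νt)Δ}ψ⟩ = ∫₀ᵗ ⟨-P div (u ⊗ u)(s), e^{(σ+ν(t-s))Δ}ψ⟩ ds.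

Let `U` and `H` be the sup norm of `u` and its spatial Hölder seminorm. At heat time `ρ` the
integrand is of size `ρ^((α-1)/2) U H`, and its `ρ`-derivative of size `ρ^((α-3)/2) U H`: the
products `u_j u_k` have Hölder constant `2UH`, and a differentiated heat kernel has mean zero, so it
only sees differences. The nonlocal pressure is treated through `-Δ⁻¹ e^{ρΔ} = ∫_ρ^∞ e^{rΔ} dr`,
valid on nonzero frequencies: three derivatives on `e^{rΔ}` give `r^((α-3)/2)`, which is integrable
at infinity because `α < 1`.

Passing from `t₁` to `t₂` moves the heat time by `ν(t₂-t₁)`, and `∫ ν (σ+ν(t₁-s))^((α-3)/2) ds` is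
at most a multiple of `σ^((α-1)/2)`, whatever `ν` is. The increment of the Duhamel integral is thus
of size `(t₂-t₁) σ^((α-1)/2) U H` (`exists_duhamel_sub_le`), while removing the mollifier `e^{σΔ}`
costs `σ^(α/2) H`. The choice `√σ = U (t₂-t₁)` turns both into `U^α H (t₂-t₁)^α`
(`exists_abs_sub_heatFlow_le`).

All this holds between times of full measure, at which the modes are as predicted, and time zero.
Since the bound on `u - e^{νtΔ}u₀` is uniform, it extends to all times. The joint estimate adds the
heat flow, whose time modulus is governed by `√(νt)`; beyond time `aν` that function is Lipschitz
with constant `1/√a`, which produces `a^(-α/2)`. -/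

theorem unitCell_eq_fundamentalDomain (d : ℕ) :
    unitCell d = ZSpan.fundamentalDomain (EuclideanSpace.basisFun (Fin d) ℝ).toBasis := by
  ext x
  simp [unitCell, ZSpan.mem_fundamentalDomain]

theorem isAddFundamentalDomain_unitCell (d : ℕ) :
    IsAddFundamentalDomain
      (Submodule.span ℤ (Set.range (EuclideanSpace.basisFun (Fin d) ℝ).toBasis))
      (unitCell d) volume := by
  rw [unitCell_eq_fundamentalDomain]
  exact ZSpan.isAddFundamentalDomain _ _

theorem measurableSet_unitCell (d : ℕ) : MeasurableSet (unitCell d) := by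
  rw [unitCell_eq_fundamentalDomain]
  exact ZSpan.fundamentalDomain_measurableSet _

theorem isBounded_unitCell (d : ℕ) : Bornology.IsBounded (unitCell d) := by
  rw [unitCell_eq_fundamentalDomain]
  exact ZSpan.fundamentalDomain_isBounded _

theorem volume_unitCell_lt_top (d : ℕ) : volume (unitCell d) < ⊤ :=
  (isBounded_unitCell d).measure_lt_top

instance isFiniteMeasure_restrict_unitCell (d : ℕ) :
    IsFiniteMeasure ((volume : Measure (Sp d)).restrict (unitCell d)) :=
  ⟨by simpa using volume_unitCell_lt_top d⟩

theorem IsPeriodic.add_of_mem_span {d : ℕ} {F : Type*} {f : Sp d → F} (hf : IsPeriodic f)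
    {v : Sp d}
    (hv : v ∈ Submodule.span ℤ (Set.range (EuclideanSpace.basisFun (Fin d) ℝ).toBasis)) :
    ∀ x, f (x + v) = f x := by
  induction hv using Submodule.span_induction with
  | mem v hv =>
    obtain ⟨i, rfl⟩ := hv
    intro x
    simpa using hf i x
  | zero => simp
  | add v w _ _ hv hw => intro x; rw [← add_assoc, hw, hv]
  | smul n v _ hv =>
    induction n using Int.induction_on with
    | zero => simp
    | succ n ih => intro x; rw [add_smul, one_smul, ← add_assoc, hv, ih]
    | pred n ih =>
      intro x
      rw [sub_smul, one_smul, ← ih x, ← hv (x + _)]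
      congr 1; abel

-- The translated cell is a fundamental domain of the same lattice, and all fundamental domains give
-- a periodic function the same integral.
open scoped Pointwise in
theorem IsPeriodic.setIntegral_add {d : ℕ} {F : Type*} [NormedAddCommGroup F] [NormedSpace ℝ F]
    {f : Sp d → F} (hf : IsPeriodic f) (a : Sp d) :
    ∫ x in unitCell d, f (x + a) = ∫ x in unitCell d, f x := by
  have h1 := isAddFundamentalDomain_unitCell d
  have h2 : IsAddFundamentalDomain
      (Submodule.span ℤ (Set.range (EuclideanSpace.basisFun (Fin d) ℝ).toBasis))
      (a +ᵥ unitCell d) volume := h1.vadd_of_comm a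
  have : VAddInvariantMeasure
      (Submodule.span ℤ (Set.range (EuclideanSpace.basisFun (Fin d) ℝ).toBasis)) (Sp d) volume :=
    inferInstanceAs (VAddInvariantMeasure (Submodule.span ℤ
      (Set.range (EuclideanSpace.basisFun (Fin d) ℝ).toBasis)).toAddSubgroup (Sp d) volume)
  rw [h1.setIntegral_eq h2 (f := f)]
  · have := (measurePreserving_add_right (volume : Measure (Sp d)) a).setIntegral_image_emb
      (measurableEmbedding_addRight a) f (unitCell d)
    rw [← this]
    congr 2
    ext x
    simp only [Set.mem_image, Set.mem_vadd_set, vadd_eq_add, add_comm]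
  · intro g x
    have := hf.add_of_mem_span g.2 x
    rwa [add_comm] at this

/-- A continuous periodic function attains its values on a compact set, hence is bounded. -/
theorem IsPeriodic.exists_mem_unitCell {d : ℕ} {F : Type*} {f : Sp d → F} (hf : IsPeriodic f)
    (x : Sp d) : ∃ y ∈ unitCell d, f y = f x := by
  obtain ⟨v, hv, -⟩ := (ZSpan.exist_unique_vadd_mem_fundamentalDomain
    (EuclideanSpace.basisFun (Fin d) ℝ).toBasis x)
  refine ⟨(v : Sp d) + x, ?_, ?_⟩
  · rw [unitCell_eq_fundamentalDomain]; exact hv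
  · rw [add_comm]; exact hf.add_of_mem_span v.2 x

theorem IsPeriodic.exists_bound {d : ℕ} {F : Type*} [NormedAddCommGroup F] {f : Sp d → F}
    (hf : IsPeriodic f) (hc : Continuous f) : ∃ B, ∀ x, ‖f x‖ ≤ B := by
  have hK : IsCompact (closure (unitCell d)) := (isBounded_unitCell d).isCompact_closure
  obtain ⟨B, hB⟩ := hK.exists_bound_of_continuousOn hc.continuousOn
  refine ⟨B, fun x => ?_⟩
  obtain ⟨y, hy, hyx⟩ := hf.exists_mem_unitCell x
  rw [← hyx]
  exact hB y (subset_closure hy)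

theorem integrableOn_unitCell {d : ℕ} {F : Type*} [NormedAddCommGroup F] {f : Sp d → F}
    (hc : Continuous f) : IntegrableOn f (unitCell d) :=
  (hc.continuousOn.integrableOn_compact (isBounded_unitCell d).isCompact_closure).mono_set
    subset_closure

/-! ### Trigonometric polynomials -/

/-- The plane wave `exp (i ⟨ξ, x⟩)`. -/
noncomputable def wave {d : ℕ} (ξ x : Sp d) : ℂ := Complex.exp (Complex.I * (inner ℝ ξ x : ℝ))

/-- The frequency vector `2πn`. -/
noncomputable def freq {d : ℕ} (n : Fin d → ℤ) : Sp d :=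
  WithLp.toLp 2 fun i => 2 * Real.pi * (n i : ℝ)

@[simp] theorem freq_apply {d : ℕ} (n : Fin d → ℤ) (i : Fin d) :
    freq n i = 2 * Real.pi * (n i : ℝ) := rfl

theorem continuous_wave {d : ℕ} (ξ : Sp d) : Continuous (wave ξ) := by
  unfold wave; fun_prop

theorem wave_add {d : ℕ} (ξ x y : Sp d) : wave ξ (x + y) = wave ξ x * wave ξ y := by
  simp only [wave, inner_add_right, Complex.ofReal_add, mul_add, Complex.exp_add]

@[simp] theorem norm_wave {d : ℕ} (ξ x : Sp d) : ‖wave ξ x‖ = 1 := by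
  rw [wave, mul_comm, Complex.norm_exp_ofReal_mul_I]

theorem isPeriodic_wave {d : ℕ} (n : Fin d → ℤ) : IsPeriodic (wave (freq n)) := by
  intro i x
  rw [wave_add]
  have : wave (freq n) (EuclideanSpace.single i 1) = 1 := by
    rw [wave, EuclideanSpace.inner_single_right, Complex.exp_eq_one_iff]
    refine ⟨n i, ?_⟩
    simp
    ring
  rw [this, mul_one]

/-- The trigonometric polynomial with frequencies in `S` and coefficients `c`. -/
noncomputable def trig {d : ℕ} (S : Finset (Fin d → ℤ)) (c : (Fin d → ℤ) → ℂ) (x : Sp d) : ℂ :=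
  ∑ n ∈ S, c n * wave (freq n) x

/-- The `L¹` norm over the torus. -/
noncomputable def cellL1 {d : ℕ} (f : Sp d → ℂ) : ℝ := ∫ x in unitCell d, ‖f x‖

theorem cellL1_nonneg {d : ℕ} (f : Sp d → ℂ) : 0 ≤ cellL1 f :=
  integral_nonneg fun _ => norm_nonneg _

theorem continuous_trig {d : ℕ} (S : Finset (Fin d → ℤ)) (c : (Fin d → ℤ) → ℂ) :
    Continuous (trig S c) := by
  unfold trig
  exact continuous_finsetSum _ fun n _ => continuous_const.mul (continuous_wave _)

theorem isPeriodic_trig {d : ℕ} (S : Finset (Fin d → ℤ)) (c : (Fin d → ℤ) → ℂ) :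
    IsPeriodic (trig S c) := by
  intro i x
  simp only [trig, isPeriodic_wave _ i x]

theorem setIntegral_mul_trig {d : ℕ} {g : Sp d → ℂ} (hg : Continuous g)
    (S : Finset (Fin d → ℤ)) (c : (Fin d → ℤ) → ℂ) :
    ∫ x in unitCell d, g x * trig S c x
      = ∑ n ∈ S, c n * ∫ x in unitCell d, g x * wave (freq n) x := by
  simp only [trig, Finset.mul_sum]
  rw [integral_finsetSum]
  · refine Finset.sum_congr rfl fun n _ => ?_
    rw [← integral_const_mul]
    congr 1; ext x; ring
  · intro n _
    exact integrableOn_unitCell (hg.mul (continuous_const.mul (continuous_wave _)))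

theorem norm_setIntegral_mul_le {d : ℕ} {g ψ : Sp d → ℂ} {B : ℝ}
    (hψ : Continuous ψ) (hB : ∀ x, ‖g x‖ ≤ B) :
    ‖∫ x in unitCell d, g x * ψ x‖ ≤ B * cellL1 ψ := by
  rw [cellL1, ← integral_const_mul]
  refine norm_integral_le_of_norm_le ((integrableOn_unitCell hψ).norm.const_mul _) ?_
  refine Filter.Eventually.of_forall fun x => ?_
  rw [norm_mul]
  gcongr
  exact hB x

/-! ### Convolution multipliers -/

section Multiplier

variable {d : ℕ} {K : Sp d → ℝ} {r : ℝ} {m : (Fin d → ℤ) → ℂ}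

/-- The hypothesis `hm` says that averaging over shifts by `r • z` with weight `K` multiplies each
wave by `m n`; by linearity it acts so on finite sums. The abstract kernel serves both `gauss` and
`dgauss`. -/
theorem trig_multiplier (hK : Integrable K)
    (hm : ∀ n, ∫ z, (K z : ℂ) * wave (freq n) (-(r • z)) = m n)
    (S : Finset (Fin d → ℤ)) (c : (Fin d → ℤ) → ℂ) (x : Sp d) :
    trig S (fun n => m n * c n) x = ∫ z, (K z : ℂ) * trig S c (x - r • z) := by
  simp only [trig, Finset.mul_sum]
  rw [integral_finsetSum]
  · refine Finset.sum_congr rfl fun n _ => ?_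
    rw [← hm n, ← integral_mul_const, ← integral_mul_const]
    congr 1; ext z
    rw [sub_eq_add_neg, wave_add]; ring
  · intro n _
    refine hK.ofReal.mul_bdd (c := ‖c n‖) ?_ ?_
    · exact (continuous_const.mul ((continuous_wave _).comp (by fun_prop))).aestronglyMeasurable
    · exact Filter.Eventually.of_forall fun z => by simp

theorem integrable_prod_kernel (hK : Integrable K) {F : Sp d × Sp d → ℂ} (hF : Continuous F)
    {B : ℝ} (hB : ∀ p, ‖F p‖ ≤ B) :
    Integrable (fun p : Sp d × Sp d => (K p.2 : ℂ) * F p)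
      ((volume.restrict (unitCell d)).prod volume) := by
  refine Integrable.mul_bdd (c := B) ?_ hF.aestronglyMeasurable (Filter.Eventually.of_forall hB)
  have := (integrable_const (μ := volume.restrict (unitCell d)) (1 : ℂ)).mul_prod (hK.ofReal (𝕜 := ℂ))
  simpa using this

/-- Fubini and translation invariance move the shift from the polynomial to `g`, where Hölder
continuity can be exploited. -/
theorem setIntegral_mul_multiplier (hK : Integrable K)
    (hm : ∀ n, ∫ z, (K z : ℂ) * wave (freq n) (-(r • z)) = m n)
    {g : Sp d → ℂ} (hg : Continuous g) (hgp : IsPeriodic g)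
    (S : Finset (Fin d → ℤ)) (c : (Fin d → ℤ) → ℂ) :
    ∫ x in unitCell d, g x * trig S (fun n => m n * c n) x
      = ∫ z, (K z : ℂ) * ∫ x in unitCell d, g (x + r • z) * trig S c x := by
  obtain ⟨A, hA⟩ := hgp.exists_bound hg
  obtain ⟨B, hB⟩ := (isPeriodic_trig S c).exists_bound (continuous_trig S c)
  have hA0 : 0 ≤ A := (norm_nonneg _).trans (hA 0)
  simp only [trig_multiplier hK hm, ← integral_const_mul]
  rw [integral_integral_swap]
  · congr 1; ext z
    have hp : IsPeriodic fun x => g (x + r • z) * trig S c x := by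
      intro i x
      simp only [add_right_comm x _ (r • z), hgp i, isPeriodic_trig S c i]
    rw [integral_const_mul (K z : ℂ), ← hp.setIntegral_add (-(r • z))]
    simp only [← sub_eq_add_neg, sub_add_cancel]
    rw [← integral_const_mul]
    congr 1; ext x; ring
  · have := integrable_prod_kernel (K := K) hK
      (F := fun p => g p.1 * trig S c (p.1 - r • p.2)) (B := A * B)
      ((hg.comp continuous_fst).mul ((continuous_trig S c).comp (by fun_prop)))
      (fun p => by rw [norm_mul]; exact mul_le_mul (hA _) (hB _) (norm_nonneg _) hA0)
    refine this.congr (Filter.Eventually.of_forall fun p => ?_)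
    simp only [Function.uncurry]; ring

/-- Young's inequality for the convolution of an `L¹` kernel on `ℝ^d` with an `L¹` function on the
torus. -/
theorem cellL1_multiplier_le (hK : Integrable K)
    (hm : ∀ n, ∫ z, (K z : ℂ) * wave (freq n) (-(r • z)) = m n)
    (S : Finset (Fin d → ℤ)) (c : (Fin d → ℤ) → ℂ) :
    cellL1 (trig S fun n => m n * c n) ≤ (∫ z, ‖K z‖) * cellL1 (trig S c) := by
  obtain ⟨B, hB⟩ := (isPeriodic_trig S c).exists_bound (continuous_trig S c)
  have hint : Integrable (fun p : Sp d × Sp d => (K p.2 : ℂ) * trig S c (p.1 - r • p.2))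
      ((volume.restrict (unitCell d)).prod volume) :=
    integrable_prod_kernel hK (F := fun p => trig S c (p.1 - r • p.2))
      ((continuous_trig S c).comp (by fun_prop)) (fun p => hB _)
  calc cellL1 (trig S fun n => m n * c n)
      ≤ ∫ x in unitCell d, ∫ z, ‖(K z : ℂ) * trig S c (x - r • z)‖ := by
        refine integral_mono (integrableOn_unitCell (continuous_trig _ _).norm)
          hint.norm.integral_prod_left fun x => ?_
        simp only [trig_multiplier hK hm]
        exact norm_integral_le_integral_norm _
    _ = ∫ z, ∫ x in unitCell d, ‖(K z : ℂ) * trig S c (x - r • z)‖ :=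
        integral_integral_swap hint.norm
    _ = ∫ z, ‖K z‖ * cellL1 (trig S c) := by
        congr 1; ext z
        simp only [norm_mul, Complex.norm_real]
        rw [integral_const_mul]
        congr 1
        have hp : IsPeriodic fun x => ‖trig S c x‖ := fun i x => by
          simp only [isPeriodic_trig S c i x]
        simpa [sub_eq_add_neg, cellL1] using hp.setIntegral_add (-(r • z))
    _ = _ := integral_mul_const _ _

end Multiplier

/-! ### The Gaussian kernel -/

/-- The heat kernel at time one. -/
noncomputable def gauss {d : ℕ} (z : Sp d) : ℝ :=
  (4 * Real.pi) ^ (-(d : ℝ) / 2) * Real.exp (-‖z‖ ^ 2 / 4)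

theorem gauss_pos {d : ℕ} (z : Sp d) : 0 < gauss z := by unfold gauss; positivity

theorem gauss_neg {d : ℕ} (z : Sp d) : gauss (-z) = gauss z := by simp [gauss]

theorem continuous_gauss {d : ℕ} : Continuous (gauss (d := d)) := by unfold gauss; fun_prop

theorem integral_gauss_mul_wave {d : ℕ} (r : ℝ) (ξ : Sp d) :
    ∫ z, (gauss z : ℂ) * wave ξ (-(r • z)) = Complex.exp (-(r ^ 2 * ‖ξ‖ ^ 2 : ℝ)) := by
  have h := GaussianFourier.integral_cexp_neg_mul_sq_norm_add (V := Sp d) (b := 1 / 4)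
    (by norm_num) (-(Complex.I * r)) ξ
  have h2 : ∀ z : Sp d, (gauss z : ℂ) * wave ξ (-(r • z))
      = ((4 * Real.pi) ^ (-(d : ℝ) / 2) : ℝ) *
        Complex.exp (-(1 / 4) * ‖z‖ ^ 2 + -(Complex.I * r) * (inner ℝ ξ z : ℝ)) := by
    intro z
    rw [Complex.exp_add, gauss, wave, inner_neg_right, inner_smul_right]
    push_cast
    rw [mul_assoc]
    congr 2
    · congr 1; ring
    · congr 1; ring
  simp_rw [h2]
  rw [integral_const_mul, h, ← mul_assoc]
  have h3 : (((4 * Real.pi) ^ (-(d : ℝ) / 2) : ℝ) : ℂ)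
      * (Real.pi / (1 / 4)) ^ (Module.finrank ℝ (Sp d) / 2 : ℂ) = 1 := by
    have : ((Real.pi : ℂ) / (1 / 4)) ^ (Module.finrank ℝ (Sp d) / 2 : ℂ)
        = (((4 * Real.pi) ^ ((d : ℝ) / 2) : ℝ) : ℂ) := by
      rw [Complex.ofReal_cpow (by positivity)]
      simp
      congr 1; ring
    rw [this, ← Complex.ofReal_mul, ← Real.rpow_add (by positivity)]
    simp [neg_div]
  rw [h3, one_mul]
  congr 1
  rw [neg_sq, mul_pow, Complex.I_sq]
  push_cast; ring

theorem integrable_norm_rpow_mul_gauss {d : ℕ} {s : ℝ} (hs : 0 ≤ s) (hs2 : s ≤ 2) :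
    Integrable fun z : Sp d => ‖z‖ ^ s * gauss z := by
  -- Half of the Gaussian exponent `1/4` absorbs the power, by `‖z‖ ^ s ≤ 1 + ‖z‖ ^ 2 ≤ 9 exp (‖z‖ ^
  -- 2 / 8)`; the other half is the integrable majorant.
  have h := (GaussianFourier.integrable_cexp_neg_mul_sq_norm_add (V := Sp d) (b := 1 / 8)
    (by norm_num) 0 0).norm.const_mul (9 * (4 * Real.pi) ^ (-(d : ℝ) / 2))
  refine h.mono ?_ (Filter.Eventually.of_forall fun z => ?_)
  · exact ((continuous_norm.rpow_const fun _ => Or.inr hs).mul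
      continuous_gauss).aestronglyMeasurable
  · have h1 : ‖z‖ ^ s ≤ 9 * Real.exp (‖z‖ ^ 2 / 8) := by
      have h2 : ‖z‖ ^ s ≤ 1 + ‖z‖ ^ 2 := by
        rcases le_total ‖z‖ 1 with h | h
        · have := Real.rpow_le_one (norm_nonneg z) h hs
          nlinarith [sq_nonneg ‖z‖]
        · have := Real.rpow_le_rpow_of_exponent_le h hs2
          rw [Real.rpow_two] at this
          linarith
      have h3 := Real.add_one_le_exp (‖z‖ ^ 2 / 8)
      nlinarith [sq_nonneg ‖z‖]
    have h4 : gauss z = (4 * Real.pi) ^ (-(d : ℝ) / 2)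
        * (Real.exp (-(1 / 8) * ‖z‖ ^ 2) / Real.exp (‖z‖ ^ 2 / 8)) := by
      rw [gauss, ← Real.exp_sub]; congr 2; ring
    have h5 : ‖Complex.exp (-(1 / 8) * ‖z‖ ^ 2 + 0 * (inner ℝ (0 : Sp d) z : ℝ))‖
        = Real.exp (-(1 / 8) * ‖z‖ ^ 2) := by
      rw [zero_mul, add_zero, Complex.norm_exp]
      congr 1
      have : (-(1 / 8) * (‖z‖ : ℂ) ^ 2) = ((-(1 / 8) * ‖z‖ ^ 2 : ℝ) : ℂ) := by push_cast; ring
      rw [this, Complex.ofReal_re]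
    rw [h5, Real.norm_of_nonneg (by have := gauss_pos z; positivity),
      Real.norm_of_nonneg (by positivity), h4]
    calc _ ≤ (9 * Real.exp (‖z‖ ^ 2 / 8)) * ((4 * Real.pi) ^ (-(d : ℝ) / 2)
        * (Real.exp (-(1 / 8) * ‖z‖ ^ 2) / Real.exp (‖z‖ ^ 2 / 8))) := by gcongr
      _ = _ := by field_simp

theorem integrable_gauss {d : ℕ} : Integrable (gauss (d := d)) := by
  simpa using integrable_norm_rpow_mul_gauss (d := d) le_rfl zero_le_two

theorem integral_gauss {d : ℕ} : ∫ z, gauss (d := d) z = 1 := by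
  have h := integral_gauss_mul_wave (d := d) 0 0
  simp only [zero_smul, neg_zero, wave, inner_zero_left, Complex.ofReal_zero, mul_zero,
    Complex.exp_zero, mul_one] at h
  rw [integral_complex_ofReal] at h
  norm_num at h
  exact_mod_cast h

/-- The derivative of the heat kernel at time one in the direction of the `i`-th axis. -/
noncomputable def dgauss {d : ℕ} (i : Fin d) (z : Sp d) : ℝ := -(z i / 2) * gauss z

theorem continuous_dgauss {d : ℕ} (i : Fin d) : Continuous (dgauss i) := by
  unfold dgauss
  exact (by fun_prop : Continuous fun z : Sp d => -(z i / 2)).mul continuous_gauss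

theorem abs_dgauss_le {d : ℕ} (i : Fin d) (z : Sp d) : |dgauss i z| ≤ ‖z‖ * gauss z := by
  have h := gauss_pos z
  have h1 := PiLp.norm_apply_le z i
  rw [Real.norm_eq_abs] at h1
  rw [dgauss, abs_mul, abs_of_pos h, abs_neg, abs_div, abs_two]
  gcongr
  linarith [abs_nonneg (z i)]

theorem integrable_norm_rpow_mul_dgauss {d : ℕ} (i : Fin d) {s : ℝ} (hs : 0 ≤ s) (hs1 : s ≤ 1) :
    Integrable fun z : Sp d => ‖z‖ ^ s * dgauss i z := by
  refine (integrable_norm_rpow_mul_gauss (d := d) (s := s + 1) (by linarith) (by linarith)).mono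
    ?_ (Filter.Eventually.of_forall fun z => ?_)
  · exact ((continuous_norm.rpow_const fun _ => Or.inr hs).mul
      (continuous_dgauss i)).aestronglyMeasurable
  · have hg := gauss_pos z
    rw [norm_mul, Real.norm_of_nonneg (by positivity : 0 ≤ ‖z‖ ^ s),
      Real.norm_of_nonneg (mul_nonneg (Real.rpow_nonneg (norm_nonneg z) _) hg.le),
      Real.rpow_add_one' (norm_nonneg z) (by linarith), mul_assoc]
    exact mul_le_mul_of_nonneg_left (abs_dgauss_le i z) (by positivity)

theorem integrable_dgauss {d : ℕ} (i : Fin d) : Integrable (dgauss i) := by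
  simpa using integrable_norm_rpow_mul_dgauss i le_rfl zero_le_one

theorem hasFDerivAt_gauss {d : ℕ} (z : Sp d) :
    HasFDerivAt gauss (-(gauss z / 2) • innerSL ℝ z) z := by
  have h : HasFDerivAt (fun z : Sp d => -‖z‖ ^ 2 / 4) ((-1 / 4 : ℝ) • (2 • innerSL ℝ z)) z := by
    have := (hasStrictFDerivAt_norm_sq z).hasFDerivAt.const_mul (-1 / 4 : ℝ)
    refine this.congr_of_eventuallyEq (Filter.Eventually.of_forall fun y => ?_)
    simp only; ring
  refine (h.exp.const_mul _).congr_fderiv ?_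
  ext v
  simp [gauss]
  ring

theorem hasFDerivAt_wave {d : ℕ} (ξ x : Sp d) :
    HasFDerivAt (wave ξ) (wave ξ x • Complex.I • (Complex.ofRealCLM.comp (innerSL ℝ ξ))) x := by
  have h : HasFDerivAt (fun x : Sp d => Complex.I * ((innerSL ℝ ξ x : ℝ) : ℂ))
      (Complex.I • (Complex.ofRealCLM.comp (innerSL ℝ ξ))) x :=
    ((Complex.ofRealCLM.hasFDerivAt).comp x (innerSL ℝ ξ).hasFDerivAt).const_mul Complex.I
  exact h.cexp

/-- Integration by parts moves the derivative from the Gaussian to the wave, which reduces to the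
transform of `gauss`. -/
theorem integral_dgauss_mul_wave {d : ℕ} (i : Fin d) (r : ℝ) (ξ : Sp d) :
    ∫ z, (dgauss i z : ℂ) * wave ξ (-(r • z))
      = Complex.I * (r * ξ i : ℝ) * Complex.exp (-(r ^ 2 * ‖ξ‖ ^ 2 : ℝ)) := by
  have hw : ∀ z : Sp d, wave ξ (-(r • z)) = wave (-(r • ξ)) z := by
    intro z; simp [wave, inner_smul_left, inner_smul_right]
  have hf : ∀ z : Sp d, HasFDerivAt (fun z => (gauss z : ℂ))
      (Complex.ofRealCLM.comp (-(gauss z / 2) • innerSL ℝ z)) z := fun z =>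
    Complex.ofRealCLM.hasFDerivAt.comp z (hasFDerivAt_gauss z)
  have hfv : ∀ z : Sp d, fderiv ℝ (fun z => (gauss z : ℂ)) z (EuclideanSpace.single i 1)
      = (dgauss i z : ℂ) := by
    intro z
    rw [(hf z).fderiv]
    simp [dgauss, EuclideanSpace.inner_single_right]
    ring
  have hgv : ∀ z : Sp d, fderiv ℝ (wave (-(r • ξ))) z (EuclideanSpace.single i 1)
      = -(Complex.I * (r * ξ i : ℝ)) * wave (-(r • ξ)) z := by
    intro z
    rw [(hasFDerivAt_wave _ z).fderiv]
    simp [EuclideanSpace.inner_single_right]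
    ring
  have hbd : ∀ {k : Sp d → ℝ}, Integrable k →
      Integrable fun z => (k z : ℂ) * wave (-(r • ξ)) z := fun hk =>
    hk.ofReal.mul_bdd (c := 1) (continuous_wave _).aestronglyMeasurable
      (Filter.Eventually.of_forall fun z => by simp)
  have key := integral_mul_fderiv_eq_neg_fderiv_mul_of_integrable (μ := (volume : Measure (Sp d)))
    (f := fun z : Sp d => (gauss z : ℂ)) (g := wave (-(r • ξ)))
    (v := EuclideanSpace.single i 1) ?_ ?_ ?_ ?_ ?_
  · simp only [hfv, hgv] at key
    simp only [hw]
    rw [← neg_eq_iff_eq_neg.mpr key, ← integral_gauss_mul_wave, ← integral_neg,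
      ← integral_const_mul]
    congr 1; ext z
    rw [hw]; ring
  · simp only [hfv]; exact hbd (integrable_dgauss i)
  · simp only [hgv]
    refine ((hbd integrable_gauss).const_mul (-(Complex.I * (r * ξ i : ℝ)))).congr
      (Filter.Eventually.of_forall fun z => ?_)
    simp only; ring
  · exact hbd integrable_gauss
  · exact fun z _ => (hf z).differentiableAt
  · exact fun z _ => (hasFDerivAt_wave _ z).differentiableAt

/-- The vanishing mean makes it free to replace `g (x + r • z)` by `g (x + r • z) - g x` under this
kernel, which gains a factor `r ^ α`. -/
theorem integral_dgauss {d : ℕ} (i : Fin d) : ∫ z, dgauss i z = 0 := by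
  have h := integral_dgauss_mul_wave i 0 0
  simp only [zero_smul, neg_zero, wave, inner_zero_left, Complex.ofReal_zero, mul_zero,
    Complex.exp_zero, mul_one, zero_mul] at h
  rw [integral_complex_ofReal] at h
  exact_mod_cast h

/-! ### The heat semigroup on trigonometric polynomials -/

/-- The coefficients of `e^{τΔ} ψ`, where `ψ` has coefficients `c`. -/
noncomputable def heatCoeff {d : ℕ} (τ : ℝ) (c : (Fin d → ℤ) → ℂ) (n : Fin d → ℤ) : ℂ :=
  (Real.exp (-(τ * ‖freq n‖ ^ 2)) : ℂ) * c n

/-- The coefficients of `∂ᵢ ψ`, where `ψ` has coefficients `c`. -/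
noncomputable def derivCoeff {d : ℕ} (i : Fin d) (c : (Fin d → ℤ) → ℂ) (n : Fin d → ℤ) : ℂ :=
  Complex.I * (freq n i : ℝ) * c n

/-- The moment of order `s` of the heat kernel at time one. -/
noncomputable def gaussMoment (d : ℕ) (s : ℝ) : ℝ := ∫ z : Sp d, ‖z‖ ^ s * gauss z

theorem gaussMoment_nonneg (d : ℕ) (s : ℝ) : 0 ≤ gaussMoment d s :=
  integral_nonneg fun z => mul_nonneg (Real.rpow_nonneg (norm_nonneg z) _) (gauss_pos z).le

theorem heatCoeff_heatCoeff {d : ℕ} (σ τ : ℝ) (c : (Fin d → ℤ) → ℂ) :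
    heatCoeff σ (heatCoeff τ c) = heatCoeff (σ + τ) c := by
  ext n
  simp only [heatCoeff]
  rw [← mul_assoc, ← Complex.ofReal_mul, ← Real.exp_add]
  congr 3; ring

theorem heatCoeff_derivCoeff {d : ℕ} (τ : ℝ) (i : Fin d) (c : (Fin d → ℤ) → ℂ) :
    heatCoeff τ (derivCoeff i c) = derivCoeff i (heatCoeff τ c) := by
  ext n
  simp only [heatCoeff, derivCoeff]; ring

theorem trig_const_mul {d : ℕ} (S : Finset (Fin d → ℤ)) (a : ℂ) (c : (Fin d → ℤ) → ℂ) (x : Sp d) :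
    trig S (fun n => a * c n) x = a * trig S c x := by
  simp only [trig, Finset.mul_sum, mul_assoc]

theorem cellL1_const_mul {d : ℕ} (S : Finset (Fin d → ℤ)) (a : ℂ) (c : (Fin d → ℤ) → ℂ) :
    cellL1 (trig S fun n => a * c n) = ‖a‖ * cellL1 (trig S c) := by
  simp only [cellL1, trig_const_mul, norm_mul, integral_const_mul]

theorem gauss_multiplier {d : ℕ} {τ : ℝ} (hτ : 0 ≤ τ) (n : Fin d → ℤ) :
    ∫ z, (gauss z : ℂ) * wave (freq n) (-(√τ • z)) = (Real.exp (-(τ * ‖freq n‖ ^ 2)) : ℂ) := by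
  rw [integral_gauss_mul_wave, Real.sq_sqrt hτ]
  push_cast; rfl

theorem dgauss_multiplier {d : ℕ} {τ : ℝ} (hτ : 0 ≤ τ) (i : Fin d) (n : Fin d → ℤ) :
    ∫ z, (dgauss i z : ℂ) * wave (freq n) (-(√τ • z))
      = (√τ : ℂ) * (Complex.I * (freq n i : ℝ) * (Real.exp (-(τ * ‖freq n‖ ^ 2)) : ℂ)) := by
  rw [integral_dgauss_mul_wave, Real.sq_sqrt hτ]
  push_cast; ring

theorem cellL1_heatCoeff_le {d : ℕ} {τ : ℝ} (hτ : 0 ≤ τ) (S : Finset (Fin d → ℤ))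
    (c : (Fin d → ℤ) → ℂ) : cellL1 (trig S (heatCoeff τ c)) ≤ cellL1 (trig S c) := by
  have h := cellL1_multiplier_le integrable_gauss (gauss_multiplier hτ) S c
  have h1 : ∫ z : Sp d, ‖gauss z‖ = 1 := by
    simp only [Real.norm_of_nonneg (gauss_pos _).le, integral_gauss]
  rw [h1, one_mul] at h
  exact h

theorem derivCoeff_heatCoeff_eq {d : ℕ} {τ : ℝ} (hτ : 0 < τ) (i : Fin d)
    (c : (Fin d → ℤ) → ℂ) :
    derivCoeff i (heatCoeff τ c) = fun n => ((√τ)⁻¹ : ℂ) *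
      ((√τ : ℂ) * (Complex.I * (freq n i : ℝ) * (Real.exp (-(τ * ‖freq n‖ ^ 2)) : ℂ)) * c n) := by
  have h : (√τ : ℂ) ≠ 0 := by exact_mod_cast (Real.sqrt_pos.mpr hτ).ne'
  ext n
  simp only [derivCoeff, heatCoeff]
  field_simp

theorem norm_inv_sqrt {τ : ℝ} (hτ : 0 < τ) : ‖((√τ)⁻¹ : ℂ)‖ = τ ^ (-1 / 2 : ℝ) := by
  rw [norm_inv, Complex.norm_real, Real.norm_of_nonneg (Real.sqrt_nonneg _), Real.sqrt_eq_rpow,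
    ← Real.rpow_neg hτ.le]
  norm_num

/-- By scaling, `∂ᵢ e^{τΔ}` is `τ^(-1/2)` times averaging with `dgauss i` at length scale `√τ`. -/
theorem cellL1_derivCoeff_heatCoeff_le {d : ℕ} {τ : ℝ} (hτ : 0 < τ) (i : Fin d)
    (S : Finset (Fin d → ℤ)) (c : (Fin d → ℤ) → ℂ) :
    cellL1 (trig S (derivCoeff i (heatCoeff τ c)))
      ≤ gaussMoment d 1 * τ ^ (-1 / 2 : ℝ) * cellL1 (trig S c) := by
  have h := cellL1_multiplier_le (integrable_dgauss i) (dgauss_multiplier hτ.le i) S c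
  have h1 : ∫ z : Sp d, ‖dgauss i z‖ ≤ gaussMoment d 1 := by
    refine integral_mono (integrable_dgauss i).norm
      (integrable_norm_rpow_mul_gauss zero_le_one one_le_two) fun z => ?_
    simpa using abs_dgauss_le i z
  rw [derivCoeff_heatCoeff_eq hτ, cellL1_const_mul, norm_inv_sqrt hτ]
  calc _ ≤ τ ^ (-1 / 2 : ℝ) * ((∫ z : Sp d, ‖dgauss i z‖) * cellL1 (trig S c)) := by gcongr
    _ ≤ τ ^ (-1 / 2 : ℝ) * (gaussMoment d 1 * cellL1 (trig S c)) := by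
        gcongr; exact cellL1_nonneg _
    _ = _ := by ring

/-! ### Testing Hölder functions -/

section Holder

variable {d : ℕ} {α H : ℝ} {g : Sp d → ℂ}

theorem continuous_of_holder {F : Type*} [NormedAddCommGroup F] {f : Sp d → F} (hα : 0 < α)
    (hf : ∀ x y, ‖f x - f y‖ ≤ H * ‖x - y‖ ^ α) : Continuous f := by
  refine continuous_iff_continuousAt.mpr fun x => ?_
  rw [ContinuousAt, tendsto_iff_norm_sub_tendsto_zero]
  have h : Filter.Tendsto (fun y : Sp d => H * ‖y - x‖ ^ α) (nhds x) (nhds 0) := by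
    have : Continuous fun y : Sp d => H * ‖y - x‖ ^ α :=
      continuous_const.mul
        ((continuous_norm.comp (continuous_id.sub continuous_const)).rpow_const
          fun _ => Or.inr hα.le)
    have h := this.tendsto x
    simpa [Real.zero_rpow hα.ne'] using h
  exact squeeze_zero (fun _ => norm_nonneg _) (fun y => hf y x) h

/-- A shift by `r • z` changes `g` by at most `H r^α ‖z‖^α`, so the kernel enters only through a
majorant of its moment of order `α`. -/
theorem norm_setIntegral_shift_le (hH : 0 ≤ H) (hg : ∀ x y, ‖g x - g y‖ ≤ H * ‖x - y‖ ^ α)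
    {r : ℝ} (hr : 0 ≤ r)
    {K : Sp d → ℝ} {M : Sp d → ℝ} (hM : Integrable M) (hKM : ∀ z, ‖z‖ ^ α * |K z| ≤ M z)
    (S : Finset (Fin d → ℤ)) (c : (Fin d → ℤ) → ℂ) :
    ‖∫ z, (K z : ℂ) * ∫ x in unitCell d, (g (x + r • z) - g x) * trig S c x‖
      ≤ (∫ z, M z) * r ^ α * H * cellL1 (trig S c) := by
  rw [mul_assoc, mul_assoc, ← integral_mul_const]
  refine norm_integral_le_of_norm_le (hM.mul_const _) (Filter.Eventually.of_forall fun z => ?_)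
  rw [norm_mul, Complex.norm_real, Real.norm_eq_abs]
  have h1 : ∀ x, ‖g (x + r • z) - g x‖ ≤ H * (r ^ α * ‖z‖ ^ α) := by
    intro x
    refine (hg _ _).trans_eq ?_
    rw [add_sub_cancel_left, norm_smul, Real.norm_of_nonneg hr,
      Real.mul_rpow hr (norm_nonneg z)]
  have h2 := norm_setIntegral_mul_le (g := fun x => g (x + r • z) - g x)
    (continuous_trig S c) h1
  calc _ ≤ |K z| * (H * (r ^ α * ‖z‖ ^ α) * cellL1 (trig S c)) := by gcongr
    _ = (‖z‖ ^ α * |K z|) * (r ^ α * (H * cellL1 (trig S c))) := by ring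
    _ ≤ _ := by
      have := cellL1_nonneg (trig S c)
      exact mul_le_mul_of_nonneg_right (hKM z) (by positivity)

theorem setIntegral_shift_sub {K : Sp d → ℝ} (hK : Integrable K) (hg : Continuous g)
    (hgp : IsPeriodic g) (r : ℝ) (S : Finset (Fin d → ℤ)) (c : (Fin d → ℤ) → ℂ) :
    ∫ z, (K z : ℂ) * ∫ x in unitCell d, (g (x + r • z) - g x) * trig S c x
      = (∫ z, (K z : ℂ) * ∫ x in unitCell d, g (x + r • z) * trig S c x)
        - ((∫ z, K z : ℝ) : ℂ) * ∫ x in unitCell d, g x * trig S c x := by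
  obtain ⟨A, hA⟩ := hgp.exists_bound hg
  obtain ⟨B, hB⟩ := (isPeriodic_trig S c).exists_bound (continuous_trig S c)
  have hc : ∀ z, Continuous fun x => g (x + r • z) * trig S c x := fun z =>
    (hg.comp (by fun_prop)).mul (continuous_trig S c)
  have h : ∀ z, ∫ x in unitCell d, (g (x + r • z) - g x) * trig S c x
      = (∫ x in unitCell d, g (x + r • z) * trig S c x)
        - ∫ x in unitCell d, g x * trig S c x := by
    intro z
    simp only [sub_mul]
    exact integral_sub (integrableOn_unitCell (hc z))
      (integrableOn_unitCell (hg.mul (continuous_trig S c)))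
  simp only [h, mul_sub]
  rw [integral_sub, integral_mul_const, integral_complex_ofReal]
  · have hint := integrable_prod_kernel hK
      (F := fun p : Sp d × Sp d => g (p.1 + r • p.2) * trig S c p.1)
      ((hg.comp (by fun_prop)).mul ((continuous_trig S c).comp continuous_fst))
      (B := A * B)
      (fun p => by
        rw [norm_mul]
        exact mul_le_mul (hA _) (hB _) (norm_nonneg _) ((norm_nonneg _).trans (hA 0)))
    refine hint.integral_prod_right.congr (Filter.Eventually.of_forall fun z => ?_)
    simp only [integral_const_mul]
  · exact hK.ofReal.mul_const _

/-- The cost `τ^(-1/2)` of a derivative improves by `τ^(α/2)` against an `α`-Hölder function,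
because `dgauss i` has mean zero. -/
theorem norm_setIntegral_mul_derivCoeff_le (hα : 0 < α) (hα1 : α ≤ 1) (hH : 0 ≤ H)
    (hg : ∀ x y, ‖g x - g y‖ ≤ H * ‖x - y‖ ^ α) (hgp : IsPeriodic g) {τ : ℝ} (hτ : 0 < τ)
    (i : Fin d) (S : Finset (Fin d → ℤ)) (c : (Fin d → ℤ) → ℂ) :
    ‖∫ x in unitCell d, g x * trig S (derivCoeff i (heatCoeff τ c)) x‖
      ≤ gaussMoment d (α + 1) * τ ^ ((α - 1) / 2) * H * cellL1 (trig S c) := by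
  have hgc := continuous_of_holder hα hg
  have h1 := norm_setIntegral_shift_le hH hg (Real.sqrt_nonneg τ) (K := dgauss i)
    (integrable_norm_rpow_mul_gauss (d := d) (s := α + 1) (by linarith) (by linarith))
    (fun z => by
      rw [Real.rpow_add_one' (norm_nonneg z) (by linarith), mul_assoc]
      exact mul_le_mul_of_nonneg_left (abs_dgauss_le i z) (by positivity)) S c
  rw [setIntegral_shift_sub (integrable_dgauss i) hgc hgp, integral_dgauss, Complex.ofReal_zero,
    zero_mul, sub_zero, ← setIntegral_mul_multiplier (integrable_dgauss i)
      (dgauss_multiplier hτ.le i) hgc hgp] at h1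
  rw [derivCoeff_heatCoeff_eq hτ]
  simp only [trig_const_mul, mul_left_comm (g _)]
  rw [integral_const_mul, norm_mul, norm_inv_sqrt hτ]
  calc _ ≤ τ ^ (-1 / 2 : ℝ) *
        ((∫ z : Sp d, ‖z‖ ^ (α + 1) * gauss z) * √τ ^ α * H * cellL1 (trig S c)) := by gcongr
    _ = gaussMoment d (α + 1) * (τ ^ (-1 / 2 : ℝ) * √τ ^ α) * H * cellL1 (trig S c) := by
        rw [gaussMoment]; ring
    _ = _ := by
        rw [Real.sqrt_eq_rpow, ← Real.rpow_mul hτ.le, ← Real.rpow_add hτ]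
        congr 4; ring

/-- This is the price of the mollifier: `gauss` has mass one, so the difference only involves
increments of `g` at scale `√τ`. -/
theorem norm_setIntegral_mul_sub_heatCoeff_le (hα : 0 < α) (hα1 : α ≤ 1) (hH : 0 ≤ H)
    (hg : ∀ x y, ‖g x - g y‖ ≤ H * ‖x - y‖ ^ α) (hgp : IsPeriodic g) {τ : ℝ} (hτ : 0 ≤ τ)
    (S : Finset (Fin d → ℤ)) (c : (Fin d → ℤ) → ℂ) :
    ‖(∫ x in unitCell d, g x * trig S (heatCoeff τ c) x) - ∫ x in unitCell d, g x * trig S c x‖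
      ≤ gaussMoment d α * τ ^ (α / 2) * H * cellL1 (trig S c) := by
  have hgc := continuous_of_holder hα hg
  have h1 := norm_setIntegral_shift_le hH hg (Real.sqrt_nonneg τ) (K := gauss)
    (integrable_norm_rpow_mul_gauss (d := d) (s := α) (by linarith) (by linarith))
    (fun z => by rw [abs_of_pos (gauss_pos z)]) S c
  rw [setIntegral_shift_sub integrable_gauss hgc hgp, integral_gauss, Complex.ofReal_one,
    one_mul, ← setIntegral_mul_multiplier integrable_gauss
      (gauss_multiplier hτ) hgc hgp, Real.sqrt_eq_rpow, ← Real.rpow_mul hτ,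
      one_div_mul_eq_div] at h1
  exact h1

end Holder

/-! ### The heat flow in the unit scale -/

section HeatFlow

variable {d : ℕ}

/-- The substitution `y = √s • z` puts all times under one kernel, so that flows at different times
can be subtracted inside one integral. The formula includes `s = 0`. -/
theorem heatFlow_eq {s : ℝ} (hs : 0 ≤ s) (f : Sp d → Sp d) (x : Sp d) :
    heatFlow s f x = ∫ z, gauss z • f (x - √s • z) := by
  rcases hs.eq_or_lt with rfl | hs
  · simp [heatFlow, integral_smul_const, integral_gauss]
  have hs' := Real.sqrt_pos.mpr hs
  have h := Measure.integral_comp_smul_of_nonneg (volume : Measure (Sp d))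
    (fun y => ((4 * Real.pi * s) ^ (-(d : ℝ) / 2) * Real.exp (-‖y‖ ^ 2 / (4 * s))) • f (x - y))
    (√s) (hR := hs'.le)
  rw [heatFlow, if_pos hs]
  rw [eq_comm, inv_smul_eq_iff₀ (by simp [hs'.ne'])] at h
  rw [h, ← integral_smul]
  congr 1; ext1 z
  rw [smul_smul]
  congr 1
  rw [gauss, norm_smul, Real.norm_of_nonneg hs'.le, mul_pow, Real.sq_sqrt hs.le, ← mul_assoc]
  congr 1
  · rw [Real.mul_rpow (by positivity) hs.le, mul_left_comm, Real.sqrt_eq_rpow,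
      ← Real.rpow_natCast, ← Real.rpow_mul hs.le, ← Real.rpow_add hs]
    simp only [neg_div, finrank_euclideanSpace, Fintype.card_fin, one_div]
    rw [show (2 : ℝ)⁻¹ * d + -(d / 2) = 0 by ring, Real.rpow_zero, mul_one]
  · congr 1
    field_simp

theorem integrable_gauss_smul {f : Sp d → Sp d} (hf : Continuous f) (hfp : IsPeriodic f)
    (x : Sp d) (r : ℝ) : Integrable fun z => gauss z • f (x - r • z) := by
  obtain ⟨B, hB⟩ := hfp.exists_bound hf
  exact integrable_gauss.smul_bdd B
    (hf.comp (by fun_prop)).aestronglyMeasurable (Filter.Eventually.of_forall fun z => hB _)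

theorem norm_heatFlow_sub_le {α H : ℝ} (hα : 0 < α) (hα1 : α ≤ 1)
    {f : Sp d → Sp d} (hf : ∀ x y, ‖f x - f y‖ ≤ H * ‖x - y‖ ^ α)
    (hfp : IsPeriodic f) {s t : ℝ} (hs : 0 ≤ s) (ht : 0 ≤ t) (x : Sp d) :
    ‖heatFlow s f x - heatFlow t f x‖ ≤ gaussMoment d α * |√s - √t| ^ α * H := by
  have hfc := continuous_of_holder hα hf
  rw [heatFlow_eq hs, heatFlow_eq ht, ← integral_sub (integrable_gauss_smul hfc hfp _ _)
    (integrable_gauss_smul hfc hfp _ _), gaussMoment, mul_assoc, ← integral_mul_const]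
  refine norm_integral_le_of_norm_le ((integrable_norm_rpow_mul_gauss (d := d) (s := α)
    (by linarith) (by linarith)).mul_const _) (Filter.Eventually.of_forall fun z => ?_)
  rw [← smul_sub, norm_smul, Real.norm_of_nonneg (gauss_pos z).le]
  have h := hf (x - √s • z) (x - √t • z)
  rw [sub_sub_sub_cancel_left, ← sub_smul, norm_smul, Real.norm_eq_abs, abs_sub_comm,
    Real.mul_rpow (abs_nonneg _) (norm_nonneg _)] at h
  calc _ ≤ gauss z * (H * (|√s - √t| ^ α * ‖z‖ ^ α)) :=
        mul_le_mul_of_nonneg_left h (gauss_pos z).le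
    _ = _ := by ring

theorem norm_heatFlow_sub_le' {α H : ℝ} (hα : 0 < α)
    {f : Sp d → Sp d} (hf : ∀ x y, ‖f x - f y‖ ≤ H * ‖x - y‖ ^ α)
    (hfp : IsPeriodic f) {s : ℝ} (hs : 0 ≤ s) (x y : Sp d) :
    ‖heatFlow s f x - heatFlow s f y‖ ≤ H * ‖x - y‖ ^ α := by
  have hfc := continuous_of_holder hα hf
  rw [heatFlow_eq hs, heatFlow_eq hs, ← integral_sub (integrable_gauss_smul hfc hfp _ _)
    (integrable_gauss_smul hfc hfp _ _)]
  calc _ ≤ ∫ z : Sp d, gauss z * (H * ‖x - y‖ ^ α) := by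
        refine norm_integral_le_of_norm_le (integrable_gauss.mul_const _)
          (Filter.Eventually.of_forall fun z => ?_)
        rw [← smul_sub, norm_smul, Real.norm_of_nonneg (gauss_pos z).le]
        have h := hf (x - √s • z) (y - √s • z)
        rw [sub_sub_sub_cancel_right] at h
        exact mul_le_mul_of_nonneg_left h (gauss_pos z).le
    _ = _ := by rw [integral_mul_const, integral_gauss, one_mul]

theorem isPeriodic_heatFlow {f : Sp d → Sp d} (hfp : IsPeriodic f) (s : ℝ) :
    IsPeriodic (heatFlow s f) := by
  intro i x
  simp only [heatFlow, add_sub_right_comm, hfp i]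

/-- Self-adjointness of the heat semigroup, from Fubini and the evenness of `gauss`; it links the
Gaussian convolution with the multiplier `heatCoeff`. -/
theorem setIntegral_heatFlow_mul_trig {f : Sp d → Sp d} (hf : Continuous f) (hfp : IsPeriodic f)
    {τ : ℝ} (hτ : 0 ≤ τ) (i : Fin d) (S : Finset (Fin d → ℤ)) (c : (Fin d → ℤ) → ℂ) :
    ∫ x in unitCell d, ((heatFlow τ f x i : ℝ) : ℂ) * trig S c x
      = ∫ x in unitCell d, ((f x i : ℝ) : ℂ) * trig S (heatCoeff τ c) x := by
  have hgc : Continuous fun x => ((f x i : ℝ) : ℂ) := by fun_prop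
  have hgp : IsPeriodic fun x => ((f x i : ℝ) : ℂ) := fun j x => by simp only [hfp j]
  obtain ⟨A, hA⟩ := hgp.exists_bound hgc
  obtain ⟨B, hB⟩ := (isPeriodic_trig S c).exists_bound (continuous_trig S c)
  have h := setIntegral_mul_multiplier integrable_gauss (gauss_multiplier hτ) hgc hgp S c
  refine Eq.trans ?_ h.symm
  simp only [← integral_const_mul]
  have h1 : ∀ x, ((heatFlow τ f x i : ℝ) : ℂ) * trig S c x
      = ∫ z, (gauss z : ℂ) * (((f (x + √τ • z) i : ℝ) : ℂ) * trig S c x) := by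
    intro x
    rw [heatFlow_eq hτ]
    have h2 := (EuclideanSpace.proj (𝕜 := ℝ) i : Sp d →L[ℝ] ℝ).integral_comp_comm
      (integrable_gauss_smul hf hfp x √τ)
    rw [show (∫ z, gauss z • f (x - √τ • z)) i
      = ∫ z, gauss z * f (x - √τ • z) i from h2.symm, ← integral_complex_ofReal, ← integral_mul_const, ← integral_neg_eq_self]
    congr 1; ext z
    simp [gauss_neg]
    ring
  simp only [h1]
  rw [integral_integral_swap]
  exact integrable_prod_kernel integrable_gauss
    (F := fun p : Sp d × Sp d => ((f (p.1 + √τ • p.2) i : ℝ) : ℂ) * trig S c p.1) (B := A * B)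
    ((hgc.comp (by fun_prop)).mul ((continuous_trig S c).comp continuous_fst))
    (fun p => by
      rw [norm_mul]
      exact mul_le_mul (hA _) (hB _) (norm_nonneg _) ((norm_nonneg _).trans (hA 0)))

end HeatFlow

/-! ### Density of trigonometric polynomials -/

theorem IsPeriodic.eq_of_coe_eq {d : ℕ} {F : Type*} {ψ : Sp d → F} (hψ : IsPeriodic ψ)
    {x y : Sp d} (h : ∀ i, (x i : UnitAddCircle) = (y i : UnitAddCircle)) : ψ x = ψ y := by
  have h' : ∀ i, ∃ m : ℤ, x i - y i = m := by
    intro i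
    have h1 : ((x i - y i : ℝ) : UnitAddCircle) = 0 := by
      rw [AddCircle.coe_sub, h i, sub_self]
    obtain ⟨m, hm⟩ := (AddCircle.coe_eq_zero_iff (p := (1 : ℝ))).mp h1
    exact ⟨m, by simpa using hm.symm⟩
  choose m hm using h'
  have h2 : x = y + ∑ i, m i • (EuclideanSpace.basisFun (Fin d) ℝ).toBasis i := by
    ext j
    have h3 : (∑ i, m i • (EuclideanSpace.basisFun (Fin d) ℝ).toBasis i) j = m j := by
      simp [Pi.single_apply]
    rw [PiLp.add_apply, h3, ← hm]; ring
  rw [h2]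
  refine hψ.add_of_mem_span (Submodule.sum_mem _ fun i _ => Submodule.smul_mem _ _ ?_) y
  exact Submodule.subset_span (mem_range_self i)

theorem mFourier_coe {d : ℕ} (n : Fin d → ℤ) (x : Sp d) :
    UnitAddTorus.mFourier n (fun i => (x i : UnitAddCircle)) = wave (freq n) x := by
  simp only [UnitAddTorus.mFourier, ContinuousMap.coe_mk, fourier_coe_apply, wave]
  rw [← Complex.exp_sum]
  congr 1
  rw [PiLp.inner_apply]
  push_cast
  rw [Finset.mul_sum]
  refine Finset.sum_congr rfl fun i _ => ?_
  simp
  ring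

theorem exists_trig_approx {d : ℕ} {ψ : Sp d → ℂ} (hψ : Continuous ψ) (hp : IsPeriodic ψ)
    {ε : ℝ} (hε : 0 < ε) :
    ∃ (S : Finset (Fin d → ℤ)) (c : (Fin d → ℤ) → ℂ), ∀ x, ‖ψ x - trig S c x‖ < ε := by
  let π : (Fin d → ℝ) → UnitAddTorus (Fin d) := fun x i => (x i : UnitAddCircle)
  have hπ : IsOpenQuotientMap π :=
    IsOpenQuotientMap.piMap fun _ => QuotientAddGroup.isOpenQuotientMap_mk
  -- Any section of the covering will do: by periodicity `F` does not depend on it, and continuity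
  -- of `F` comes from the quotient topology.
  let s := Function.surjInv hπ.surjective
  let F : UnitAddTorus (Fin d) → ℂ := fun y => ψ (WithLp.toLp 2 (s y))
  have hF : ∀ x : Sp d, F (π x) = ψ x := by
    intro x
    refine hp.eq_of_coe_eq fun i => ?_
    exact congrFun (Function.surjInv_eq hπ.surjective (π x)) i
  have hFc : Continuous F := by
    rw [hπ.isQuotientMap.continuous_iff]
    have : F ∘ π = fun x => ψ (WithLp.toLp 2 x) := by
      ext x; exact hF (WithLp.toLp 2 x)
    rw [this]
    fun_prop
  have hmem : (⟨F, hFc⟩ : C(UnitAddTorus (Fin d), ℂ)) ∈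
      (Submodule.span ℂ (range <| UnitAddTorus.mFourier (d := Fin d))).topologicalClosure := by
    rw [UnitAddTorus.span_mFourier_closure_eq_top]; trivial
  obtain ⟨p, hp1, hp2⟩ := Metric.mem_closure_iff.mp hmem ε hε
  obtain ⟨c, rfl⟩ := Finsupp.mem_span_range_iff_exists_finsupp.mp hp1
  refine ⟨c.support, c, fun x => ?_⟩
  have h := (ContinuousMap.dist_apply_le_dist (π x)).trans_lt hp2
  rw [dist_eq_norm] at h
  have h1 : (c.sum fun i a => a • UnitAddTorus.mFourier i) (π x) = trig c.support c x := by
    rw [Finsupp.sum, ContinuousMap.sum_apply]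
    simp only [trig, ContinuousMap.smul_apply, smul_eq_mul, ← mFourier_coe]
    rfl
  rw [h1] at h
  have h2 : (⟨F, hFc⟩ : C(UnitAddTorus (Fin d), ℂ)) (π x) = ψ x := hF x
  rwa [h2] at h

/-- Both sides are continuous in `ψ` for uniform convergence, and trigonometric polynomials are
uniformly dense. -/
theorem norm_setIntegral_mul_le_of_forall_trig {d : ℕ} {f : Sp d → ℂ} (hf : Continuous f)
    (hp : IsPeriodic f) {B : ℝ}
    (h : ∀ S c, ‖∫ x in unitCell d, f x * trig S c x‖ ≤ B * cellL1 (trig S c))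
    {ψ : Sp d → ℂ} (hψ : Continuous ψ) (hψp : IsPeriodic ψ) :
    ‖∫ x in unitCell d, f x * ψ x‖ ≤ B * cellL1 ψ := by
  obtain ⟨A, hA⟩ := hp.exists_bound hf
  have hA0 : 0 ≤ A := (norm_nonneg _).trans (hA 0)
  set V := volume.real (unitCell d)
  have hV : 0 ≤ V := measureReal_nonneg
  refine le_of_forall_pos_le_add fun δ hδ => ?_
  -- The errors are `A V ε` in the pairing and at most `|B| V ε` in the norm, where `B` may have any
  -- sign; the `+ 1` keeps the denominator positive.
  obtain ⟨S, c, hSc⟩ := exists_trig_approx hψ hψp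
    (ε := δ / (A * V + |B| * V + 1)) (by positivity)
  set ε := δ / (A * V + |B| * V + 1)
  have hε : 0 < ε := by positivity
  have hεδ : (A * V + |B| * V) * ε ≤ δ := by
    rw [show δ = (A * V + |B| * V + 1) * ε by simp only [ε]; field_simp]
    nlinarith
  have hd : Continuous fun x => ψ x - trig S c x := hψ.sub (continuous_trig S c)
  have h1 : cellL1 (fun x => ψ x - trig S c x) ≤ V * ε := by
    have := setIntegral_mono_on (integrableOn_unitCell hd.norm)
      (integrable_const ε : Integrable _ (volume.restrict (unitCell d)))
      (measurableSet_unitCell d) (fun x _ => (hSc x).le)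
    simpa [cellL1, V] using this
  have h2 := norm_setIntegral_mul_le hd hA
  have h3 : ∫ x in unitCell d, f x * (ψ x - trig S c x)
      = (∫ x in unitCell d, f x * ψ x) - ∫ x in unitCell d, f x * trig S c x := by
    simp only [mul_sub]
    exact integral_sub (integrableOn_unitCell (hf.mul hψ))
      (integrableOn_unitCell (hf.mul (continuous_trig S c)))
  have h4 : |cellL1 (trig S c) - cellL1 ψ| ≤ V * ε := by
    refine le_trans ?_ h1
    simp only [cellL1]
    rw [← integral_sub (integrableOn_unitCell (continuous_trig S c).norm)
      (integrableOn_unitCell hψ.norm), ← Real.norm_eq_abs]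
    refine norm_integral_le_of_norm_le (integrableOn_unitCell hd.norm)
      (Filter.Eventually.of_forall fun x => ?_)
    rw [norm_sub_rev (ψ x)]
    exact abs_norm_sub_norm_le _ _
  have h5 : B * (cellL1 (trig S c) - cellL1 ψ) ≤ |B| * (V * ε) := by
    refine (le_abs_self _).trans ?_
    rw [abs_mul]; gcongr
  have h6 := norm_sub_norm_le (∫ x in unitCell d, f x * ψ x)
    (∫ x in unitCell d, f x * trig S c x)
  rw [← h3] at h6
  have h7 := h S c
  have h8 : A * cellL1 (fun x => ψ x - trig S c x) ≤ A * (V * ε) := by gcongr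
  nlinarith

theorem IsPeriodic.eq_zero_of_setIntegral_sq_nonpos {d : ℕ} {ψ : Sp d → ℝ} (hψ : Continuous ψ)
    (hp : IsPeriodic ψ) (h : ∫ x in unitCell d, ψ x ^ 2 ≤ 0) (x : Sp d) : ψ x = 0 := by
  have h0 : ∫ x in unitCell d, ψ x ^ 2 = 0 :=
    le_antisymm h (integral_nonneg fun _ => sq_nonneg _)
  rw [integral_eq_zero_iff_of_nonneg (fun _ => sq_nonneg _)
    (integrableOn_unitCell (hψ.pow 2))] at h0
  have ho : IsOpen {x | ψ x ≠ 0} := isOpen_ne_fun hψ continuous_const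
  have h1 : volume ({x | ψ x ≠ 0} ∩ unitCell d) = 0 := by
    have := ae_iff.mp h0
    rw [Measure.restrict_apply₀' (measurableSet_unitCell d).nullMeasurableSet] at this
    simpa using this
  -- The set is invariant under the lattice and null in one cell, hence null; being open, it is
  -- empty.
  have h2 : volume {x | ψ x ≠ 0} = 0 := by
    have : VAddInvariantMeasure
        (Submodule.span ℤ (Set.range (EuclideanSpace.basisFun (Fin d) ℝ).toBasis)) (Sp d) volume :=
      inferInstanceAs (VAddInvariantMeasure (Submodule.span ℤ
        (Set.range (EuclideanSpace.basisFun (Fin d) ℝ).toBasis)).toAddSubgroup (Sp d) volume)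
    refine (isAddFundamentalDomain_unitCell d).measure_zero_of_invariant _ (fun g => ?_) h1
    have hg : ∀ x, ψ ((g : Sp d) + x) = ψ x := fun x => by
      rw [add_comm]; exact hp.add_of_mem_span g.2 x
    ext x
    rw [Set.mem_vadd_set_iff_neg_vadd_mem]
    have := hg (-g +ᵥ x)
    simp only [mem_ofPred_eq]
    rw [← this]
    congr! 2
    change (g : Sp d) + (-(g : Sp d) + x) = x
    abel
  have h3 := (ho.measure_eq_zero_iff volume).mp h2
  by_contra hx
  exact (h3 ▸ (hx : x ∈ {x | ψ x ≠ 0}) : x ∈ (∅ : Set (Sp d)))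

/-- Testing with the positive part `ψ` of `f - B` gives `∫ ψ² = ∫ f ψ - B ∫ ψ ≤ 0`, so `ψ` vanishes.
-/
theorem le_of_forall_trig {d : ℕ} {f : Sp d → ℝ} (hf : Continuous f) (hp : IsPeriodic f)
    {B : ℝ} (h : ∀ S c, ‖∫ x in unitCell d, (f x : ℂ) * trig S c x‖ ≤ B * cellL1 (trig S c))
    (x : Sp d) : f x ≤ B := by
  let ψ : Sp d → ℝ := fun x => max (f x - B) 0
  have hψ : Continuous ψ := (hf.sub continuous_const).max continuous_const
  have hψp : IsPeriodic ψ := fun i x => by simp only [ψ, hp i x]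
  have h1 := norm_setIntegral_mul_le_of_forall_trig (f := fun x => (f x : ℂ)) (by fun_prop)
    (fun i x => by simp only [hp i x]) h (ψ := fun x => (ψ x : ℂ)) (by fun_prop)
    (fun i x => by simp only [hψp i x])
  have h2 : ∫ x in unitCell d, (f x : ℂ) * (ψ x : ℂ)
      = ((∫ x in unitCell d, f x * ψ x : ℝ) : ℂ) := by
    rw [← integral_complex_ofReal]; push_cast; rfl
  have h3 : cellL1 (fun x => (ψ x : ℂ)) = ∫ x in unitCell d, ψ x := by
    simp only [cellL1, Complex.norm_real]
    congr 1; ext x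
    exact Real.norm_of_nonneg (le_max_right _ _)
  rw [h2, Complex.norm_real, h3] at h1
  have h4 : ∫ x in unitCell d, ψ x ^ 2
      = (∫ x in unitCell d, f x * ψ x) - B * ∫ x in unitCell d, ψ x := by
    rw [← integral_const_mul]
    refine Eq.trans ?_ (integral_sub (f := fun x => f x * ψ x) (g := fun x => B * ψ x)
      (integrableOn_unitCell (hf.mul hψ)) (integrableOn_unitCell (continuous_const.mul hψ)))
    congr 1; ext x
    rcases le_total (f x - B) 0 with h | h
    · simp [ψ, max_eq_right h]
    · simp only [ψ, max_eq_left h]; ring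
  have h5 := hψp.eq_zero_of_setIntegral_sq_nonpos hψ
    (by rw [h4]; linarith [Real.le_norm_self (∫ x in unitCell d, f x * ψ x)]) x
  have h6 := le_max_left (f x - B) 0
  simp only [ψ] at h5
  linarith

theorem abs_le_of_forall_trig {d : ℕ} {f : Sp d → ℝ} (hf : Continuous f) (hp : IsPeriodic f)
    {B : ℝ} (h : ∀ S c, ‖∫ x in unitCell d, (f x : ℂ) * trig S c x‖ ≤ B * cellL1 (trig S c))
    (x : Sp d) : |f x| ≤ B := by
  refine abs_le'.mpr ⟨le_of_forall_trig hf hp h x, ?_⟩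
  refine le_of_forall_trig (f := fun x => -f x) hf.neg (fun i x => by simp only [hp i x])
    (fun S c => ?_) x
  simp only [Complex.ofReal_neg, neg_mul, integral_neg, norm_neg]
  exact h S c

/-! ### The projected nonlinearity tested with trigonometric polynomials -/

/-- The projection of the `i`-th unit vector to the orthogonal complement of `ξ`. -/
noncomputable def leray {d : ℕ} (i : Fin d) (ξ : Sp d) : Sp d :=
  EuclideanSpace.single i 1 - (ξ i / ‖ξ‖ ^ 2) • ξ

/-- Orthogonality makes the plane wave with this polarization divergence free. At `ξ = 0` the
quotient in `leray` is zero by convention, so the mean is tested with the constant field `eᵢ`. -/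
theorem inner_leray {d : ℕ} (i : Fin d) (ξ : Sp d) : inner ℝ ξ (leray i ξ) = 0 := by
  rw [leray, inner_sub_right, inner_smul_right, EuclideanSpace.inner_single_right,
    real_inner_self_eq_norm_sq]
  rcases eq_or_ne ξ 0 with rfl | h
  · simp
  · have : ‖ξ‖ ≠ 0 := norm_ne_zero_iff.mpr h
    simp; field_simp; ring

theorem inner_leray_right {d : ℕ} (i : Fin d) (ξ w : Sp d) :
    inner ℝ w (leray i ξ) = w i - (ξ i / ‖ξ‖ ^ 2) * inner ℝ ξ w := by
  rw [leray, inner_sub_right, inner_smul_right, EuclideanSpace.inner_single_right,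
    real_inner_comm]
  simp

/-- The `n`-th Fourier mode of the `i`-th component of the projected nonlinearity `-P div (w ⊗ w)`,
tested with `wave`. -/
noncomputable def nonlinMode {d : ℕ} (w : Sp d → Sp d) (i : Fin d) (n : Fin d → ℤ) : ℂ :=
  ∫ x in unitCell d, Complex.I *
    ((inner ℝ (freq n) (w x) * inner ℝ (w x) (leray i (freq n)) : ℝ) : ℂ) * wave (freq n) x

/-- Fourier modes of the products `w_j w_k`. -/
noncomputable def prodMode {d : ℕ} (w : Sp d → Sp d) (j k : Fin d) (n : Fin d → ℤ) : ℂ :=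
  ∫ x in unitCell d, ((w x j * w x k : ℝ) : ℂ) * wave (freq n) x

/-- The first sum is the divergence of `w ⊗ w`; the second, with the symbol of order one homogeneous
in `ξ`, is the pressure. -/
theorem nonlinMode_eq {d : ℕ} {w : Sp d → Sp d} (hw : Continuous w) (i : Fin d)
    (n : Fin d → ℤ) :
    nonlinMode w i n = (∑ j, Complex.I * (freq n j : ℝ) * prodMode w j i n)
      - ∑ j, ∑ k, Complex.I * ((freq n j * freq n i * freq n k / ‖freq n‖ ^ 2 : ℝ) : ℂ)
        * prodMode w j k n := by
  have hint : ∀ (a : ℂ) (j k : Fin d), Integrable (fun x => a * (((w x j * w x k : ℝ) : ℂ)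
      * wave (freq n) x)) (volume.restrict (unitCell d)) := fun a j k =>
    integrableOn_unitCell (continuous_const.mul
      ((by fun_prop : Continuous fun x => ((w x j * w x k : ℝ) : ℂ)).mul (continuous_wave _)))
  simp only [prodMode, ← integral_const_mul]
  rw [← integral_finsetSum _ fun j _ => hint _ j i]
  rw [Finset.sum_congr rfl fun j _ => (integral_finsetSum Finset.univ
    (fun k _ => hint (Complex.I * ((freq n j * freq n i * freq n k / ‖freq n‖ ^ 2 : ℝ) : ℂ))
      j k)).symm,
    ← integral_finsetSum _ fun j _ => integrable_finsetSum _ fun k _ => hint _ j k,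
    ← integral_sub (integrable_finsetSum _ fun j _ => hint _ j i)
      (integrable_finsetSum _ fun j _ => integrable_finsetSum _ fun k _ => hint _ j k)]
  rw [nonlinMode]
  congr 1; ext x
  rw [inner_leray_right, PiLp.inner_apply]
  have h1 : ∀ j, inner ℝ (freq n j) (w x j) = freq n j * w x j := fun j => by
    simp [mul_comm]
  simp only [h1]
  have h2 : (∑ j, freq n j * w x j) * (w x i - freq n i / ‖freq n‖ ^ 2 * ∑ j, freq n j * w x j)
      = (∑ j, freq n j * (w x j * w x i))
        - ∑ j, ∑ k, (freq n j * freq n i * freq n k / ‖freq n‖ ^ 2) * (w x j * w x k) := by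
    rw [mul_sub, Finset.sum_mul, mul_left_comm, Finset.sum_mul_sum, Finset.mul_sum]
    congr 1
    · exact Finset.sum_congr rfl fun j _ => by ring
    · refine Finset.sum_congr rfl fun j _ => ?_
      rw [Finset.mul_sum]
      exact Finset.sum_congr rfl fun k _ => by ring
  rw [h2]
  push_cast
  rw [mul_sub, sub_mul, Finset.mul_sum, Finset.sum_mul, Finset.mul_sum, Finset.sum_mul]
  congr 1
  · exact Finset.sum_congr rfl fun j _ => by ring
  · refine Finset.sum_congr rfl fun j _ => ?_
    rw [Finset.mul_sum, Finset.sum_mul]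
    exact Finset.sum_congr rfl fun k _ => by ring

theorem hasDerivAt_heatCoeff {d : ℕ} (c : (Fin d → ℤ) → ℂ) (n : Fin d → ℤ) (ρ : ℝ) :
    HasDerivAt (fun ρ => heatCoeff ρ c n) (-((‖freq n‖ ^ 2 : ℝ) : ℂ) * heatCoeff ρ c n) ρ := by
  have h : HasDerivAt (fun ρ : ℝ => Real.exp (-(ρ * ‖freq n‖ ^ 2)))
      (Real.exp (-(ρ * ‖freq n‖ ^ 2)) * -(1 * ‖freq n‖ ^ 2)) ρ :=
    ((hasDerivAt_id ρ).mul_const _).neg.exp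
  convert! (h.ofReal_comp.mul_const (c n)) using 1
  simp only [heatCoeff]; push_cast; ring

/-! ### Bounds for the heat-smoothed projected nonlinearity -/

section Bounds

variable {d : ℕ} {α U H : ℝ} {w : Sp d → Sp d}

theorem holder_mul (hU : 0 ≤ U) (hwU : ∀ x, ‖w x‖ ≤ U)
    (hwH : ∀ x y, ‖w x - w y‖ ≤ H * ‖x - y‖ ^ α) (j k : Fin d) (x y : Sp d) :
    ‖((w x j * w x k : ℝ) : ℂ) - ((w y j * w y k : ℝ) : ℂ)‖ ≤ 2 * U * H * ‖x - y‖ ^ α := by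
  rw [← Complex.ofReal_sub, Complex.norm_real, Real.norm_eq_abs]
  have h1 : ∀ z i, |w z i| ≤ U := fun z i => (PiLp.norm_apply_le (w z) i).trans (hwU z)
  have h2 : ∀ i, |w x i - w y i| ≤ H * ‖x - y‖ ^ α := fun i =>
    (PiLp.norm_apply_le (w x - w y) i).trans (hwH x y)
  calc |w x j * w x k - w y j * w y k| = |(w x j - w y j) * w x k + w y j * (w x k - w y k)| := by
        congr 1; ring
    _ ≤ |w x j - w y j| * |w x k| + |w y j| * |w x k - w y k| := by
        rw [← abs_mul, ← abs_mul]; exact abs_add_le _ _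
    _ ≤ (H * ‖x - y‖ ^ α) * U + U * (H * ‖x - y‖ ^ α) := by
        have h0 : 0 ≤ H * ‖x - y‖ ^ α := (norm_nonneg _).trans (hwH x y)
        have := h2 j; have := h2 k; have := h1 x k; have := h1 y j
        gcongr
    _ = _ := by ring

theorem sum_heatCoeff_mul_prodMode (hw : Continuous w) (j k : Fin d) (S : Finset (Fin d → ℤ))
    (c : (Fin d → ℤ) → ℂ) :
    ∑ n ∈ S, c n * prodMode w j k n
      = ∫ x in unitCell d, ((w x j * w x k : ℝ) : ℂ) * trig S c x :=
  (setIntegral_mul_trig (by fun_prop) S c).symm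

/-- The heat time is split into three equal parts, one for each derivative. One derivative meets the
Hölder product and costs `(ρ/3)^((α-1)/2)`; the other two fall on the test polynomial and cost
`(ρ/3)^(-1/2)` each. -/
theorem norm_sum_third_deriv_le (hα : 0 < α) (hα1 : α < 1) (hU : 0 ≤ U) (hH : 0 ≤ H)
    (hwp : IsPeriodic w) (hwU : ∀ x, ‖w x‖ ≤ U)
    (hwH : ∀ x y, ‖w x - w y‖ ≤ H * ‖x - y‖ ^ α) (i j k : Fin d) {ρ : ℝ} (hρ : 0 < ρ)
    (S : Finset (Fin d → ℤ)) (c : (Fin d → ℤ) → ℂ) :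
    ‖∑ n ∈ S, derivCoeff j (derivCoeff i (derivCoeff k (heatCoeff ρ c))) n * prodMode w j k n‖
      ≤ (gaussMoment d (α + 1) * gaussMoment d 1 ^ 2 * 3 ^ ((3 - α) / 2) * 2)
        * ρ ^ ((α - 3) / 2) * (U * H * cellL1 (trig S c)) := by
  have hw := continuous_of_holder hα hwH
  have hρ3 : 0 < ρ / 3 := by positivity
  have hN := cellL1_nonneg (trig S c)
  have hM1 := gaussMoment_nonneg d 1
  have hM2 := gaussMoment_nonneg d (α + 1)
  have hsplit : derivCoeff j (derivCoeff i (derivCoeff k (heatCoeff ρ c)))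
      = derivCoeff j (heatCoeff (ρ / 3) (derivCoeff i (heatCoeff (ρ / 3)
        (derivCoeff k (heatCoeff (ρ / 3) c))))) := by
    simp only [heatCoeff_derivCoeff, heatCoeff_heatCoeff]
    congr 4; ring
  rw [sum_heatCoeff_mul_prodMode hw, hsplit]
  refine (norm_setIntegral_mul_derivCoeff_le hα hα1.le (by positivity)
    (holder_mul hU hwU hwH j k) (fun l x => by simp only [hwp l x]) hρ3 j S _).trans ?_
  have h1 := (cellL1_derivCoeff_heatCoeff_le hρ3 i S
    (derivCoeff k (heatCoeff (ρ / 3) c))).trans (mul_le_mul_of_nonneg_left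
      (cellL1_derivCoeff_heatCoeff_le hρ3 k S c) (by positivity))
  have hpow : (ρ / 3) ^ ((α - 1) / 2) * ((ρ / 3) ^ (-1 / 2 : ℝ)) * ((ρ / 3) ^ (-1 / 2 : ℝ))
      = 3 ^ ((3 - α) / 2) * ρ ^ ((α - 3) / 2) := by
    rw [← Real.rpow_add hρ3, ← Real.rpow_add hρ3, Real.div_rpow hρ.le (by norm_num),
      div_eq_mul_inv, ← Real.rpow_neg (by norm_num), mul_comm]
    congr 2 <;> ring
  calc _ ≤ gaussMoment d (α + 1) * (ρ / 3) ^ ((α - 1) / 2) * (2 * U * H) *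
        (gaussMoment d 1 * (ρ / 3) ^ (-1 / 2 : ℝ) *
          (gaussMoment d 1 * (ρ / 3) ^ (-1 / 2 : ℝ) * cellL1 (trig S c))) :=
        mul_le_mul_of_nonneg_left h1 (by positivity)
    _ = gaussMoment d (α + 1) * gaussMoment d 1 ^ 2 * 2 * ((ρ / 3) ^ ((α - 1) / 2)
        * ((ρ / 3) ^ (-1 / 2 : ℝ)) * ((ρ / 3) ^ (-1 / 2 : ℝ)))
        * (U * H * cellL1 (trig S c)) := by ring
    _ = _ := by rw [hpow]; ring

/-- Differentiating in the heat time multiplies by `-|ξ|²` and cancels the denominator, which leaves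
three derivatives. Since the sum tends to zero as the heat time grows, it is minus the integral of
its derivative over `(ρ, ∞)`, and the third-derivative bound is integrable there. -/
theorem norm_sum_pressure_le (hα : 0 < α) (hα1 : α < 1) (hU : 0 ≤ U) (hH : 0 ≤ H)
    (hwp : IsPeriodic w) (hwU : ∀ x, ‖w x‖ ≤ U)
    (hwH : ∀ x y, ‖w x - w y‖ ≤ H * ‖x - y‖ ^ α) (i j k : Fin d) {ρ : ℝ} (hρ : 0 < ρ)
    (S : Finset (Fin d → ℤ)) (c : (Fin d → ℤ) → ℂ) :
    ‖∑ n ∈ S, heatCoeff ρ c n * (Complex.I *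
        ((freq n j * freq n i * freq n k / ‖freq n‖ ^ 2 : ℝ) : ℂ) * prodMode w j k n)‖
      ≤ (gaussMoment d (α + 1) * gaussMoment d 1 ^ 2 * 3 ^ ((3 - α) / 2) * 2 * (2 / (1 - α)))
        * ρ ^ ((α - 1) / 2) * (U * H * cellL1 (trig S c)) := by
  set A := (gaussMoment d (α + 1) * gaussMoment d 1 ^ 2 * 3 ^ ((3 - α) / 2) * 2)
  set F : ℝ → ℂ := fun r => ∑ n ∈ S, heatCoeff r c n * (Complex.I *
        ((freq n j * freq n i * freq n k / ‖freq n‖ ^ 2 : ℝ) : ℂ) * prodMode w j k n)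
  set F' : ℝ → ℂ := fun r =>
    ∑ n ∈ S, derivCoeff j (derivCoeff i (derivCoeff k (heatCoeff r c))) n * prodMode w j k n
  have hd : ∀ r, HasDerivAt F (F' r) r := by
    intro r
    refine (HasDerivAt.fun_sum fun n _ =>
      (hasDerivAt_heatCoeff c n r).mul_const _).congr_deriv ?_
    refine Finset.sum_congr rfl fun n _ => ?_
    have hI : Complex.I * Complex.I = -1 := Complex.I_mul_I
    simp only [derivCoeff]
    -- At zero frequency both the pressure symbol (a quotient by zero) and the third derivative
    -- vanish.
    rcases eq_or_ne (freq n) 0 with h0 | h0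
    · simp only [h0]; simp
    · have : ((‖freq n‖ : ℝ) : ℂ) ≠ 0 := by exact_mod_cast norm_ne_zero_iff.mpr h0
      push_cast
      field_simp
      linear_combination (-(freq n j * freq n i * freq n k : ℂ)
        * heatCoeff r c n * prodMode w j k n) * hI
  have hlim : Filter.Tendsto F Filter.atTop (nhds 0) := by
    rw [show (0 : ℂ) = ∑ n ∈ S, 0 by simp]
    refine tendsto_finsetSum _ fun n _ => ?_
    rcases eq_or_ne (freq n) 0 with h0 | h0
    · simp only [h0]; simp
    · have hpos : 0 < ‖freq n‖ ^ 2 := by positivity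
      have h1 : Filter.Tendsto (fun r : ℝ => Real.exp (-(r * ‖freq n‖ ^ 2))) Filter.atTop
          (nhds 0) :=
        Real.tendsto_exp_neg_atTop_nhds_zero.comp (Filter.tendsto_id.atTop_mul_const hpos)
      have h2 := (((Complex.continuous_ofReal.tendsto 0).comp h1).mul_const (c n)).mul_const
        (Complex.I * ((freq n j * freq n i * freq n k / ‖freq n‖ ^ 2 : ℝ) : ℂ)
          * prodMode w j k n)
      simpa [heatCoeff] using h2
  have hbd : ∀ r ∈ Ioi ρ, ‖F' r‖ ≤ A * r ^ ((α - 3) / 2) * (U * H * cellL1 (trig S c)) :=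
    fun r hr => norm_sum_third_deriv_le hα hα1 hU hH hwp hwU hwH i j k (hρ.trans hr) S c
  have hexp : (α - 3) / 2 < -1 := by linarith
  have hmaj : IntegrableOn (fun r : ℝ => A * r ^ ((α - 3) / 2) * (U * H * cellL1 (trig S c)))
      (Ioi ρ) := ((integrableOn_Ioi_rpow_of_lt hexp hρ).const_mul A).mul_const _
  have hF'c : Continuous F' := by
    refine continuous_finsetSum _ fun n _ => ?_
    simp only [derivCoeff, heatCoeff]
    fun_prop
  have hF'i : IntegrableOn F' (Ioi ρ) :=
    Integrable.mono' hmaj hF'c.aestronglyMeasurable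
      ((ae_restrict_iff' measurableSet_Ioi).mpr (Filter.Eventually.of_forall hbd))
  have hint := integral_Ioi_of_hasDerivAt_of_tendsto' (fun r _ => hd r) hF'i hlim
  rw [zero_sub] at hint
  change ‖F ρ‖ ≤ _
  rw [← norm_neg, ← hint]
  refine (norm_integral_le_of_norm_le hmaj
    ((ae_restrict_iff' measurableSet_Ioi).mpr (Filter.Eventually.of_forall hbd))).trans_eq ?_
  rw [integral_mul_const, integral_const_mul, integral_Ioi_rpow_of_lt hexp hρ]
  have h3 : (α - 3) / 2 + 1 = (α - 1) / 2 := by ring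
  rw [h3]
  have h4 : α - 1 ≠ 0 := by linarith
  have h5 : 1 - α ≠ 0 := by linarith
  have h6 : -ρ ^ ((α - 1) / 2) / ((α - 1) / 2) = 2 / (1 - α) * ρ ^ ((α - 1) / 2) := by
    field_simp; ring
  rw [h6]; ring

/-- Testing `e^{ρΔ} (-P div (w ⊗ w))` with a trigonometric polynomial. -/
noncomputable def nonlinPairing (w : Sp d → Sp d) (i : Fin d) (S : Finset (Fin d → ℤ))
    (c : (Fin d → ℤ) → ℂ) (ρ : ℝ) : ℂ :=
  ∑ n ∈ S, heatCoeff ρ c n * nonlinMode w i n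

theorem exists_norm_nonlinPairing_le (d : ℕ) (hα : 0 < α) (hα1 : α < 1) :
    ∃ C : ℝ, 0 ≤ C ∧ ∀ (U H : ℝ) (w : Sp d → Sp d), 0 ≤ U → 0 ≤ H →
      IsPeriodic w → (∀ x, ‖w x‖ ≤ U) → (∀ x y, ‖w x - w y‖ ≤ H * ‖x - y‖ ^ α) →
      ∀ (i : Fin d) (S : Finset (Fin d → ℤ)) (c : (Fin d → ℤ) → ℂ) (ρ : ℝ), 0 < ρ →
        ‖nonlinPairing w i S c ρ‖ ≤ C * ρ ^ ((α - 1) / 2) * (U * H * cellL1 (trig S c)) := by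
  set A := (gaussMoment d (α + 1) * gaussMoment d 1 ^ 2 * 3 ^ ((3 - α) / 2) * 2 * (2 / (1 - α)))
  have hM1 := gaussMoment_nonneg d 1
  have hM2 := gaussMoment_nonneg d (α + 1)
  have h1α : 0 < 1 - α := by linarith
  have hA : 0 ≤ A := by positivity
  refine ⟨d * (2 * gaussMoment d (α + 1)) + d * (d * A), by positivity, ?_⟩
  intro U H w hU hH hwp hwU hwH i S c ρ hρ
  have hw := continuous_of_holder hα hwH
  set N := U * H * cellL1 (trig S c)
  have h1 : nonlinPairing w i S c ρ
      = (∑ j, ∫ x in unitCell d,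
          ((w x j * w x i : ℝ) : ℂ) * trig S (derivCoeff j (heatCoeff ρ c)) x)
        - ∑ j, ∑ k, ∑ n ∈ S, heatCoeff ρ c n * (Complex.I *
        ((freq n j * freq n i * freq n k / ‖freq n‖ ^ 2 : ℝ) : ℂ) * prodMode w j k n) := by
    simp only [nonlinPairing, nonlinMode_eq hw, mul_sub, Finset.sum_sub_distrib, Finset.mul_sum]
    congr 1
    · rw [Finset.sum_comm]
      refine Finset.sum_congr rfl fun j _ => ?_
      rw [← sum_heatCoeff_mul_prodMode hw]
      refine Finset.sum_congr rfl fun n _ => ?_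
      simp only [derivCoeff]; ring
    · rw [Finset.sum_comm]
      exact Finset.sum_congr rfl fun j _ => Finset.sum_comm
  rw [h1]
  refine (norm_sub_le _ _).trans ?_
  rw [add_mul, add_mul]
  refine add_le_add ?_ ?_
  · refine (norm_sum_le_of_le
      (n := fun _ => 2 * gaussMoment d (α + 1) * ρ ^ ((α - 1) / 2) * N) _ fun j _ => ?_).trans_eq ?_
    · refine (norm_setIntegral_mul_derivCoeff_le hα hα1.le (by positivity)
        (holder_mul hU hwU hwH j i) (fun l x => by simp only [hwp l x]) hρ j S c).trans_eq ?_
      simp only [N]; ring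
    · simp; ring
  · refine (norm_sum_le_of_le (n := fun _ => d * (A * ρ ^ ((α - 1) / 2) * N)) _
      fun j _ => ?_).trans_eq ?_
    · refine (norm_sum_le_of_le (n := fun _ => A * ρ ^ ((α - 1) / 2) * N) _
        fun k _ => ?_).trans_eq ?_
      · exact norm_sum_pressure_le hα hα1 hU hH hwp hwU hwH i j k hρ S c
      · simp
    · simp; ring

/-- The derivative in the heat time is a Laplacian. With `ρ = ρ/2 + ρ/4 + ρ/4` it becomes the same
pairing at time `ρ/2` against a smoothed second derivative of the test polynomial, so the bound for
the pairing itself can be reused. -/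
theorem hasDerivAt_nonlinPairing (w : Sp d → Sp d) (i : Fin d) (S : Finset (Fin d → ℤ))
    (c : (Fin d → ℤ) → ℂ) (ρ : ℝ) :
    HasDerivAt (nonlinPairing w i S c) (∑ j, nonlinPairing w i S
      (derivCoeff j (heatCoeff (ρ / 4) (derivCoeff j (heatCoeff (ρ / 4) c)))) (ρ / 2)) ρ := by
  refine (HasDerivAt.fun_sum fun n _ => (hasDerivAt_heatCoeff c n ρ).mul_const _).congr_deriv ?_
  simp only [nonlinPairing, heatCoeff_derivCoeff, heatCoeff_heatCoeff]
  rw [Finset.sum_comm]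
  refine Finset.sum_congr rfl fun n _ => ?_
  rw [← Finset.sum_mul]
  congr 1
  rw [show ρ / 2 + (ρ / 4 + ρ / 4) = ρ by ring, EuclideanSpace.real_norm_sq_eq]
  simp only [derivCoeff]
  push_cast
  rw [← Finset.sum_neg_distrib, Finset.sum_mul]
  refine Finset.sum_congr rfl fun j _ => ?_
  linear_combination (-(freq n j : ℂ) ^ 2 * heatCoeff ρ c n) * Complex.I_mul_I

theorem exists_norm_deriv_nonlinPairing_le (d : ℕ) (hα : 0 < α) (hα1 : α < 1) :
    ∃ C : ℝ, 0 ≤ C ∧ ∀ (U H : ℝ) (w : Sp d → Sp d), 0 ≤ U → 0 ≤ H →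
      IsPeriodic w → (∀ x, ‖w x‖ ≤ U) → (∀ x y, ‖w x - w y‖ ≤ H * ‖x - y‖ ^ α) →
      ∀ (i : Fin d) (S : Finset (Fin d → ℤ)) (c : (Fin d → ℤ) → ℂ) (ρ : ℝ), 0 < ρ →
        ‖deriv (nonlinPairing w i S c) ρ‖
          ≤ C * ρ ^ ((α - 3) / 2) * (U * H * cellL1 (trig S c)) := by
  obtain ⟨C, hC, h⟩ := exists_norm_nonlinPairing_le d hα hα1
  have hM1 := gaussMoment_nonneg d 1
  refine ⟨d * (C * gaussMoment d 1 ^ 2 * (2⁻¹ ^ ((α - 1) / 2) * 4)), by positivity, ?_⟩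
  intro U H w hU hH hwp hwU hwH i S c ρ hρ
  rw [(hasDerivAt_nonlinPairing w i S c ρ).deriv]
  have hN := cellL1_nonneg (trig S c)
  have hρ4 : 0 < ρ / 4 := by positivity
  have hρ2 : 0 < ρ / 2 := by positivity
  have hpow : (ρ / 2) ^ ((α - 1) / 2) * ((ρ / 4) ^ (-1 / 2 : ℝ) * (ρ / 4) ^ (-1 / 2 : ℝ))
      = 2⁻¹ ^ ((α - 1) / 2) * 4 * ρ ^ ((α - 3) / 2) := by
    rw [← Real.rpow_add hρ4, show (-1 / 2 : ℝ) + -1 / 2 = -1 by norm_num, Real.rpow_neg_one,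
      div_eq_mul_inv ρ 2, Real.mul_rpow hρ.le (by norm_num), inv_div,
      show (α - 3) / 2 = (α - 1) / 2 - 1 by ring, Real.rpow_sub_one hρ.ne']
    ring
  refine (norm_sum_le_of_le (n := fun _ => (C * gaussMoment d 1 ^ 2 *
    (2⁻¹ ^ ((α - 1) / 2) * 4)) * ρ ^ ((α - 3) / 2) * (U * H * cellL1 (trig S c))) _
    fun j _ => ?_).trans_eq ?_
  · refine (h U H w hU hH hwp hwU hwH i S _ (ρ / 2) hρ2).trans ?_
    have h1 := (cellL1_derivCoeff_heatCoeff_le hρ4 j S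
      (derivCoeff j (heatCoeff (ρ / 4) c))).trans (mul_le_mul_of_nonneg_left
        (cellL1_derivCoeff_heatCoeff_le hρ4 j S c) (by positivity))
    calc _ ≤ C * (ρ / 2) ^ ((α - 1) / 2) * (U * H * (gaussMoment d 1 * (ρ / 4) ^ (-1 / 2 : ℝ) *
          (gaussMoment d 1 * (ρ / 4) ^ (-1 / 2 : ℝ) * cellL1 (trig S c)))) := by gcongr
      _ = C * gaussMoment d 1 ^ 2 * ((ρ / 2) ^ ((α - 1) / 2) *
          ((ρ / 4) ^ (-1 / 2 : ℝ) * (ρ / 4) ^ (-1 / 2 : ℝ)))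
          * (U * H * cellL1 (trig S c)) := by ring
      _ = _ := by rw [hpow]; ring
  · simp; ring

end Bounds

/-! ### A du Bois-Reymond lemma with initial value -/

theorem measurableSet_openTime (s : ℝ) (T : EReal) : MeasurableSet (openTime s T) :=
  (measurableSet_Ioi (a := s)).inter (measurable_coe_real_ereal measurableSet_Iio)

theorem isOpen_openTime (s : ℝ) (T : EReal) : IsOpen (openTime s T) :=
  (isOpen_Ioi (a := s)).inter (isOpen_Iio.preimage continuous_coe_real_ereal)

theorem Ioc_subset_openTime {T : EReal} {b : ℝ} (hb : (b : EReal) < T) :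
    Ioc 0 b ⊆ openTime 0 T := fun _ ht =>
  ⟨ht.1, (EReal.coe_le_coe_iff.mpr ht.2).trans_lt hb⟩

theorem exists_bound_openTime {T : EReal} (hT : 0 < T) {s : Set ℝ} (hs : IsCompact s)
    (hsT : s ⊆ openTime 0 T) : ∃ b : ℝ, 0 < b ∧ (b : EReal) < T ∧ ∀ t ∈ s, t < b := by
  rcases s.eq_empty_or_nonempty with rfl | hne
  · obtain ⟨b, hb, hbT⟩ := EReal.lt_iff_exists_real_btwn.mp hT
    exact ⟨b, by exact_mod_cast hb, hbT, by simp⟩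
  · obtain ⟨t, ht, hmax⟩ := hs.exists_isMaxOn hne continuousOn_id
    obtain ⟨b, hb, hbT⟩ := EReal.lt_iff_exists_real_btwn.mp (hsT ht).2
    have hb' : t < b := by exact_mod_cast hb
    exact ⟨b, (hsT ht).1.trans hb', hbT, fun r hr => (hmax hr).trans_lt hb'⟩

/-- As `k` is merely integrable, this is integration by parts for absolutely continuous functions.
The boundary terms vanish at `b` through `θ` and at `0` through the primitive. -/
theorem intervalIntegral_mul_primitive {θ χ k : ℝ → ℝ} {b : ℝ}
    (hθ : ∀ t, HasDerivAt θ (χ t) t) (hχ : Continuous χ) (hk : IntervalIntegrable k volume 0 b)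
    (hθb : θ b = 0) :
    ∫ t in 0..b, θ t * k t = -∫ t in 0..b, χ t * ∫ s in 0..t, k s := by
  have hθ' : deriv θ = χ := funext fun t => (hθ t).deriv
  have h1 : AbsolutelyContinuousOnInterval θ 0 b := by
    refine ContDiffOn.absolutelyContinuousOnInterval (ContDiff.contDiffOn ?_)
    rw [contDiff_one_iff_deriv, hθ']
    exact ⟨fun t => (hθ t).differentiableAt, hχ⟩
  have h2 := hk.absolutelyContinuousOnInterval_intervalIntegral (c := 0) (by simp)
  have h3 := h1.integral_mul_deriv_eq_deriv_mul h2
  rw [hθ', hθb, intervalIntegral.integral_same] at h3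
  simp only [zero_mul, mul_zero, sub_zero, zero_sub] at h3
  rw [← h3]
  refine intervalIntegral.integral_congr_ae ?_
  filter_upwards [hk.ae_hasDerivAt_integral] with t ht htm
  rw [(ht (uIoc_subset_uIcc htm) 0 (by simp)).deriv]

/-- The test functions are primitives of arbitrary bumps `χ` supported in the open interval.
Integration by parts then leaves `χ` integrated against `h - h₀ - ∫ k`, which must vanish. -/
theorem ae_eq_primitive_of_weak {T : EReal} (hT : 0 < T) {h k : ℝ → ℝ} {h₀ : ℝ}
    (hh : ∀ b : ℝ, (b : EReal) < T → IntegrableOn h (Ioc 0 b))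
    (hk : ∀ b : ℝ, (b : EReal) < T → IntegrableOn k (Ioc 0 b))
    (hw : ∀ θ : ℝ → ℝ, ContDiff ℝ ∞ θ → (∃ b : ℝ, (b : EReal) < T ∧ ∀ t, b ≤ t → θ t = 0) →
      (∫ t in openTime 0 T, (deriv θ t * h t + θ t * k t)) + θ 0 * h₀ = 0) :
    ∀ᵐ t ∂(volume.restrict (openTime 0 T)), h t = h₀ + ∫ s in 0..t, k s := by
  have hkc : ∀ b : ℝ, 0 ≤ b → (b : EReal) < T →
      ContinuousOn (fun t => ∫ s in 0..t, k s) (Icc 0 b) := by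
    intro b hb hbT
    have := intervalIntegral.continuousOn_primitive_interval (a := 0) (b := b) (μ := volume)
      (f := k) (by
        rw [uIcc_of_le hb, integrableOn_Icc_iff_integrableOn_Ioc]
        exact hk b hbT)
    rwa [uIcc_of_le hb] at this
  have key : ∀ᵐ t, t ∈ openTime 0 T → h t - (h₀ + ∫ s in 0..t, k s) = 0 := by
    refine (isOpen_openTime 0 T).ae_eq_zero_of_integral_contDiff_smul_eq_zero ?_ ?_
    · intro t ht
      obtain ⟨b, hb, hbT⟩ := EReal.lt_iff_exists_real_btwn.mp ht.2
      have hb' : t < b := by exact_mod_cast hb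
      have hb0 : 0 ≤ b := (ht.1.trans hb').le
      refine ⟨Ioc 0 b, mem_nhdsWithin_of_mem_nhds (Ioc_mem_nhds ht.1 hb'), ?_⟩
      refine (hh b hbT).sub ((integrableOn_const (by simp)).add ?_)
      exact ((hkc b hb0 hbT).integrableOn_Icc).mono_set Ioc_subset_Icc_self
    · intro χ hχ hχc hχs
      obtain ⟨b, hb0, hbT, hb⟩ := exists_bound_openTime hT hχc hχs
      have hχz : ∀ t, b ≤ t → χ t = 0 := fun t ht =>
        image_eq_zero_of_notMem_tsupport fun hmem => (hb t hmem).not_ge ht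
      have hχ0 : ∀ t, t ≤ 0 → χ t = 0 := fun t ht =>
        image_eq_zero_of_notMem_tsupport fun hmem => ((hχs hmem).1).not_ge ht
      -- Starting the primitive at `b` makes `θ` vanish late, as a test function must, and gives `θ
      -- 0 = -∫ χ`, which brings in the initial value.
      let θ : ℝ → ℝ := fun t => ∫ s in b..t, χ s
      have hθd : ∀ t, HasDerivAt θ (χ t) t := fun t =>
        intervalIntegral.integral_hasDerivAt_right (hχ.continuous.intervalIntegrable _ _)
          hχ.continuous.stronglyMeasurable.stronglyMeasurableAtFilter hχ.continuous.continuousAt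
      have hθ' : deriv θ = χ := funext fun t => (hθd t).deriv
      have hθ : ContDiff ℝ ∞ θ := by
        rw [contDiff_infty_iff_deriv, hθ']
        exact ⟨fun t => (hθd t).differentiableAt, hχ⟩
      have hθz : ∀ t, b ≤ t → θ t = 0 := by
        intro t ht
        refine intervalIntegral.integral_zero_ae (Filter.Eventually.of_forall fun s hs => ?_)
        rw [uIoc_of_le ht] at hs
        exact hχz s hs.1.le
      have h1 := hw θ hθ ⟨b, hbT, hθz⟩
      rw [hθ'] at h1
      have hres : ∀ {f : ℝ → ℝ}, (∀ t, b ≤ t → f t = 0) →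
          ∫ t in openTime 0 T, f t = ∫ t in 0..b, f t := by
        intro f hf
        rw [intervalIntegral.integral_of_le hb0.le]
        refine setIntegral_eq_of_subset_of_forall_sdiff_eq_zero (measurableSet_openTime 0 T)
          (Ioc_subset_openTime hbT) fun t ht => hf t ?_
        by_contra hlt
        exact ht.2 ⟨ht.1.1, (not_le.mp hlt).le⟩
      rw [hres fun t ht => by rw [hχz t ht, hθz t ht]; simp] at h1
      have hhi : IntervalIntegrable h volume 0 b :=
        (intervalIntegrable_iff_integrableOn_Ioc_of_le hb0.le).mpr (hh b hbT)
      have hki : IntervalIntegrable k volume 0 b :=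
        (intervalIntegrable_iff_integrableOn_Ioc_of_le hb0.le).mpr (hk b hbT)
      have hχh : IntervalIntegrable (fun t => χ t * h t) volume 0 b :=
        hhi.continuousOn_mul hχ.continuous.continuousOn
      have hθk : IntervalIntegrable (fun t => θ t * k t) volume 0 b :=
        hki.continuousOn_mul hθ.continuous.continuousOn
      have hKc : ContinuousOn (fun t => ∫ s in 0..t, k s) (uIcc 0 b) := by
        rw [uIcc_of_le hb0.le]; exact hkc b hb0.le hbT
      have hχK : IntervalIntegrable (fun t => χ t * ∫ s in 0..t, k s) volume 0 b :=
        (hχ.continuous.continuousOn.mul hKc).intervalIntegrable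
      have hχ1 : IntervalIntegrable (fun t => χ t * h₀) volume 0 b :=
        (hχ.continuous.mul continuous_const).intervalIntegrable _ _
      rw [intervalIntegral.integral_add hχh hθk,
        intervalIntegral_mul_primitive hθd hχ.continuous hki (hθz b le_rfl)] at h1
      have hθ0 : θ 0 = -∫ t in 0..b, χ t := intervalIntegral.integral_symm _ _
      have h2 : ∫ t, χ t • (h t - (h₀ + ∫ s in 0..t, k s))
          = ∫ t in 0..b, χ t • (h t - (h₀ + ∫ s in 0..t, k s)) := by
        rw [intervalIntegral.integral_of_le hb0.le, setIntegral_eq_integral_of_forall_compl_eq_zero]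
        intro t ht
        have : χ t = 0 := by
          rcases le_or_gt t 0 with h | h
          · exact hχ0 t h
          · exact hχz t (le_of_not_ge fun hle => ht ⟨h, hle⟩)
        rw [this, zero_smul]
      rw [h2]
      have h3 : (fun t => χ t • (h t - (h₀ + ∫ s in 0..t, k s)))
          = fun t => χ t * h t - (χ t * h₀ + χ t * ∫ s in 0..t, k s) := by
        ext t; rw [smul_eq_mul]; ring
      rw [h3, intervalIntegral.integral_sub hχh (hχ1.add hχK),
        intervalIntegral.integral_add hχ1 hχK, intervalIntegral.integral_mul_const]
      rw [hθ0] at h1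
      linarith
  rw [ae_restrict_iff' (measurableSet_openTime 0 T)]
  filter_upwards [key] with t ht htm
  exact sub_eq_zero.mp (ht htm)

/-! ### Measurability and bounds of the velocity -/

theorem restrict_openTime_prod (d : ℕ) (T : EReal) (s : Set (Sp d)) :
    (volume : Measure (ℝ × Sp d)).restrict (openTime 0 T ×ˢ s)
      = (volume.restrict (openTime 0 T)).prod (volume.restrict s) := by
  rw [Measure.volume_eq_prod, Measure.prod_restrict]

theorem aestronglyMeasurable_comp {d : ℕ} {T : EReal} {u : ℝ → Sp d → Sp d}
    (hu : AEStronglyMeasurable (Function.uncurry u)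
      (volume.restrict (openTime 0 T ×ˢ (univ : Set (Sp d)))))
    {E : Type*} [NormedAddCommGroup E] {G : Sp d × Sp d → E} (hG : Continuous G) :
    AEStronglyMeasurable (fun p : ℝ × Sp d => G (u p.1 p.2, p.2))
      ((volume.restrict (openTime 0 T)).prod (volume.restrict (unitCell d))) := by
  have h1 : AEStronglyMeasurable (Function.uncurry u)
      ((volume.restrict (openTime 0 T)).prod (volume.restrict (unitCell d))) := by
    rw [← restrict_openTime_prod]
    exact hu.mono_measure (Measure.restrict_mono (prod_mono_right (subset_univ _)) le_rfl)
  exact hG.comp_aestronglyMeasurable (h1.prodMk measurable_snd.aestronglyMeasurable)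

theorem aestronglyMeasurable_setIntegral_comp {d : ℕ} {T : EReal} {u : ℝ → Sp d → Sp d}
    (hu : AEStronglyMeasurable (Function.uncurry u)
      (volume.restrict (openTime 0 T ×ˢ (univ : Set (Sp d)))))
    {E : Type*} [NormedAddCommGroup E] [NormedSpace ℝ E] {G : Sp d × Sp d → E}
    (hG : Continuous G) :
    AEStronglyMeasurable (fun t => ∫ x in unitCell d, G (u t x, x))
      (volume.restrict (openTime 0 T)) :=
  (aestronglyMeasurable_comp hu hG).integral_prod_right'

theorem ae_prod_of_ae_forall {d : ℕ} {T : EReal} {P : ℝ → Prop}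
    (h : ∀ᵐ t ∂(volume.restrict (openTime 0 T)), P t) (s : Set (Sp d)) :
    ∀ᵐ p ∂((volume.restrict (openTime 0 T)).prod (volume.restrict s)), P p.1 :=
  Measure.quasiMeasurePreserving_fst.ae h

theorem integrable_mul_comp {d : ℕ} {T : EReal} {u : ℝ → Sp d → Sp d}
    (hu : AEStronglyMeasurable (Function.uncurry u)
      (volume.restrict (openTime 0 T ×ˢ (univ : Set (Sp d)))))
    {G : Sp d × Sp d → ℝ} (hG : Continuous G) {B : ℝ}
    (hB : ∀ᵐ t ∂(volume.restrict (openTime 0 T)), ∀ x, |G (u t x, x)| ≤ B)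
    {η : ℝ → ℝ} (hη : IntegrableOn η (openTime 0 T)) :
    Integrable (fun p : ℝ × Sp d => η p.1 * G (u p.1 p.2, p.2))
      ((volume.restrict (openTime 0 T)).prod (volume.restrict (unitCell d))) := by
  refine (hη.comp_fst (volume.restrict (unitCell d))).mul_bdd (c := B)
    (aestronglyMeasurable_comp hu hG) ?_
  filter_upwards [ae_prod_of_ae_forall hB (unitCell d)] with p hp
  exact hp p.2

theorem integrableOn_openTime_of_eq_zero {T : EReal} {η : ℝ → ℝ} (hη : Continuous η) {b : ℝ}
    (hb : ∀ t, b ≤ t → η t = 0) : IntegrableOn η (openTime 0 T) := by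
  have h1 : IntegrableOn η (Ioc 0 b) := (hη.integrableOn_Icc).mono_set Ioc_subset_Icc_self
  refine IntegrableOn.of_forall_sdiff_eq_zero h1 (measurableSet_openTime 0 T) fun t ht => hb t ?_
  by_contra hlt
  exact ht.2 ⟨ht.1.1, (not_le.mp hlt).le⟩

/-! ### The equation for the Fourier modes -/

section TestMode

variable {d : ℕ}

/-- The real plane wave with frequency `ξ`, phase `δ` and polarization `b`. -/
noncomputable def planeWave (ξ b : Sp d) (δ : ℝ) (x : Sp d) : Sp d :=
  Real.cos (inner ℝ ξ x + δ) • b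

theorem hasFDerivAt_planeWave (ξ b : Sp d) (δ : ℝ) (x : Sp d) :
    HasFDerivAt (planeWave ξ b δ)
      (-Real.sin (inner ℝ ξ x + δ) • (innerSL ℝ ξ).smulRight b) x := by
  have h : HasFDerivAt (fun x : Sp d => innerSL ℝ ξ x + δ) (innerSL ℝ ξ) x :=
    (innerSL ℝ ξ).hasFDerivAt.add_const δ
  refine (h.cos.smul_const b).congr_fderiv ?_
  ext v
  simp [smul_smul]

theorem contDiff_planeWave (ξ b : Sp d) (δ : ℝ) : ContDiff ℝ ∞ (planeWave ξ b δ) := by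
  unfold planeWave
  exact ((Real.contDiff_cos.comp ((innerSL ℝ ξ).contDiff.add contDiff_const)).smul contDiff_const)

theorem laplacian_planeWave (ξ b : Sp d) (δ : ℝ) (x : Sp d) :
    Laplacian.laplacian (planeWave ξ b δ) x = -(‖ξ‖ ^ 2) • planeWave ξ b δ x := by
  rw [InnerProductSpace.laplacian_eq_iteratedFDeriv_orthonormalBasis _
    (EuclideanSpace.basisFun (Fin d) ℝ)]
  have h1 : fderiv ℝ (planeWave ξ b δ)
      = fun x => -Real.sin (inner ℝ ξ x + δ) • (innerSL ℝ ξ).smulRight b :=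
    funext fun x => (hasFDerivAt_planeWave ξ b δ x).fderiv
  have h2 : HasFDerivAt (fun x => -Real.sin (inner ℝ ξ x + δ) • (innerSL ℝ ξ).smulRight b)
      ((-(Real.cos (inner ℝ ξ x + δ) • innerSL ℝ ξ)).smulRight ((innerSL ℝ ξ).smulRight b)) x := by
    have h : HasFDerivAt (fun x : Sp d => innerSL ℝ ξ x + δ) (innerSL ℝ ξ) x :=
      (innerSL ℝ ξ).hasFDerivAt.add_const δ
    have h' : HasFDerivAt (fun x : Sp d => -Real.sin (inner ℝ ξ x + δ))
        (-(Real.cos (inner ℝ ξ x + δ) • innerSL ℝ ξ)) x := h.sin.neg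
    exact h'.smul_const ((innerSL ℝ ξ).smulRight b)
  simp only [iteratedFDeriv_two_apply, h1, h2.fderiv]
  simp only [EuclideanSpace.basisFun_apply, Matrix.cons_val_zero, Matrix.cons_val_one,
    ContinuousLinearMap.smulRight_apply, neg_apply,
    smul_apply, innerSL_apply_apply, EuclideanSpace.inner_single_right,
    planeWave, smul_smul]
  rw [← Finset.sum_smul, EuclideanSpace.real_norm_sq_eq, ← Finset.sum_neg_distrib, Finset.sum_mul]
  congr 1
  refine Finset.sum_congr rfl fun i _ => ?_
  simp; ring

theorem isPeriodic_planeWave (n : Fin d → ℤ) (b : Sp d) (δ : ℝ) :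
    IsPeriodic (planeWave (freq n) b δ) := by
  intro i x
  simp only [planeWave]
  congr 1
  rw [inner_add_right, EuclideanSpace.inner_single_right]
  have : inner ℝ (freq n) x + 1 * (starRingEnd ℝ) (freq n i) + δ
      = inner ℝ (freq n) x + δ + (n i : ℝ) * (2 * Real.pi) := by
    simp; ring
  rw [this, Real.cos_add_int_mul_two_pi]

theorem isTestField_planeWave {T : EReal} {η : ℝ → ℝ} (hη : ContDiff ℝ ∞ η)
    (hηT : ∃ b : ℝ, (b : EReal) < T ∧ ∀ t, b ≤ t → η t = 0) (n : Fin d → ℤ) {b : Sp d}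
    (hb : inner ℝ (freq n) b = 0) (δ : ℝ) :
    IsTestField T (fun t x => η t • planeWave (freq n) b δ x) where
  smooth := (hη.comp contDiff_fst).smul ((contDiff_planeWave _ _ _).comp contDiff_snd)
  periodic t i x := by simp only [isPeriodic_planeWave n b δ i x]
  divFree t x := by
    have h : fderiv ℝ (fun x => η t • planeWave (freq n) b δ x) x
        = η t • (-Real.sin (inner ℝ (freq n) x + δ) • (innerSL ℝ (freq n)).smulRight b) :=
      ((hasFDerivAt_planeWave _ _ _ x).const_smul (η t)).fderiv
    rw [divergence, h]
    rw [PiLp.inner_apply] at hb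
    have h2 : ∀ i, ((η t • (-Real.sin (inner ℝ (freq n) x + δ) •
        (innerSL ℝ (freq n)).smulRight b)) (EuclideanSpace.single i 1)) i
        = η t * -Real.sin (inner ℝ (freq n) x + δ) * inner ℝ (freq n i) (b i) := by
      intro i
      simp [EuclideanSpace.inner_single_right]
      ring
    rw [Finset.sum_congr rfl fun i _ => h2 i, ← Finset.mul_sum, hb, mul_zero]
  support := by
    obtain ⟨T', hT', h⟩ := hηT
    exact ⟨T', hT', fun t ht x => by rw [h t ht, zero_smul]⟩

end TestMode

section Modes

variable {d : ℕ}

/-- The pairing of the real plane wave `cos (⟨ξ, x⟩ + δ) b` with a vector field. -/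
noncomputable def waveMoment (ξ b : Sp d) (δ : ℝ) (w : Sp d → Sp d) : ℝ :=
  ∫ x in unitCell d, Real.cos (inner ℝ ξ x + δ) * inner ℝ (w x) b

/-- The pairing of the gradient of a real plane wave with `w ⊗ w`. -/
noncomputable def waveFlux (ξ b : Sp d) (δ : ℝ) (w : Sp d → Sp d) : ℝ :=
  ∫ x in unitCell d, -Real.sin (inner ℝ ξ x + δ) * (inner ℝ ξ (w x) * inner ℝ (w x) b)

theorem abs_waveMoment_le {U : ℝ} (ξ b : Sp d) (δ : ℝ) {w : Sp d → Sp d} (hw : ∀ x, ‖w x‖ ≤ U) :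
    |waveMoment ξ b δ w| ≤ U * ‖b‖ * volume.real (unitCell d) := by
  rw [waveMoment, ← Real.norm_eq_abs]
  refine norm_setIntegral_le_of_norm_le_const (volume_unitCell_lt_top d) fun x _ => ?_
  rw [norm_mul]
  calc _ ≤ 1 * (‖w x‖ * ‖b‖) := mul_le_mul (Real.abs_cos_le_one _) (norm_inner_le_norm _ _)
        (norm_nonneg _) zero_le_one
    _ ≤ _ := by rw [one_mul]; gcongr; exact hw x

theorem abs_waveFlux_le {U : ℝ} (ξ b : Sp d) (δ : ℝ) {w : Sp d → Sp d} (hw : ∀ x, ‖w x‖ ≤ U) :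
    |waveFlux ξ b δ w| ≤ (‖ξ‖ * U) * (U * ‖b‖) * volume.real (unitCell d) := by
  have hU : 0 ≤ U := (norm_nonneg _).trans (hw 0)
  rw [waveFlux, ← Real.norm_eq_abs]
  refine norm_setIntegral_le_of_norm_le_const (volume_unitCell_lt_top d) fun x _ => ?_
  rw [norm_mul, norm_mul, norm_neg]
  calc _ ≤ 1 * ((‖ξ‖ * ‖w x‖) * (‖w x‖ * ‖b‖)) := by
        refine mul_le_mul (Real.abs_sin_le_one _) ?_ (by positivity) zero_le_one
        exact mul_le_mul (norm_inner_le_norm _ _) (norm_inner_le_norm _ _) (by positivity)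
          (by positivity)
    _ ≤ _ := by rw [one_mul]; have := hw x; gcongr

variable {α : ℝ≥0} {ν : ℝ} {T : EReal} {u₀ : Sp d → Sp d} {u : ℝ → Sp d → Sp d} {U : ℝ}

theorem aestronglyMeasurable_waveMoment (h : IsHolderWeakSolution α ν T u₀ u) (ξ b : Sp d)
    (δ : ℝ) :
    AEStronglyMeasurable (fun t => waveMoment ξ b δ (u t)) (volume.restrict (openTime 0 T)) :=
  aestronglyMeasurable_setIntegral_comp h.measurable
    (G := fun p => Real.cos (inner ℝ ξ p.2 + δ) * inner ℝ p.1 b) (by fun_prop)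

theorem aestronglyMeasurable_waveFlux (h : IsHolderWeakSolution α ν T u₀ u) (ξ b : Sp d)
    (δ : ℝ) :
    AEStronglyMeasurable (fun t => waveFlux ξ b δ (u t)) (volume.restrict (openTime 0 T)) :=
  aestronglyMeasurable_setIntegral_comp h.measurable
    (G := fun p => -Real.sin (inner ℝ ξ p.2 + δ) * (inner ℝ ξ p.1 * inner ℝ p.1 b)) (by fun_prop)

/-- Products of a time cutoff and a divergence-free plane wave separate the variables: the wave is
an eigenfunction of the Laplacian, so a scalar linear equation in time remains. -/
theorem weak_planeWave (h : IsHolderWeakSolution α ν T u₀ u)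
    (hU : ∀ᵐ t ∂(volume.restrict (openTime 0 T)), ∀ x, ‖u t x‖ ≤ U)
    (n : Fin d → ℤ) {b : Sp d} (hb : inner ℝ (freq n) b = 0) (δ : ℝ) {η : ℝ → ℝ}
    (hη : ContDiff ℝ ∞ η) (hηT : ∃ b : ℝ, (b : EReal) < T ∧ ∀ t, b ≤ t → η t = 0) :
    (∫ t in openTime 0 T, (deriv η t * waveMoment (freq n) b δ (u t)
        + η t * (waveFlux (freq n) b δ (u t)
          - ν * ‖freq n‖ ^ 2 * waveMoment (freq n) b δ (u t))))
      + η 0 * waveMoment (freq n) b δ u₀ = 0 := by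
  have hm := h.momentum _ (isTestField_planeWave hη hηT n hb δ)
  obtain ⟨b', -, hb'⟩ := hηT
  have hη' : Continuous (deriv η) := hη.continuous_deriv (by simp)
  -- The cutoff is moved from `b'` to `b' + 1` so that `η` vanishes in a whole neighbourhood of `t`.
  have hηd : ∀ t, b' + 1 ≤ t → deriv η t = 0 := by
    intro t ht
    have : η =ᶠ[nhds t] fun _ => 0 := by
      filter_upwards [Ioi_mem_nhds (show b' < t by linarith)] with s hs using hb' s hs.le
    rw [this.deriv_eq, deriv_const]
  have hi1 := integrableOn_openTime_of_eq_zero (T := T) hη' hηd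
  have hi2 := integrableOn_openTime_of_eq_zero (T := T) hη.continuous hb'
  set G1 : Sp d × Sp d → ℝ := fun p => Real.cos (inner ℝ (freq n) p.2 + δ) * inner ℝ p.1 b
  set G2 : Sp d × Sp d → ℝ := fun p => -Real.sin (inner ℝ (freq n) p.2 + δ) *
    (inner ℝ (freq n) p.1 * inner ℝ p.1 b)
  have hG1 : Continuous G1 := by fun_prop
  have hG2 : Continuous G2 := by fun_prop
  have hB1 : ∀ᵐ t ∂(volume.restrict (openTime 0 T)), ∀ x, |G1 (u t x, x)| ≤ U * ‖b‖ := by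
    filter_upwards [hU] with t ht x
    simp only [G1]
    rw [abs_mul]
    calc _ ≤ 1 * (‖u t x‖ * ‖b‖) := mul_le_mul (Real.abs_cos_le_one _) (abs_real_inner_le_norm _ _)
          (abs_nonneg _) zero_le_one
      _ ≤ _ := by rw [one_mul]; gcongr; exact ht x
  have hB2 : ∀ᵐ t ∂(volume.restrict (openTime 0 T)), ∀ x,
      |G2 (u t x, x)| ≤ (‖freq n‖ * U) * (U * ‖b‖) := by
    filter_upwards [hU] with t ht x
    have hU0 : 0 ≤ U := (norm_nonneg _).trans (ht 0)
    simp only [G2]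
    rw [abs_mul, abs_mul, abs_neg]
    calc _ ≤ 1 * ((‖freq n‖ * ‖u t x‖) * (‖u t x‖ * ‖b‖)) := by
          refine mul_le_mul (Real.abs_sin_le_one _) ?_ (by positivity) zero_le_one
          exact mul_le_mul (abs_real_inner_le_norm _ _) (abs_real_inner_le_norm _ _) (by positivity)
            (by positivity)
      _ ≤ _ := by rw [one_mul]; have := ht x; gcongr
  have hI1 := integrable_mul_comp h.measurable hG1 hB1 hi1
  have hI2 := integrable_mul_comp h.measurable hG2 hB2 hi2
  have hI3 := (integrable_mul_comp h.measurable hG1 hB1 hi2).const_mul (ν * ‖freq n‖ ^ 2)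
  have hI12 : Integrable (fun p : ℝ × Sp d =>
      deriv η p.1 * G1 (u p.1 p.2, p.2) + η p.1 * G2 (u p.1 p.2, p.2))
      ((volume.restrict (openTime 0 T)).prod (volume.restrict (unitCell d))) := hI1.add hI2
  have heq : ∀ z : ℝ × Sp d,
      inner ℝ (u z.1 z.2) (deriv (fun s => η s • planeWave (freq n) b δ z.2) z.1)
        + inner ℝ (u z.1 z.2)
          (fderiv ℝ (fun x => η z.1 • planeWave (freq n) b δ x) z.2 (u z.1 z.2))
        + ν * inner ℝ (u z.1 z.2)
          (Laplacian.laplacian (fun x => η z.1 • planeWave (freq n) b δ x) z.2)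
      = (deriv η z.1 * G1 (u z.1 z.2, z.2) + η z.1 * G2 (u z.1 z.2, z.2))
        - ν * ‖freq n‖ ^ 2 * (η z.1 * G1 (u z.1 z.2, z.2)) := by
    intro z
    have e1 : deriv (fun s => η s • planeWave (freq n) b δ z.2) z.1
        = deriv η z.1 • planeWave (freq n) b δ z.2 :=
      (((hη.differentiable (by simp)).differentiableAt).hasDerivAt.smul_const _).deriv
    have e2 : fderiv ℝ (fun x => η z.1 • planeWave (freq n) b δ x) z.2
        = η z.1 • (-Real.sin (inner ℝ (freq n) z.2 + δ) • (innerSL ℝ (freq n)).smulRight b) :=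
      ((hasFDerivAt_planeWave _ _ _ z.2).const_smul (η z.1)).fderiv
    have e3 : Laplacian.laplacian (fun x => η z.1 • planeWave (freq n) b δ x) z.2
        = η z.1 • -(‖freq n‖ ^ 2) • planeWave (freq n) b δ z.2 := by
      have := InnerProductSpace.laplacian_smul (η z.1)
        ((contDiff_planeWave (freq n) b δ).contDiffAt (x := z.2) |>.of_le (by norm_cast))
      rw [laplacian_planeWave] at this
      exact this
    rw [e1, e2, e3]
    simp only [G1, G2, planeWave, smul_apply, ContinuousLinearMap.smulRight_apply,
      innerSL_apply_apply, inner_smul_right]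
    ring
  rw [integral_congr_ae (Filter.Eventually.of_forall heq), restrict_openTime_prod,
    integral_sub hI12 hI3, integral_add hI1 hI2, integral_const_mul,
    integral_prod _ hI1, integral_prod _ hI2,
    integral_prod _ (integrable_mul_comp h.measurable hG1 hB1 hi2)] at hm
  simp only [integral_const_mul] at hm
  have hJ1 : Integrable (fun t => deriv η t * waveMoment (freq n) b δ (u t))
      (volume.restrict (openTime 0 T)) := by
    have := hI1.integral_prod_left
    simp only [integral_const_mul] at this
    exact this
  have hJ2 : Integrable (fun t => η t * waveFlux (freq n) b δ (u t))
      (volume.restrict (openTime 0 T)) := by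
    have := hI2.integral_prod_left
    simp only [integral_const_mul] at this
    exact this
  have hJ3 : Integrable (fun t => ν * ‖freq n‖ ^ 2 * (η t * waveMoment (freq n) b δ (u t)))
      (volume.restrict (openTime 0 T)) := by
    have := hI3.integral_prod_left
    simp only [integral_const_mul] at this
    exact this
  have hfin : (∫ t in openTime 0 T, (deriv η t * waveMoment (freq n) b δ (u t)
        + η t * (waveFlux (freq n) b δ (u t)
          - ν * ‖freq n‖ ^ 2 * waveMoment (freq n) b δ (u t))))
      = (∫ t in openTime 0 T, deriv η t * waveMoment (freq n) b δ (u t))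
        + (∫ t in openTime 0 T, η t * waveFlux (freq n) b δ (u t))
        - ν * ‖freq n‖ ^ 2 * ∫ t in openTime 0 T, η t * waveMoment (freq n) b δ (u t) := by
    rw [← integral_const_mul, ← integral_add hJ1 hJ2]
    refine Eq.trans ?_ (integral_sub (hJ1.add hJ2) hJ3)
    refine integral_congr_ae (Filter.Eventually.of_forall fun t => ?_)
    change _ = _ + _ - _
    ring
  rw [hfin]
  have h0 : ∫ x in unitCell d, inner ℝ (u₀ x) (η 0 • planeWave (freq n) b δ x)
      = η 0 * waveMoment (freq n) b δ u₀ := by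
    rw [waveMoment, ← integral_const_mul]
    congr 1; ext x
    simp only [planeWave, inner_smul_right]
  rw [h0] at hm
  exact hm

theorem integrableOn_of_ae_bound {f : ℝ → ℝ} {B b : ℝ} (hbT : (b : EReal) < T)
    (hf : AEStronglyMeasurable f (volume.restrict (openTime 0 T)))
    (hB : ∀ᵐ t ∂(volume.restrict (openTime 0 T)), |f t| ≤ B) : IntegrableOn f (Ioc 0 b) :=
  Integrable.of_bound (hf.mono_measure (Measure.restrict_mono (Ioc_subset_openTime hbT) le_rfl)) B
    (ae_mono (Measure.restrict_mono (Ioc_subset_openTime hbT) le_rfl) hB)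

theorem ae_waveMoment_eq (hT : 0 < T) (h : IsHolderWeakSolution α ν T u₀ u)
    (hU : ∀ᵐ t ∂(volume.restrict (openTime 0 T)), ∀ x, ‖u t x‖ ≤ U)
    (n : Fin d → ℤ) {b : Sp d} (hb : inner ℝ (freq n) b = 0) (δ : ℝ) :
    ∀ᵐ t ∂(volume.restrict (openTime 0 T)),
      Real.exp (ν * ‖freq n‖ ^ 2 * t) * waveMoment (freq n) b δ (u t)
        = waveMoment (freq n) b δ u₀
          + ∫ s in 0..t, Real.exp (ν * ‖freq n‖ ^ 2 * s) * waveFlux (freq n) b δ (u s) := by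
  set μ := ν * ‖freq n‖ ^ 2
  have hint : ∀ {f : ℝ → ℝ} {b : ℝ}, IntegrableOn f (Ioc 0 b) →
      IntegrableOn (fun t => Real.exp (μ * t) * f t) (Ioc 0 b) := by
    intro f b hf
    have h2 : IntegrableOn f (Icc 0 b) := by
      rwa [integrableOn_Icc_iff_integrableOn_Ioc]
    exact (h2.continuousOn_mul (by fun_prop : Continuous fun t => Real.exp (μ * t)).continuousOn
      isCompact_Icc).mono_set Ioc_subset_Icc_self
  refine ae_eq_primitive_of_weak hT (fun b' hb' => hint ?_) (fun b' hb' => hint ?_) ?_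
  · exact integrableOn_of_ae_bound hb' (aestronglyMeasurable_waveMoment h _ _ _)
      (hU.mono fun t ht => abs_waveMoment_le _ _ _ ht)
  · exact integrableOn_of_ae_bound hb' (aestronglyMeasurable_waveFlux h _ _ _)
      (hU.mono fun t ht => abs_waveFlux_le _ _ _ ht)
  · intro θ hθ hθT
    -- Integrating factor: the derivative of the exponential cancels the viscous term.
    have hη : ContDiff ℝ ∞ fun t => θ t * Real.exp (μ * t) :=
      hθ.mul (Real.contDiff_exp.comp (contDiff_const.mul contDiff_id))
    have := weak_planeWave h hU n hb δ hη (by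
      obtain ⟨b', hb', hz⟩ := hθT
      exact ⟨b', hb', fun t ht => by rw [hz t ht, zero_mul]⟩)
    rw [mul_zero, Real.exp_zero, mul_one] at this
    refine Eq.trans ?_ this
    refine congrArg (· + θ 0 * waveMoment (freq n) b δ u₀)
      (integral_congr_ae (Filter.Eventually.of_forall fun t => ?_))
    simp only
    have hd : deriv (fun t => θ t * Real.exp (μ * t)) t
        = deriv θ t * Real.exp (μ * t) + θ t * (Real.exp (μ * t) * μ) := by
      have h1 : HasDerivAt (fun t => Real.exp (μ * t)) (Real.exp (μ * t) * μ) t := by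
        simpa using ((hasDerivAt_id t).const_mul μ).exp
      exact (((hθ.differentiable (by simp)).differentiableAt).hasDerivAt.mul h1).deriv
    rw [hd]; ring

/-- The Fourier modes of the `i`-th component of a vector field, tested with `wave`. -/
noncomputable def velMode (w : Sp d → Sp d) (i : Fin d) (n : Fin d → ℤ) : ℂ :=
  ∫ x in unitCell d, ((w x i : ℝ) : ℂ) * wave (freq n) x

theorem wave_eq (ξ x : Sp d) :
    wave ξ x = (Real.cos (inner ℝ ξ x) : ℂ) + Complex.I * (Real.sin (inner ℝ ξ x) : ℂ) := by
  rw [wave, mul_comm, Complex.exp_mul_I]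
  push_cast; ring

/-- The phases `0` and `-π/2` turn the cosine into cosine and sine, so two real test fields recover
one complex mode. -/
theorem integral_inner_mul_wave {f : Sp d → ℝ} (hf : Continuous f) (ξ : Sp d) :
    ((∫ x in unitCell d, Real.cos (inner ℝ ξ x + 0) * f x : ℝ) : ℂ)
      + Complex.I * ((∫ x in unitCell d, Real.cos (inner ℝ ξ x + -(Real.pi / 2)) * f x : ℝ) : ℂ)
      = ∫ x in unitCell d, (f x : ℂ) * wave ξ x := by
  rw [← integral_complex_ofReal, ← integral_complex_ofReal, ← integral_const_mul,
    ← integral_add]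
  · congr 1; ext x
    rw [wave_eq, add_zero, ← sub_eq_add_neg, Real.cos_sub_pi_div_two]
    push_cast; ring
  · exact integrableOn_unitCell (by fun_prop)
  · exact integrableOn_unitCell (by fun_prop)

theorem integral_inner_freq_mul_wave {w : Sp d → Sp d} (hw : Continuous w)
    (hdiv : IsWeaklyDivFree w) (n : Fin d → ℤ) :
    ∫ x in unitCell d, ((inner ℝ (freq n) (w x) : ℝ) : ℂ) * wave (freq n) x = 0 := by
  have h1 : ∀ δ : ℝ, ∫ x in unitCell d,
      Real.cos (inner ℝ (freq n) x + δ) * inner ℝ (freq n) (w x) = 0 := by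
    intro δ
    have hper : IsPeriodic fun x : Sp d => Real.sin (inner ℝ (freq n) x + δ) := by
      intro i x
      simp only
      rw [inner_add_right, EuclideanSpace.inner_single_right]
      have : inner ℝ (freq n) x + 1 * (starRingEnd ℝ) (freq n i) + δ
          = inner ℝ (freq n) x + δ + (n i : ℝ) * (2 * Real.pi) := by
        simp; ring
      rw [this, Real.sin_add_int_mul_two_pi]
    have := hdiv _ (Real.contDiff_sin.comp ((innerSL ℝ (freq n)).contDiff.add
      (contDiff_const (c := δ)))) hper
    rw [← this]
    congr 1; ext x
    have hd : HasFDerivAt (Real.sin ∘ fun x : Sp d => innerSL ℝ (freq n) x + δ)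
        (Real.cos (innerSL ℝ (freq n) x + δ) • innerSL ℝ (freq n)) x :=
      ((innerSL ℝ (freq n)).hasFDerivAt.add_const δ).sin
    rw [hd.fderiv]
    simp
  rw [← integral_inner_mul_wave (by fun_prop), h1, h1]
  simp

/-- A divergence-free field has no Fourier component along `ξ`, so the projection in the
polarization is invisible and the full mode of `w` is recovered. -/
theorem waveMoment_complex {w : Sp d → Sp d} (hw : Continuous w) (hdiv : IsWeaklyDivFree w)
    (i : Fin d) (n : Fin d → ℤ) :
    (waveMoment (freq n) (leray i (freq n)) 0 w : ℂ)
      + Complex.I * (waveMoment (freq n) (leray i (freq n)) (-(Real.pi / 2)) w : ℂ)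
      = velMode w i n := by
  simp only [waveMoment]
  rw [integral_inner_mul_wave (f := fun x => inner ℝ (w x) (leray i (freq n))) (by fun_prop)]
  simp only [inner_leray_right, velMode]
  have h1 : ∀ x, (((w x i - freq n i / ‖freq n‖ ^ 2 * inner ℝ (freq n) (w x) : ℝ)) : ℂ)
      * wave (freq n) x = (w x i : ℂ) * wave (freq n) x - ((freq n i / ‖freq n‖ ^ 2 : ℝ) : ℂ)
        * (((inner ℝ (freq n) (w x) : ℝ) : ℂ) * wave (freq n) x) := by
    intro x; push_cast; ring
  have hc := continuous_wave (freq n)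
  rw [integral_congr_ae (Filter.Eventually.of_forall h1), integral_sub, integral_const_mul,
    integral_inner_freq_mul_wave hw hdiv, mul_zero, sub_zero]
  · exact integrableOn_unitCell (by fun_prop)
  · exact integrableOn_unitCell (by fun_prop)

theorem waveFlux_complex {w : Sp d → Sp d} (hw : Continuous w) (i : Fin d) (n : Fin d → ℤ) :
    (waveFlux (freq n) (leray i (freq n)) 0 w : ℂ)
      + Complex.I * (waveFlux (freq n) (leray i (freq n)) (-(Real.pi / 2)) w : ℂ)
      = nonlinMode w i n := by
  simp only [waveFlux, nonlinMode]
  rw [← integral_complex_ofReal, ← integral_complex_ofReal, ← integral_const_mul,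
    ← integral_add]
  · congr 1; ext x
    rw [wave_eq, add_zero, ← sub_eq_add_neg, Real.sin_sub_pi_div_two]
    push_cast
    linear_combination (-(Complex.sin (inner ℝ (freq n) x : ℝ) *
      ((inner ℝ (freq n) (w x) : ℝ) * (inner ℝ (w x) (leray i (freq n)) : ℝ) : ℂ)))
      * Complex.I_mul_I
  · exact integrableOn_unitCell (by fun_prop)
  · exact integrableOn_unitCell (by fun_prop)

theorem ae_velMode_eq (hT : 0 < T) (h : IsHolderWeakSolution α ν T u₀ u)
    (hU : ∀ᵐ t ∂(volume.restrict (openTime 0 T)), ∀ x, ‖u t x‖ ≤ U)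
    (hc : ∀ᵐ t ∂(volume.restrict (openTime 0 T)), Continuous (u t)) :
    ∀ᵐ t ∂(volume.restrict (openTime 0 T)), ∀ (i : Fin d) (n : Fin d → ℤ),
      (Real.exp (ν * ‖freq n‖ ^ 2 * t) : ℂ) * velMode (u t) i n
        = velMode u₀ i n
          + ∫ s in 0..t, (Real.exp (ν * ‖freq n‖ ^ 2 * s) : ℂ) * nonlinMode (u s) i n := by
  rw [ae_all_iff]; intro i
  rw [ae_all_iff]; intro n
  have hb := inner_leray i (freq n)
  have hmem : ∀ᵐ t ∂(volume.restrict (openTime 0 T)), t ∈ openTime 0 T :=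
    ae_restrict_mem (measurableSet_openTime 0 T)
  filter_upwards [ae_waveMoment_eq hT h hU n hb 0, ae_waveMoment_eq hT h hU n hb (-(Real.pi / 2)),
    hc, h.divFree, hmem] with t h1 h2 hct hdiv ht
  have hsub := Ioc_subset_openTime ht.2
  have hint : ∀ δ, IntervalIntegrable (fun s => ((Real.exp (ν * ‖freq n‖ ^ 2 * s)
      * waveFlux (freq n) (leray i (freq n)) δ (u s) : ℝ) : ℂ)) volume 0 t := by
    intro δ
    have h3 : IntervalIntegrable (fun s => waveFlux (freq n) (leray i (freq n)) δ (u s))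
        volume 0 t :=
      (intervalIntegrable_iff_integrableOn_Ioc_of_le ht.1.le).mpr
        (integrableOn_of_ae_bound ht.2 (aestronglyMeasurable_waveFlux h _ _ _)
          (hU.mono fun t ht => abs_waveFlux_le _ _ _ ht))
    have h4 := h3.continuousOn_mul
      (by fun_prop : Continuous fun s => Real.exp (ν * ‖freq n‖ ^ 2 * s)).continuousOn
    exact ⟨h4.1.ofReal, h4.2.ofReal⟩
  rw [← waveMoment_complex hct hdiv, ← waveMoment_complex h.init_continuous h.init_divFree]
  have h5 : ∫ s in 0..t, (Real.exp (ν * ‖freq n‖ ^ 2 * s) : ℂ) * nonlinMode (u s) i n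
      = ∫ s in 0..t, (((Real.exp (ν * ‖freq n‖ ^ 2 * s)
        * waveFlux (freq n) (leray i (freq n)) 0 (u s) : ℝ) : ℂ)
        + Complex.I * ((Real.exp (ν * ‖freq n‖ ^ 2 * s)
        * waveFlux (freq n) (leray i (freq n)) (-(Real.pi / 2)) (u s) : ℝ) : ℂ)) := by
    refine intervalIntegral.integral_congr_ae ?_
    rw [uIoc_of_le ht.1.le, ← ae_restrict_iff' measurableSet_Ioc]
    filter_upwards [ae_mono (Measure.restrict_mono hsub le_rfl) hc] with s hs
    rw [← waveFlux_complex hs]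
    push_cast; ring
  rw [h5, intervalIntegral.integral_add (hint _) ((hint _).const_mul _),
    intervalIntegral.integral_const_mul, intervalIntegral.integral_ofReal,
    intervalIntegral.integral_ofReal]
  have h1' := congrArg (fun r : ℝ => (r : ℂ)) h1
  have h2' := congrArg (fun r : ℝ => (r : ℂ)) h2
  rw [Complex.ofReal_add, Complex.ofReal_mul] at h1' h2'
  linear_combination h1' + Complex.I * h2'

end Modes

/-! ### Duhamel's formula and its increments in time -/

theorem norm_le_of_abs_apply_le {d : ℕ} {v : Sp d} {B : ℝ} (h : ∀ i, |v i| ≤ B) :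
    ‖v‖ ≤ d * B := by
  have h1 : v = ∑ i, EuclideanSpace.single i (v i) := by
    ext j
    simp [Pi.single_apply]
  rw [h1]
  refine (norm_sum_le_of_le (n := fun _ => B) _ fun i _ => ?_).trans_eq (by simp)
  simpa using h i

section Duhamel

variable {d : ℕ} {α : ℝ≥0} {ν : ℝ} {T : EReal} {u₀ : Sp d → Sp d} {u : ℝ → Sp d → Sp d} {U H : ℝ}

theorem intervalIntegrable_nonlinMode (h : IsHolderWeakSolution α ν T u₀ u)
    (hU : ∀ᵐ t ∂(volume.restrict (openTime 0 T)), ∀ x, ‖u t x‖ ≤ U) {t₁ t₂ : ℝ}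
    (h1 : 0 ≤ t₁) (h12 : t₁ ≤ t₂) (h2 : (t₂ : EReal) < T) (i : Fin d) (n : Fin d → ℤ) :
    IntervalIntegrable (fun s => nonlinMode (u s) i n) volume t₁ t₂ := by
  rw [intervalIntegrable_iff_integrableOn_Ioc_of_le h12]
  have hsub : Ioc t₁ t₂ ⊆ openTime 0 T :=
    (Ioc_subset_Ioc_left h1).trans (Ioc_subset_openTime h2)
  have hc := continuous_wave (freq n)
  have hmeas : AEStronglyMeasurable (fun t => nonlinMode (u t) i n)
      (volume.restrict (openTime 0 T)) :=
    aestronglyMeasurable_setIntegral_comp h.measurable (G := fun p => Complex.I *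
      ((inner ℝ (freq n) p.1 * inner ℝ p.1 (leray i (freq n)) : ℝ) : ℂ) * wave (freq n) p.2)
      (by fun_prop)
  refine Integrable.of_bound (hmeas.mono_measure (Measure.restrict_mono hsub le_rfl))
    ((‖freq n‖ * U) * (U * ‖leray i (freq n)‖) * volume.real (unitCell d)) ?_
  filter_upwards [ae_mono (Measure.restrict_mono hsub le_rfl) hU] with s hs
  have hU0 : 0 ≤ U := (norm_nonneg _).trans (hs 0)
  refine norm_setIntegral_le_of_norm_le_const (volume_unitCell_lt_top d) fun x _ => ?_
  rw [norm_mul, norm_wave, mul_one, norm_mul, Complex.norm_I, one_mul, Complex.norm_real,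
    norm_mul]
  have := hs x
  refine mul_le_mul ((norm_inner_le_norm _ _).trans (by gcongr))
    ((norm_inner_le_norm _ _).trans (by gcongr)) (norm_nonneg _) (by positivity)

theorem intervalIntegrable_nonlinPairing (h : IsHolderWeakSolution α ν T u₀ u)
    (hU : ∀ᵐ t ∂(volume.restrict (openTime 0 T)), ∀ x, ‖u t x‖ ≤ U) {t₁ t₂ : ℝ}
    (h1 : 0 ≤ t₁) (h12 : t₁ ≤ t₂) (h2 : (t₂ : EReal) < T) (i : Fin d)
    (S : Finset (Fin d → ℤ)) (c : (Fin d → ℤ) → ℂ) {ρ : ℝ → ℝ} (hρ : Continuous ρ) :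
    IntervalIntegrable (fun s => nonlinPairing (u s) i S c (ρ s)) volume t₁ t₂ := by
  have hsum := IntervalIntegrable.sum (μ := volume) (a := t₁) (b := t₂) S
    (f := fun n s => heatCoeff (ρ s) c n * nonlinMode (u s) i n) fun n _ => ?_
  · refine hsum.congr fun s _ => ?_
    simp only [nonlinPairing, Finset.sum_apply]
  refine (intervalIntegrable_nonlinMode h hU h1 h12 h2 i n).continuousOn_mul
    (Continuous.continuousOn ?_)
  simp only [heatCoeff]
  fun_prop

/-- Every Fourier mode of `w` is the one predicted by the equation at time `t`. -/
def SatisfiesModes (ν : ℝ) (u₀ : Sp d → Sp d) (u : ℝ → Sp d → Sp d) (t : ℝ) (w : Sp d → Sp d) :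
    Prop :=
  ∀ (i : Fin d) (n : Fin d → ℤ), (Real.exp (ν * ‖freq n‖ ^ 2 * t) : ℂ) * velMode w i n
    = velMode u₀ i n
      + ∫ s in 0..t, (Real.exp (ν * ‖freq n‖ ^ 2 * s) : ℂ) * nonlinMode (u s) i n

theorem setIntegral_mul_trig_velMode {w : Sp d → Sp d} (hw : Continuous w) (i : Fin d)
    (S : Finset (Fin d → ℤ)) (c : (Fin d → ℤ) → ℂ) :
    ∫ x in unitCell d, (w x i : ℂ) * trig S c x = ∑ n ∈ S, c n * velMode w i n :=
  setIntegral_mul_trig (by fun_prop) S c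

/-- The profile `w` is kept separate from `u t` so that time zero, with `w = u₀`, is covered. A
positive `σ` keeps the heat time in the integrand away from the singularity at zero. -/
theorem duhamel (h : IsHolderWeakSolution α ν T u₀ u)
    (hU : ∀ᵐ t ∂(volume.restrict (openTime 0 T)), ∀ x, ‖u t x‖ ≤ U) {t : ℝ} (ht : 0 ≤ t)
    (htT : (t : EReal) < T) {w : Sp d → Sp d} (hw : Continuous w)
    (hm : SatisfiesModes ν u₀ u t w) (i : Fin d) (S : Finset (Fin d → ℤ))
    (c : (Fin d → ℤ) → ℂ) (σ : ℝ) :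
    (∫ x in unitCell d, (w x i : ℂ) * trig S (heatCoeff σ c) x)
      - ∫ x in unitCell d, (u₀ x i : ℂ) * trig S (heatCoeff (σ + ν * t) c) x
      = ∫ s in 0..t, nonlinPairing (u s) i S c (σ + ν * (t - s)) := by
  rw [setIntegral_mul_trig_velMode hw, setIntegral_mul_trig_velMode h.init_continuous,
    ← Finset.sum_sub_distrib]
  simp only [nonlinPairing]
  rw [intervalIntegral.integral_finsetSum]
  · refine Finset.sum_congr rfl fun n _ => ?_
    set μ := ν * ‖freq n‖ ^ 2
    have e1 : heatCoeff (σ + ν * t) c n = (Real.exp (-(μ * t)) : ℂ) * heatCoeff σ c n := by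
      simp only [heatCoeff]
      rw [← mul_assoc, ← Complex.ofReal_mul, ← Real.exp_add]
      congr 3; simp only [μ]; ring
    have e2 : ∀ s, heatCoeff (σ + ν * (t - s)) c n * nonlinMode (u s) i n
        = ((Real.exp (-(μ * t)) : ℂ) * heatCoeff σ c n)
          * ((Real.exp (μ * s) : ℂ) * nonlinMode (u s) i n) := by
      intro s
      have : heatCoeff (σ + ν * (t - s)) c n
          = (Real.exp (-(μ * t)) : ℂ) * heatCoeff σ c n * (Real.exp (μ * s) : ℂ) := by
        simp only [heatCoeff]
        rw [← mul_assoc, mul_right_comm, ← Complex.ofReal_mul,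
          ← Complex.ofReal_mul, ← Real.exp_add, ← Real.exp_add]
        congr 3; simp only [μ]; ring
      rw [this]; ring
    simp only [e1, e2]
    rw [intervalIntegral.integral_const_mul, ← sub_eq_iff_eq_add'.mpr (hm i n)]
    have e3 : (Real.exp (-(μ * t)) : ℂ) * (Real.exp (μ * t) : ℂ) = 1 := by
      rw [← Complex.ofReal_mul, ← Real.exp_add]; simp
    linear_combination (-(heatCoeff σ c n * velMode w i n)) * e3
  · intro n _
    refine (intervalIntegrable_nonlinMode h hU le_rfl ht htT i n).continuousOn_mul
      (Continuous.continuousOn ?_)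
    simp only [heatCoeff]
    fun_prop

/-- An explicit antiderivative, whose contribution at `s = 0` has a favourable sign. The factor `ν`
is absorbed by the change of variables, which makes the final constant independent of the viscosity.
-/
theorem integral_rpow_shift_le {a σ t : ℝ} (ha : a < 1) (hν : 0 < ν) (hσ : 0 < σ) (ht : 0 ≤ t) :
    ∫ s in 0..t, ν * (σ + ν * (t - s)) ^ ((a - 3) / 2)
      ≤ 2 / (1 - a) * σ ^ ((a - 1) / 2) := by
  have hpos : ∀ s ∈ uIcc 0 t, 0 < σ + ν * (t - s) := by
    intro s hs
    rw [uIcc_of_le ht] at hs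
    have := mul_nonneg hν.le (sub_nonneg.mpr hs.2)
    linarith
  have ha1 : 1 - a ≠ 0 := by linarith
  have hd : ∀ s ∈ uIcc 0 t, HasDerivAt
      (fun s => 2 / (1 - a) * (σ + ν * (t - s)) ^ ((a - 1) / 2))
      (ν * (σ + ν * (t - s)) ^ ((a - 3) / 2)) s := by
    intro s hs
    have h1 : HasDerivAt (fun s => σ + ν * (t - s)) (-ν) s := by
      simpa using (((hasDerivAt_id s).const_sub t).const_mul ν).const_add σ
    refine ((h1.rpow_const (p := (a - 1) / 2) (Or.inl (hpos s hs).ne')).const_mul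
      (2 / (1 - a))).congr_deriv ?_
    rw [show (a - 1) / 2 - 1 = (a - 3) / 2 by ring]
    field_simp; ring
  rw [intervalIntegral.integral_eq_sub_of_hasDerivAt hd]
  · have h0 : 0 < σ + ν * (t - 0) := hpos 0 (by simp)
    have h1 : 0 < 1 - a := by linarith
    have : 0 ≤ 2 / (1 - a) * (σ + ν * (t - 0)) ^ ((a - 1) / 2) := by positivity
    simp only [sub_self, mul_zero, add_zero]
    linarith
  · refine ContinuousOn.intervalIntegrable ?_
    refine continuousOn_const.mul (ContinuousOn.rpow_const (by fun_prop) fun s hs => ?_)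
    exact Or.inl (hpos s hs).ne'

/-- On `[0, t₁]` the two integrands differ only in heat time, by `ν (t₂ - t₁)`, and the derivative
bound applies; on `[t₁, t₂]` the bound for the pairing suffices since the heat time is at least `σ`.
-/
theorem exists_duhamel_sub_le (d : ℕ) {α : ℝ≥0} (hα : 0 < α) (hα1 : α < 1) :
    ∃ C : ℝ, 0 ≤ C ∧ ∀ (ν : ℝ) (_ : 0 < ν) (T : EReal) (u₀ : Sp d → Sp d)
      (u : ℝ → Sp d → Sp d) (_ : IsHolderWeakSolution α ν T u₀ u) (U H : ℝ) (_ : 0 ≤ U) (_ : 0 ≤ H)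
      (_ : ∀ᵐ t ∂(volume.restrict (openTime 0 T)), ∀ x, ‖u t x‖ ≤ U)
      (_ : ∀ᵐ t ∂(volume.restrict (openTime 0 T)),
        ∀ x y, ‖u t x - u t y‖ ≤ H * ‖x - y‖ ^ (α : ℝ))
      (t₁ t₂ : ℝ) (_ : 0 ≤ t₁) (_ : t₁ ≤ t₂) (_ : (t₂ : EReal) < T) (i : Fin d)
      (S : Finset (Fin d → ℤ)) (c : (Fin d → ℤ) → ℂ) (σ : ℝ) (_ : 0 < σ),
      ‖(∫ s in 0..t₂, nonlinPairing (u s) i S c (σ + ν * (t₂ - s)))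
        - ∫ s in 0..t₁, nonlinPairing (u s) i S c (σ + ν * (t₁ - s))‖
        ≤ C * ((t₂ - t₁) * σ ^ (((α : ℝ) - 1) / 2)) * (U * H * cellL1 (trig S c)) := by
  have hα' : (0 : ℝ) < α := by exact_mod_cast hα
  have hα1' : (α : ℝ) < 1 := by exact_mod_cast hα1
  obtain ⟨C₁, hC₁, hb₁⟩ := exists_norm_nonlinPairing_le d hα' hα1'
  obtain ⟨C₂, hC₂, hb₂⟩ := exists_norm_deriv_nonlinPairing_le d hα' hα1'
  have h1α : 0 < 1 - (α : ℝ) := by linarith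
  refine ⟨C₁ + C₂ * (2 / (1 - α)), by positivity, ?_⟩
  intro ν hν T u₀ u h U H hU hH hbU hbH t₁ t₂ ht₁ ht ht₂ i S c σ hσ
  set N := U * H * cellL1 (trig S c)
  have hN : 0 ≤ N := mul_nonneg (mul_nonneg hU hH) (cellL1_nonneg _)
  have ht₁T : (t₁ : EReal) < T := (EReal.coe_le_coe_iff.mpr ht).trans_lt ht₂
  have hρ : ∀ t : ℝ, Continuous fun s : ℝ => σ + ν * (t - s) := fun t => by fun_prop
  have hmem : ∀ᵐ t ∂(volume.restrict (openTime 0 T)), t ∈ openTime 0 T :=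
    ae_restrict_mem (measurableSet_openTime 0 T)
  have hgood : ∀ᵐ s ∂(volume.restrict (openTime 0 T)), IsPeriodic (u s) ∧ (∀ x, ‖u s x‖ ≤ U)
      ∧ ∀ x y, ‖u s x - u s y‖ ≤ H * ‖x - y‖ ^ (α : ℝ) := by
    filter_upwards [hmem, hbU, hbH] with s h1 h2 h3
    exact ⟨h.periodic s h1, h2, h3⟩
  have hi0 := intervalIntegrable_nonlinPairing h hbU le_rfl ht₁ ht₁T i S c (hρ t₂)
  have hi1 := intervalIntegrable_nonlinPairing h hbU ht₁ ht ht₂ i S c (hρ t₂)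
  have hi2 := intervalIntegrable_nonlinPairing h hbU le_rfl ht₁ ht₁T i S c (hρ t₁)
  rw [← intervalIntegral.integral_add_adjacent_intervals hi0 hi1, add_sub_right_comm,
    ← intervalIntegral.integral_sub hi0 hi2]
  have hA : ‖∫ s in 0..t₁, (nonlinPairing (u s) i S c (σ + ν * (t₂ - s))
      - nonlinPairing (u s) i S c (σ + ν * (t₁ - s)))‖
      ≤ C₂ * (2 / (1 - α)) * ((t₂ - t₁) * σ ^ (((α : ℝ) - 1) / 2)) * N := by
    have hmaj : ContinuousOn (fun s => ν * (σ + ν * (t₁ - s)) ^ (((α : ℝ) - 3) / 2))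
        (uIcc 0 t₁) := by
      refine continuousOn_const.mul (ContinuousOn.rpow_const (by fun_prop) fun s hs => ?_)
      rw [uIcc_of_le ht₁] at hs
      have := mul_nonneg hν.le (sub_nonneg.mpr hs.2)
      exact Or.inl (by linarith)
    have hle : ∀ᵐ s, s ∈ Ioc 0 t₁ → ‖nonlinPairing (u s) i S c (σ + ν * (t₂ - s))
        - nonlinPairing (u s) i S c (σ + ν * (t₁ - s))‖
        ≤ C₂ * (t₂ - t₁) * N * (ν * (σ + ν * (t₁ - s)) ^ (((α : ℝ) - 3) / 2)) := by
      rw [← ae_restrict_iff' measurableSet_Ioc]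
      filter_upwards [ae_mono (Measure.restrict_mono (Ioc_subset_openTime ht₁T) le_rfl) hgood,
        ae_restrict_mem measurableSet_Ioc] with s ⟨hp, hsU, hsH⟩ hs
      have hpos : 0 < σ + ν * (t₁ - s) := by
        have := mul_nonneg hν.le (sub_nonneg.mpr hs.2)
        linarith
      -- The derivative bound decreases in the heat time, so its value at the left end serves for
      -- the mean value inequality.
      have hmv := (convex_Ici (σ + ν * (t₁ - s))).norm_image_sub_le_of_norm_deriv_le
        (f := nonlinPairing (u s) i S c) (x := σ + ν * (t₁ - s)) (y := σ + ν * (t₂ - s))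
        (C := C₂ * (σ + ν * (t₁ - s)) ^ (((α : ℝ) - 3) / 2) * N)
        (fun r _ => (hasDerivAt_nonlinPairing _ _ _ _ r).differentiableAt)
        (fun r hr => by
          refine (hb₂ U H (u s) hU hH hp hsU hsH i S c r (hpos.trans_le hr)).trans ?_
          gcongr ?_ * _
          gcongr ?_ * ?_
          exact Real.rpow_le_rpow_of_nonpos hpos hr (by linarith))
        (mem_Ici.mpr le_rfl) (mem_Ici.mpr (by gcongr))
      refine hmv.trans_eq ?_
      rw [show σ + ν * (t₂ - s) - (σ + ν * (t₁ - s)) = ν * (t₂ - t₁) by ring,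
        Real.norm_of_nonneg (mul_nonneg hν.le (sub_nonneg.mpr ht))]
      ring
    refine (intervalIntegral.norm_integral_le_of_norm_le ht₁ hle
      (hmaj.intervalIntegrable.const_mul _)).trans ?_
    rw [intervalIntegral.integral_const_mul]
    have ht' := sub_nonneg.mpr ht
    calc _ ≤ C₂ * (t₂ - t₁) * N * (2 / (1 - α) * σ ^ (((α : ℝ) - 1) / 2)) := by
          gcongr
          exact integral_rpow_shift_le hα1' hν hσ ht₁
      _ = _ := by ring
  have hB : ‖∫ s in t₁..t₂, nonlinPairing (u s) i S c (σ + ν * (t₂ - s))‖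
      ≤ C₁ * ((t₂ - t₁) * σ ^ (((α : ℝ) - 1) / 2)) * N := by
    have hle : ∀ᵐ s, s ∈ Ioc t₁ t₂ → ‖nonlinPairing (u s) i S c (σ + ν * (t₂ - s))‖
        ≤ C₁ * σ ^ (((α : ℝ) - 1) / 2) * N := by
      rw [← ae_restrict_iff' measurableSet_Ioc]
      have hsub : Ioc t₁ t₂ ⊆ openTime 0 T :=
        (Ioc_subset_Ioc_left ht₁).trans (Ioc_subset_openTime ht₂)
      filter_upwards [ae_mono (Measure.restrict_mono hsub le_rfl) hgood,
        ae_restrict_mem measurableSet_Ioc] with s ⟨hp, hsU, hsH⟩ hs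
      have hge : σ ≤ σ + ν * (t₂ - s) := by
        have := mul_nonneg hν.le (sub_nonneg.mpr hs.2)
        linarith
      refine (hb₁ U H (u s) hU hH hp hsU hsH i S c _ (hσ.trans_le hge)).trans ?_
      gcongr ?_ * _
      gcongr ?_ * ?_
      exact Real.rpow_le_rpow_of_nonpos hσ hge (by linarith)
    refine (intervalIntegral.norm_integral_le_of_norm_le ht hle
      (intervalIntegrable_const)).trans_eq ?_
    rw [intervalIntegral.integral_const, smul_eq_mul]; ring
  refine (norm_add_le _ _).trans ((add_le_add hA hB).trans_eq ?_)
  ring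

/-! ### Hölder regularity of the initial velocity -/

/-- On modes a translation is a scalar factor, so spatial increments pass to the limit once finitely
many modes do. -/
theorem setIntegral_shift_mul_trig {w : Sp d → Sp d} (hw : Continuous w) (hp : IsPeriodic w)
    (i : Fin d) (v : Sp d) (S : Finset (Fin d → ℤ)) (c : (Fin d → ℤ) → ℂ) :
    ∫ x in unitCell d, ((w (x + v) i - w x i : ℝ) : ℂ) * trig S c x
      = ∑ n ∈ S, c n * (wave (freq n) (-v) - 1) * velMode w i n := by
  rw [setIntegral_mul_trig (g := fun x => ((w (x + v) i - w x i : ℝ) : ℂ)) (by fun_prop)]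
  refine Finset.sum_congr rfl fun n _ => ?_
  have hc := continuous_wave (freq n)
  have h1 : ∫ x in unitCell d, (w (x + v) i : ℂ) * wave (freq n) x
      = wave (freq n) (-v) * velMode w i n := by
    have hper : IsPeriodic fun x => (w (x + v) i : ℂ) * wave (freq n) x := by
      intro j x
      simp only [add_right_comm x _ v, hp j, isPeriodic_wave n j]
    rw [← hper.setIntegral_add (-v), velMode, ← integral_const_mul]
    congr 1; ext x
    rw [neg_add_cancel_right, wave_add]; ring
  have h2 : ∫ x in unitCell d, ((w (x + v) i - w x i : ℝ) : ℂ) * wave (freq n) x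
      = (∫ x in unitCell d, (w (x + v) i : ℂ) * wave (freq n) x) - velMode w i n := by
    rw [velMode, ← integral_sub]
    · congr 1; ext x; push_cast; ring
    · exact integrableOn_unitCell (by fun_prop)
    · exact integrableOn_unitCell (by fun_prop)
  rw [h2, h1]; ring

theorem tendsto_velMode (h : IsHolderWeakSolution α ν T u₀ u)
    (hU : ∀ᵐ t ∂(volume.restrict (openTime 0 T)), ∀ x, ‖u t x‖ ≤ U) {τ : ℕ → ℝ}
    (hτT : ∀ k, τ k ∈ openTime 0 T) (hτ : Filter.Tendsto τ Filter.atTop (nhds 0))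
    (hm : ∀ k, SatisfiesModes ν u₀ u (τ k) (u (τ k))) (i : Fin d) (n : Fin d → ℤ) :
    Filter.Tendsto (fun k => velMode (u (τ k)) i n) Filter.atTop (nhds (velMode u₀ i n)) := by
  set μ := ν * ‖freq n‖ ^ 2
  obtain ⟨b, hb0, hbT⟩ := EReal.lt_iff_exists_real_btwn.mp ((EReal.coe_pos.mpr (hτT 0).1).trans
    (hτT 0).2)
  have hb0' : 0 < b := by exact_mod_cast hb0
  have hint : IntervalIntegrable (fun s => (Real.exp (μ * s) : ℂ) * nonlinMode (u s) i n)
      volume 0 b :=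
    (intervalIntegrable_nonlinMode h hU le_rfl hb0'.le hbT i n).continuousOn_mul
      (by fun_prop : Continuous fun s : ℝ => (Real.exp (μ * s) : ℂ)).continuousOn
  have hcont := intervalIntegral.continuousOn_primitive_interval
    (f := fun s => (Real.exp (μ * s) : ℂ) * nonlinMode (u s) i n) (μ := volume) (a := 0) (b := b)
    (by
      rw [uIcc_of_le hb0'.le, integrableOn_Icc_iff_integrableOn_Ioc]
      exact (intervalIntegrable_iff_integrableOn_Ioc_of_le hb0'.le).mp hint)
  have hτ' : Filter.Tendsto τ Filter.atTop (nhdsWithin 0 (uIcc 0 b)) := by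
    refine tendsto_nhdsWithin_iff.mpr ⟨hτ, ?_⟩
    filter_upwards [hτ.eventually (Iio_mem_nhds hb0')] with k hk
    rw [uIcc_of_le hb0'.le]
    exact ⟨(hτT k).1.le, hk.le⟩
  have h1 := (hcont 0 (by simp)).tendsto.comp hτ'
  rw [intervalIntegral.integral_same] at h1
  have h2 : Filter.Tendsto (fun k => (Real.exp (-(μ * τ k)) : ℂ)) Filter.atTop (nhds 1) := by
    have : Continuous fun t : ℝ => (Real.exp (-(μ * t)) : ℂ) := by fun_prop
    have h0 := (this.tendsto 0).comp hτ
    rw [mul_zero, neg_zero, Real.exp_zero, Complex.ofReal_one] at h0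
    exact h0
  have h3 := h2.mul (h1.const_add (velMode u₀ i n))
  rw [one_mul, add_zero] at h3
  refine h3.congr fun k => ?_
  have e3 : (Real.exp (-(μ * τ k)) : ℂ) * (Real.exp (μ * τ k) : ℂ) = 1 := by
    rw [← Complex.ofReal_mul, ← Real.exp_add]; simp
  simp only [Function.comp_apply]
  rw [← hm k i n, ← mul_assoc, e3, one_mul]

/-- The initial velocity is only assumed continuous. Its Hölder bound is inherited from the
velocities at times tending to zero: their modes converge, and a bound tested with polynomials
survives this weak limit. -/
theorem abs_init_sub_le (hα : 0 < α) (h : IsHolderWeakSolution α ν T u₀ u)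
    (hU : ∀ᵐ t ∂(volume.restrict (openTime 0 T)), ∀ x, ‖u t x‖ ≤ U) {τ : ℕ → ℝ}
    (hτT : ∀ k, τ k ∈ openTime 0 T) (hτ : Filter.Tendsto τ Filter.atTop (nhds 0))
    (hm : ∀ k, SatisfiesModes ν u₀ u (τ k) (u (τ k)))
    (hH : ∀ k x y, ‖u (τ k) x - u (τ k) y‖ ≤ H * ‖x - y‖ ^ (α : ℝ))
    (i : Fin d) (x y : Sp d) : |u₀ x i - u₀ y i| ≤ H * ‖x - y‖ ^ (α : ℝ) := by
  have hα' : (0 : ℝ) < α := by exact_mod_cast hα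
  have hc := h.init_continuous
  have hp := h.init_periodic
  have key := abs_le_of_forall_trig (f := fun z => u₀ (z + (x - y)) i - u₀ z i) (by fun_prop)
    (fun j z => by simp only [add_right_comm z _ (x - y), hp j]) (B := H * ‖x - y‖ ^ (α : ℝ))
    (fun S c => by
      have hlim : Filter.Tendsto (fun k => ∑ n ∈ S, c n * (wave (freq n) (-(x - y)) - 1)
          * velMode (u (τ k)) i n) Filter.atTop
          (nhds (∑ n ∈ S, c n * (wave (freq n) (-(x - y)) - 1) * velMode u₀ i n)) :=
        tendsto_finsetSum _ fun n _ => (tendsto_velMode h hU hτT hτ hm i n).const_mul _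
      rw [setIntegral_shift_mul_trig hc hp]
      refine le_of_tendsto hlim.norm (Filter.Eventually.of_forall fun k => ?_)
      have hck := continuous_of_holder hα' (hH k)
      rw [← setIntegral_shift_mul_trig hck (h.periodic _ (hτT k))]
      refine norm_setIntegral_mul_le (continuous_trig S c) fun z => ?_
      rw [Complex.norm_real]
      refine (PiLp.norm_apply_le (u (τ k) (z + (x - y)) - u (τ k) z) i).trans ?_
      simpa using hH k (z + (x - y)) z) y
  simpa using key

/-! ### Time regularity of the difference to the heat flow -/

theorem exists_abs_sub_heatFlow_le (d : ℕ) {α : ℝ≥0} (hα : 0 < α) (hα1 : α < 1) :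
    ∃ C : ℝ, 0 ≤ C ∧ ∀ (ν : ℝ) (_ : 0 < ν) (T : EReal) (u₀ : Sp d → Sp d)
      (u : ℝ → Sp d → Sp d) (_ : IsHolderWeakSolution α ν T u₀ u) (U H : ℝ) (_ : 0 ≤ U) (_ : 0 ≤ H)
      (_ : ∀ᵐ t ∂(volume.restrict (openTime 0 T)), ∀ x, ‖u t x‖ ≤ U)
      (_ : ∀ᵐ t ∂(volume.restrict (openTime 0 T)),
        ∀ x y, ‖u t x - u t y‖ ≤ H * ‖x - y‖ ^ (α : ℝ))
      (_ : ∀ i x y, |u₀ x i - u₀ y i| ≤ H * ‖x - y‖ ^ (α : ℝ))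
      (t₁ t₂ : ℝ) (_ : 0 ≤ t₁) (_ : t₁ < t₂) (_ : (t₂ : EReal) < T) (w₁ w₂ : Sp d → Sp d)
      (_ : SatisfiesModes ν u₀ u t₁ w₁) (_ : SatisfiesModes ν u₀ u t₂ w₂)
      (_ : Continuous w₁) (_ : Continuous w₂) (_ : IsPeriodic w₁) (_ : IsPeriodic w₂)
      (_ : ∀ i x y, |w₁ x i - w₁ y i| ≤ H * ‖x - y‖ ^ (α : ℝ))
      (_ : ∀ i x y, |w₂ x i - w₂ y i| ≤ H * ‖x - y‖ ^ (α : ℝ)) (i : Fin d) (x : Sp d),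
      |(w₂ x i - heatFlow (ν * t₂) u₀ x i) - (w₁ x i - heatFlow (ν * t₁) u₀ x i)|
        ≤ C * (U ^ (α : ℝ) * H) * (t₂ - t₁) ^ (α : ℝ) := by
  have hα' : (0 : ℝ) < α := by exact_mod_cast hα
  have hα1' : (α : ℝ) < 1 := by exact_mod_cast hα1
  obtain ⟨C, hC, hb⟩ := exists_duhamel_sub_le d hα hα1
  have hM := gaussMoment_nonneg d α
  refine ⟨4 * gaussMoment d α + C, by positivity, ?_⟩
  intro ν hν T u₀ u h U H hU hH hbU hbH hu₀ t₁ t₂ ht₁ ht ht₂ w₁ w₂ hm₁ hm₂ hw₁ hw₂ hp₁ hp₂ hH₁ hH₂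
    i x
  have hτ : 0 < t₂ - t₁ := sub_pos.mpr ht
  have ht₂0 : 0 ≤ t₂ := ht₁.trans ht.le
  have ht₁T : (t₁ : EReal) < T := (EReal.coe_le_coe_iff.mpr ht.le).trans_lt ht₂
  have hcmp : ∀ (w : Sp d → Sp d), IsPeriodic w →
      (∀ i x y, |w x i - w y i| ≤ H * ‖x - y‖ ^ (α : ℝ)) →
      ∀ (S : Finset (Fin d → ℤ)) (c : (Fin d → ℤ) → ℂ) (σ : ℝ), 0 < σ →
      ‖(∫ x in unitCell d, (w x i : ℂ) * trig S (heatCoeff σ c) x)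
        - ∫ x in unitCell d, (w x i : ℂ) * trig S c x‖
        ≤ gaussMoment d α * σ ^ ((α : ℝ) / 2) * H * cellL1 (trig S c) := by
    intro w hp hHw S c σ hσ
    refine norm_setIntegral_mul_sub_heatCoeff_le hα' hα1'.le hH (fun x y => ?_)
      (fun j x => by simp only [hp j]) hσ.le S c
    rw [← Complex.ofReal_sub, Complex.norm_real]
    exact hHw i x y
  have hheat : ∀ t, 0 ≤ t → Continuous (heatFlow (ν * t) u₀) := by
    intro t ht0
    have hc0 : ∀ x y, ‖u₀ x - u₀ y‖ ≤ (d * H) * ‖x - y‖ ^ (α : ℝ) := fun x y => by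
      rw [mul_assoc]
      exact norm_le_of_abs_apply_le fun i => hu₀ i x y
    exact continuous_of_holder hα' (norm_heatFlow_sub_le' hα' hc0 h.init_periodic
      (mul_nonneg hν.le ht0))
  -- As `U` may be zero and `σ` must be positive, the bound is proved for each `V > U`; in the end
  -- `V` tends to `U`.
  have hV : ∀ V : ℝ, U < V → |(w₂ x i - heatFlow (ν * t₂) u₀ x i)
      - (w₁ x i - heatFlow (ν * t₁) u₀ x i)|
        ≤ (4 * gaussMoment d α + C) * (V ^ (α : ℝ) * H) * (t₂ - t₁) ^ (α : ℝ) := by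
    intro V hUV
    have hV0 : 0 < V := hU.trans_lt hUV
    -- This choice balances the mollification error `σ^(α/2)` with the Duhamel increment `V (t₂-t₁)
    -- σ^((α-1)/2)`.
    set σ := (V * (t₂ - t₁)) ^ 2
    have hσ : 0 < σ := by positivity
    have hσ1 : σ ^ ((α : ℝ) / 2) = V ^ (α : ℝ) * (t₂ - t₁) ^ (α : ℝ) := by
      simp only [σ]
      rw [← Real.mul_rpow hV0.le hτ.le, ← Real.rpow_two, ← Real.rpow_mul (by positivity)]
      congr 1; ring
    have hσ2 : V * ((t₂ - t₁) * σ ^ (((α : ℝ) - 1) / 2)) = V ^ (α : ℝ) * (t₂ - t₁) ^ (α : ℝ) := by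
      simp only [σ]
      rw [← Real.mul_rpow hV0.le hτ.le, ← Real.rpow_two, ← Real.rpow_mul (by positivity),
        show (2 : ℝ) * (((α : ℝ) - 1) / 2) = α - 1 by ring, Real.rpow_sub_one (by positivity)]
      field_simp
    have hc1 := hheat t₁ ht₁
    have hc2 := hheat t₂ ht₂0
    have hq1 := isPeriodic_heatFlow h.init_periodic (ν * t₁)
    have hq2 := isPeriodic_heatFlow h.init_periodic (ν * t₂)
    refine abs_le_of_forall_trig (f := fun x => (w₂ x i - heatFlow (ν * t₂) u₀ x i)
      - (w₁ x i - heatFlow (ν * t₁) u₀ x i)) (by fun_prop)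
      (fun j x => by simp only [hp₁ j, hp₂ j, hq1 j, hq2 j]) (fun S c => ?_) x
    have hN := cellL1_nonneg (trig S c)
    have hct := continuous_trig S c
    have hexp : ∫ x in unitCell d, (((w₂ x i - heatFlow (ν * t₂) u₀ x i)
        - (w₁ x i - heatFlow (ν * t₁) u₀ x i) : ℝ) : ℂ) * trig S c x
        = ((∫ x in unitCell d, (w₂ x i : ℂ) * trig S c x)
          - ∫ x in unitCell d, (u₀ x i : ℂ) * trig S (heatCoeff (ν * t₂) c) x)
        - ((∫ x in unitCell d, (w₁ x i : ℂ) * trig S c x)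
          - ∫ x in unitCell d, (u₀ x i : ℂ) * trig S (heatCoeff (ν * t₁) c) x) := by
      rw [← setIntegral_heatFlow_mul_trig h.init_continuous h.init_periodic
          (mul_nonneg hν.le ht₂0), ← setIntegral_heatFlow_mul_trig h.init_continuous
          h.init_periodic (mul_nonneg hν.le ht₁), ← integral_sub, ← integral_sub, ← integral_sub]
      · congr 1; ext x; push_cast; ring
      all_goals exact integrableOn_unitCell (by fun_prop)
    have hd1 := duhamel h hbU ht₁ ht₁T hw₁ hm₁ i S c σ
    have hd2 := duhamel h hbU ht₂0 ht₂ hw₂ hm₂ i S c σ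
    have hdiff := hb ν hν T u₀ u h U H hU hH hbU hbH t₁ t₂ ht₁ ht.le ht₂ i S c σ hσ
    rw [← hd1, ← hd2] at hdiff
    have e1 := hcmp w₁ hp₁ hH₁ S c σ hσ
    have e2 := hcmp w₂ hp₂ hH₂ S c σ hσ
    have e3 : ∀ t, 0 ≤ t → ‖(∫ x in unitCell d, (u₀ x i : ℂ) * trig S (heatCoeff (σ + ν * t) c) x)
        - ∫ x in unitCell d, (u₀ x i : ℂ) * trig S (heatCoeff (ν * t) c) x‖
        ≤ gaussMoment d α * σ ^ ((α : ℝ) / 2) * H * cellL1 (trig S c) := by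
      intro t ht0
      have := hcmp u₀ h.init_periodic hu₀ S (heatCoeff (ν * t) c) σ hσ
      rw [heatCoeff_heatCoeff] at this
      refine this.trans ?_
      gcongr
      exact cellL1_heatCoeff_le (mul_nonneg hν.le ht0) S c
    have e4 := e3 t₁ ht₁
    have e5 := e3 t₂ ht₂0
    rw [hexp]
    -- Capital letters are the mollified pairings; four of them are exchanged, each with error `E`.
    have hgen : ∀ a₁ a₂ b₁ b₂ A₁ A₂ B₁ B₂ : ℂ, ∀ E F : ℝ, ‖A₁ - a₁‖ ≤ E → ‖A₂ - a₂‖ ≤ E →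
        ‖B₁ - b₁‖ ≤ E → ‖B₂ - b₂‖ ≤ E → ‖(A₂ - B₂) - (A₁ - B₁)‖ ≤ F →
        ‖(a₂ - b₂) - (a₁ - b₁)‖ ≤ 4 * E + F := by
      intro a₁ a₂ b₁ b₂ A₁ A₂ B₁ B₂ E F h1 h2 h3 h4 h5
      have : (a₂ - b₂) - (a₁ - b₁) = ((A₂ - B₂) - (A₁ - B₁)) + (B₂ - b₂) + (A₁ - a₁)
          - (A₂ - a₂) - (B₁ - b₁) := by ring
      rw [this]
      have n1 := norm_sub_le (((A₂ - B₂) - (A₁ - B₁)) + (B₂ - b₂) + (A₁ - a₁)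
          - (A₂ - a₂)) (B₁ - b₁)
      have n2 := norm_sub_le (((A₂ - B₂) - (A₁ - B₁)) + (B₂ - b₂) + (A₁ - a₁)) (A₂ - a₂)
      have n3 := norm_add_le (((A₂ - B₂) - (A₁ - B₁)) + (B₂ - b₂)) (A₁ - a₁)
      have n4 := norm_add_le ((A₂ - B₂) - (A₁ - B₁)) (B₂ - b₂)
      linarith
    refine (hgen _ _ _ _ _ _ _ _ _ _ e1 e2 e4 e5 hdiff).trans ?_
    have hlast : C * ((t₂ - t₁) * σ ^ (((α : ℝ) - 1) / 2)) * (U * H * cellL1 (trig S c))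
        ≤ C * ((t₂ - t₁) * σ ^ (((α : ℝ) - 1) / 2)) * (V * H * cellL1 (trig S c)) := by
      gcongr
    rw [hσ1]
    calc _ ≤ 4 * (gaussMoment d α * (V ^ (α : ℝ) * (t₂ - t₁) ^ (α : ℝ)) * H * cellL1 (trig S c))
          + C * ((t₂ - t₁) * σ ^ (((α : ℝ) - 1) / 2)) * (V * H * cellL1 (trig S c)) := by
          gcongr
      _ = 4 * (gaussMoment d α * (V ^ (α : ℝ) * (t₂ - t₁) ^ (α : ℝ)) * H * cellL1 (trig S c))
          + C * (V * ((t₂ - t₁) * σ ^ (((α : ℝ) - 1) / 2))) * (H * cellL1 (trig S c)) := by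
          ring
      _ = _ := by rw [hσ2]; ring
  have hcont : Continuous fun V : ℝ =>
      (4 * gaussMoment d α + C) * (V ^ (α : ℝ) * H) * (t₂ - t₁) ^ (α : ℝ) := by
    have : Continuous fun V : ℝ => V ^ (α : ℝ) := Real.continuous_rpow_const hα'.le
    fun_prop
  refine ge_of_tendsto ((hcont.tendsto U).mono_left (nhdsWithin_le_nhds (s := Ioi U))) ?_
  filter_upwards [self_mem_nhdsWithin] with V hUV using hV V hUV

end Duhamel

/-! ### Extension of Hölder functions to the closure -/

theorem tendsto_mul_rpow_dist {X : Type*} [PseudoMetricSpace X] (K : ℝ) {a : ℝ} (ha : 0 < a)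
    (x : X) : Filter.Tendsto (fun y => K * dist y x ^ a) (nhds x) (nhds 0) := by
  have h : Continuous fun y : X => K * dist y x ^ a :=
    continuous_const.mul ((continuous_id.dist continuous_const).rpow_const fun _ => Or.inr ha.le)
  simpa [Real.zero_rpow ha.ne'] using h.tendsto x

/-- The extension is the limit along `A`, which exists because the Hölder bound makes `f` Cauchy
near each point of the closure; the same constant passes to the limit. -/
theorem exists_holder_extension {E : Type*} [NormedAddCommGroup E] [CompleteSpace E]
    {f : ℝ → E} {A : Set ℝ} {K a : ℝ} (ha : 0 < a)
    (hf : ∀ s ∈ A, ∀ t ∈ A, ‖f s - f t‖ ≤ K * |s - t| ^ a) :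
    ∃ g : ℝ → E, (∀ t ∈ A, g t = f t) ∧
      ∀ s ∈ closure A, ∀ t ∈ closure A, ‖g s - g t‖ ≤ K * |s - t| ^ a := by
  have hlim : ∀ t, ∃ l, t ∈ closure A → Filter.Tendsto f (nhdsWithin t A) (nhds l) := by
    intro t
    by_cases ht : t ∈ closure A
    · have hne : (nhdsWithin t A).NeBot := mem_closure_iff_nhdsWithin_neBot.mp ht
      have hc : Cauchy (Filter.map f (nhdsWithin t A)) := by
        rw [Metric.cauchy_iff]
        refine ⟨hne.map f, fun ε hε => ?_⟩
        have h0 : Filter.Tendsto (fun p : ℝ × ℝ => K * |p.1 - p.2| ^ a) (nhds (t, t))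
            (nhds 0) := by
          have h : Continuous fun p : ℝ × ℝ => K * |p.1 - p.2| ^ a :=
            continuous_const.mul ((by fun_prop : Continuous fun p : ℝ × ℝ => |p.1 - p.2|).rpow_const
              fun _ => Or.inr ha.le)
          simpa [Real.zero_rpow ha.ne'] using h.tendsto (t, t)
        rw [nhds_prod_eq] at h0
        obtain ⟨o, ho, hoε⟩ := Filter.mem_prod_self_iff.mp (h0 (Iio_mem_nhds hε))
        refine ⟨f '' (A ∩ o), Filter.image_mem_map
          (Filter.inter_mem self_mem_nhdsWithin (mem_nhdsWithin_of_mem_nhds ho)), ?_⟩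
        rintro _ ⟨r, hr, rfl⟩ _ ⟨s, hs, rfl⟩
        rw [dist_eq_norm]
        exact (hf r hr.1 s hs.1).trans_lt (hoε (mk_mem_prod hr.2 hs.2))
      obtain ⟨l, hl⟩ := cauchy_map_iff_exists_tendsto.mp hc
      exact ⟨l, fun _ => hl⟩
    · exact ⟨0, fun h => absurd h ht⟩
  choose g hg using hlim
  refine ⟨g, fun t ht => ?_, fun s hs t ht => ?_⟩
  · have hne : (nhdsWithin t A).NeBot := mem_closure_iff_nhdsWithin_neBot.mp (subset_closure ht)
    refine tendsto_nhds_unique (hg t (subset_closure ht)) ?_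
    rw [tendsto_iff_norm_sub_tendsto_zero]
    refine squeeze_zero' (Filter.Eventually.of_forall fun _ => norm_nonneg _)
      (eventually_nhdsWithin_of_forall fun s hs => hf s hs t ht) ?_
    exact (tendsto_mul_rpow_dist K ha t).mono_left nhdsWithin_le_nhds
  · have hne1 : (nhdsWithin s A).NeBot := mem_closure_iff_nhdsWithin_neBot.mp hs
    have hne2 : (nhdsWithin t A).NeBot := mem_closure_iff_nhdsWithin_neBot.mp ht
    have h1 : Filter.Tendsto (fun p : ℝ × ℝ => ‖f p.1 - f p.2‖)
        (nhdsWithin s A ×ˢ nhdsWithin t A) (nhds ‖g s - g t‖) :=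
      (((hg s hs).comp Filter.tendsto_fst).sub ((hg t ht).comp Filter.tendsto_snd)).norm
    have h2 : Filter.Tendsto (fun p : ℝ × ℝ => K * |p.1 - p.2| ^ a)
        (nhdsWithin s A ×ˢ nhdsWithin t A) (nhds (K * |s - t| ^ a)) := by
      have h : Continuous fun p : ℝ × ℝ => K * |p.1 - p.2| ^ a :=
        continuous_const.mul ((by fun_prop : Continuous fun p : ℝ × ℝ => |p.1 - p.2|).rpow_const
          fun _ => Or.inr ha.le)
      have := h.tendsto (s, t)
      rw [nhds_prod_eq] at this
      exact this.mono_left (Filter.prod_mono nhdsWithin_le_nhds nhdsWithin_le_nhds)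
    refine le_of_tendsto_of_tendsto h1 h2 ?_
    filter_upwards [Filter.prod_mem_prod (self_mem_nhdsWithin (a := s) (s := A))
      (self_mem_nhdsWithin (a := t) (s := A))] with p hp
    exact hf _ hp.1 _ hp.2

/-! ### Norms -/

theorem eHolderNorm_le_ofReal {X F : Type*} [MetricSpace X] [NormedAddCommGroup F] {α : ℝ≥0}
    {f : X → F} {K : ℝ} (hK : 0 ≤ K) (hf : ∀ x y, ‖f x - f y‖ ≤ K * dist x y ^ (α : ℝ)) :
    eHolderNorm α f ≤ ENNReal.ofReal K := by
  have h : HolderWith K.toNNReal α f := by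
    intro x y
    rw [edist_dist, edist_dist, ENNReal.ofReal_rpow_of_nonneg dist_nonneg α.coe_nonneg, dist_eq_norm]
    change _ ≤ ENNReal.ofReal K * _
    rw [← ENNReal.ofReal_mul hK]
    exact ENNReal.ofReal_le_ofReal (hf x y)
  exact h.eHolderNorm_le

theorem norm_sub_le_of_eHolderNorm_lt_top {d : ℕ} {α : ℝ≥0} {f : Sp d → Sp d}
    (hf : eHolderNorm α f < ⊤) (x y : Sp d) :
    ‖f x - f y‖ ≤ (eHolderNorm α f).toReal * ‖x - y‖ ^ (α : ℝ) := by
  have hm : MemHolder α f := eHolderNorm_lt_top.mp hf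
  have h := hm.holderWith.dist_le x y
  rw [dist_eq_norm, dist_eq_norm] at h
  exact h

section Bounds

variable {d : ℕ} {α : ℝ≥0} {ν : ℝ} {T : EReal} {u₀ : Sp d → Sp d} {u : ℝ → Sp d → Sp d}

theorem normLinftyHolderDot_le : normLinftyHolderDot α T u ≤ normLinftyHolder α T u :=
  essSup_mono_ae (Filter.Eventually.of_forall fun _ => le_add_self)

theorem ae_enorm_le_normLinftyHolder :
    ∀ᵐ t ∂(volume.restrict (openTime 0 T)), ∀ x, ‖u t x‖ₑ ≤ normLinftyHolder α T u := by
  filter_upwards [ENNReal.ae_le_essSup (μ := volume.restrict (openTime 0 T))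
    (fun t => holderFullNorm α (u t))] with t ht x
  exact ((le_iSup (fun x => ‖u t x‖ₑ) x).trans le_self_add).trans ht

theorem normLinfty_le : normLinfty T u ≤ normLinftyHolder α T u := by
  rw [normLinfty, eLpNorm_exponent_top, eLpNormEssSup, restrict_openTime_prod]
  refine essSup_le_of_ae_le _ ?_
  filter_upwards [ae_prod_of_ae_forall (ae_enorm_le_normLinftyHolder (α := α) (u := u)) univ]
    with p hp
  exact hp p.2

theorem ae_holder (h : normLinftyHolder α T u < ⊤) :
    ∀ᵐ t ∂(volume.restrict (openTime 0 T)), ∀ x y,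
      ‖u t x - u t y‖ ≤ (normLinftyHolderDot α T u).toReal * ‖x - y‖ ^ (α : ℝ) := by
  have hfin : normLinftyHolderDot α T u < ⊤ := normLinftyHolderDot_le.trans_lt h
  filter_upwards [ENNReal.ae_le_essSup (μ := volume.restrict (openTime 0 T))
    (fun t => eHolderNorm α (u t))] with t ht x y
  change _ ≤ normLinftyHolderDot α T u at ht
  refine (norm_sub_le_of_eHolderNorm_lt_top (ht.trans_lt hfin) x y).trans ?_
  exact mul_le_mul_of_nonneg_right (ENNReal.toReal_mono hfin.ne ht) (by positivity)

/-- The joint essential supremum bounds almost every `x` at almost every time; spatial continuity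
upgrades this to every `x`. -/
theorem ae_norm_le (hα : 0 < α) (h : normLinftyHolder α T u < ⊤) :
    ∀ᵐ t ∂(volume.restrict (openTime 0 T)), ∀ x, ‖u t x‖ ≤ (normLinfty T u).toReal := by
  have hα' : (0 : ℝ) < α := by exact_mod_cast hα
  have hfin : normLinfty T u < ⊤ := (normLinfty_le (α := α)).trans_lt h
  have h1 : ∀ᵐ p ∂((volume.restrict (openTime 0 T)).prod (volume : Measure (Sp d))),
      ‖u p.1 p.2‖ₑ ≤ normLinfty T u := by
    have := ENNReal.ae_le_essSup (μ := volume.restrict (openTime 0 T ×ˢ (univ : Set (Sp d))))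
      (fun p => ‖Function.uncurry u p‖ₑ)
    rw [restrict_openTime_prod, Measure.restrict_univ] at this
    filter_upwards [this] with p hp
    rw [normLinfty, eLpNorm_exponent_top, eLpNormEssSup, restrict_openTime_prod,
      Measure.restrict_univ]
    exact hp
  filter_upwards [Measure.ae_ae_of_ae_prod h1, ae_holder h] with t ht hH x
  have hc := continuous_of_holder hα' hH
  have hcl : IsClosed {x | ‖u t x‖ ≤ (normLinfty T u).toReal} :=
    isClosed_le hc.norm continuous_const
  have hd : Dense {x | ‖u t x‖ ≤ (normLinfty T u).toReal} := by
    refine Measure.dense_of_ae (μ := volume) ?_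
    filter_upwards [ht] with y hy
    rw [← toReal_enorm]
    exact ENNReal.toReal_mono hfin.ne hy
  have hx : x ∈ closure {x | ‖u t x‖ ≤ (normLinfty T u).toReal} := hd x
  rwa [hcl.closure_eq] at hx

theorem nonempty_inter_of_ae (hT : 0 < T) {P : ℝ → Prop}
    (hP : ∀ᵐ t ∂(volume.restrict (openTime 0 T)), P t) :
    halfOpenTime T ⊆ closure {t | t ∈ openTime 0 T ∧ P t} := by
  have key : ∀ o : Set ℝ, IsOpen o → (o ∩ openTime 0 T).Nonempty →
      (o ∩ {t | t ∈ openTime 0 T ∧ P t}).Nonempty := by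
    intro o ho hne
    by_contra hempty
    have h1 := (ho.inter (isOpen_openTime 0 T)).measure_pos volume hne
    rw [ae_restrict_iff' (measurableSet_openTime 0 T)] at hP
    refine h1.ne' (measure_mono_null (fun t ht => ?_) (ae_iff.mp hP))
    intro hPt
    exact hempty ⟨t, ht.1, ht.2, hPt ht.2⟩
  intro t ht
  rw [mem_closure_iff]
  intro o ho hto
  refine key o ho ?_
  rcases ht.1.eq_or_lt with rfl | h0
  · obtain ⟨b, hb0, hbT⟩ := EReal.lt_iff_exists_real_btwn.mp hT
    have hb0' : 0 < b := by exact_mod_cast hb0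
    obtain ⟨ε, hε, hball⟩ := Metric.isOpen_iff.mp ho 0 hto
    refine ⟨min b (ε / 2), hball ?_, ?_, ?_⟩
    · rw [Metric.mem_ball, Real.dist_0_eq_abs, abs_of_pos (by positivity)]
      exact (min_le_right _ _).trans_lt (by linarith)
    · positivity
    · exact (EReal.coe_le_coe_iff.mpr (min_le_left _ _)).trans_lt hbT
  · exact ⟨t, hto, h0, ht.2⟩

end Bounds

/-! ### The continuous representative and its estimates -/

/-- Rationalizing, the numerator is `ν |s - t|` and each root is at least `ν √a`, so the viscosity
cancels. -/
theorem abs_sqrt_sub_sqrt_le {ν a s t : ℝ} (hν : 0 < ν) (ha : 0 < a) (hs : a * ν ≤ s)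
    (ht : a * ν ≤ t) : |√(ν * s) - √(ν * t)| ≤ |s - t| / √a := by
  have hsa := Real.sqrt_pos.mpr ha
  have hs0 : 0 ≤ s := (by positivity : 0 ≤ a * ν).trans hs
  have ht0 : 0 ≤ t := (by positivity : 0 ≤ a * ν).trans ht
  have h1 : ∀ {r}, a * ν ≤ r → ν * √a ≤ √(ν * r) := by
    intro r hr
    refine Real.le_sqrt_of_sq_le ?_
    rw [mul_pow, Real.sq_sqrt ha.le]
    nlinarith
  have h2 : (√(ν * s) - √(ν * t)) * (√(ν * s) + √(ν * t)) = ν * (s - t) := by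
    have e1 := Real.sq_sqrt (mul_nonneg hν.le hs0)
    have e2 := Real.sq_sqrt (mul_nonneg hν.le ht0)
    nlinarith
  have h3 : |√(ν * s) - √(ν * t)| * (√(ν * s) + √(ν * t)) = ν * |s - t| := by
    rw [← abs_of_nonneg (by positivity : 0 ≤ √(ν * s) + √(ν * t)), ← abs_mul, h2, abs_mul,
      abs_of_pos hν]
  have h4 := h1 hs
  have h5 : 0 ≤ √(ν * t) := Real.sqrt_nonneg _
  rw [le_div_iff₀ hsa]
  refine le_of_mul_le_mul_left ?_ hν
  rw [← h3]
  have := abs_nonneg (√(ν * s) - √(ν * t))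
  nlinarith

theorem mainTheorem2 (d : ℕ) (α : ℝ≥0) (hα0 : 0 < α) (hα1 : α < 1) :
    ∃ C : ℝ≥0, ∀ (ν : ℝ) (_ : 0 < ν) (T : EReal) (_ : 0 < T)
      (u₀ : Sp d → Sp d) (u : ℝ → Sp d → Sp d),
      IsHolderWeakSolution α ν T u₀ u →
      ∃ v : ℝ → Sp d → Sp d,
        ContinuousOn (Function.uncurry v) (halfOpenTime T ×ˢ (univ : Set (Sp d))) ∧
        (∀ᵐ t ∂(volume.restrict (openTime 0 T)), v t = u t) ∧
        v 0 = u₀ ∧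
        normLinftySpaceHolderTime α T (fun t x => v t x - heatFlow (ν * t) u₀ x)
          ≤ C * (normLinfty T u ^ (α : ℝ) * normLinftyHolderDot α T u) ∧
        ∀ a : ℝ, 0 < a →
          normJointHolder α (a * ν) T v
            ≤ C * (normLinfty T u ^ (α : ℝ) * normLinftyHolderDot α T u
                + normLinftyHolder α T u
                + ENNReal.ofReal (a ^ (-(α : ℝ) / 2)) * eHolderNorm α u₀) := by
  have hα' : (0 : ℝ) < α := by exact_mod_cast hα0
  have hα1' : (α : ℝ) < 1 := by exact_mod_cast hα1
  obtain ⟨C, hC, hmain⟩ := exists_abs_sub_heatFlow_le d hα0 hα1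
  have hM := gaussMoment_nonneg d α
  set M := gaussMoment d α
  -- The summand `d * C` is for the difference to the heat flow, `M` for the heat flow in time, and
  -- `2` for the sup norm plus the spatial seminorm, both at most the full norm.
  refine ⟨(d * C + 2 + M).toNNReal, ?_⟩
  intro ν hν T hT u₀ u h
  have hfin := h.holder
  set U := (normLinfty T u).toReal
  set H := (normLinftyHolderDot α T u).toReal
  set L := (normLinftyHolder α T u).toReal
  have hU0 : 0 ≤ U := ENNReal.toReal_nonneg
  have hH0 : 0 ≤ H := ENNReal.toReal_nonneg
  have hUfin : normLinfty T u ≠ ⊤ := ((normLinfty_le (α := α)).trans_lt hfin).ne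
  have hHfin : normLinftyHolderDot α T u ≠ ⊤ := (normLinftyHolderDot_le.trans_lt hfin).ne
  have hHL : H ≤ L := ENNReal.toReal_mono hfin.ne normLinftyHolderDot_le
  have hbU : ∀ᵐ t ∂(volume.restrict (openTime 0 T)), ∀ x, ‖u t x‖ ≤ U := ae_norm_le hα0 hfin
  have hbH : ∀ᵐ t ∂(volume.restrict (openTime 0 T)), ∀ x y,
      ‖u t x - u t y‖ ≤ H * ‖x - y‖ ^ (α : ℝ) := ae_holder hfin
  have hbL : ∀ᵐ t ∂(volume.restrict (openTime 0 T)), ∀ x, ‖u t x‖ ≤ L := by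
    filter_upwards [ae_enorm_le_normLinftyHolder (α := α) (u := u) (T := T)] with t ht x
    rw [← toReal_enorm]
    exact ENNReal.toReal_mono hfin.ne (ht x)
  have hmodes := ae_velMode_eq hT h hbU
    (hbH.mono fun t ht => continuous_of_holder hα' ht)
  let P : ℝ → Prop := fun t => (∀ x, ‖u t x‖ ≤ L) ∧
    (∀ x y, ‖u t x - u t y‖ ≤ H * ‖x - y‖ ^ (α : ℝ)) ∧ SatisfiesModes ν u₀ u t (u t)
  have hP : ∀ᵐ t ∂(volume.restrict (openTime 0 T)), P t := by
    filter_upwards [hbL, hbH, hmodes] with t h1 h2 h3 using ⟨h1, h2, h3⟩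
  set B : Set ℝ := {t | t ∈ openTime 0 T ∧ P t}
  have hB : halfOpenTime T ⊆ closure B := nonempty_inter_of_ae hT hP
  have h0T : (0 : ℝ) ∈ halfOpenTime T := ⟨le_rfl, by exact_mod_cast hT⟩
  obtain ⟨τ, hτB, hτ⟩ := mem_closure_iff_seq_limit.mp (hB h0T)
  have hu₀ : ∀ i x y, |u₀ x i - u₀ y i| ≤ H * ‖x - y‖ ^ (α : ℝ) := fun i x y =>
    abs_init_sub_le hα0 h hbU (fun k => (hτB k).1) hτ (fun k => (hτB k).2.2.2)
      (fun k => (hτB k).2.2.1) i x y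
  have hu₀' : eHolderNorm α u₀ < ⊤ := by
    refine (eHolderNorm_le_ofReal (K := d * H) (by positivity) fun x y => ?_).trans_lt
      ENNReal.ofReal_lt_top
    rw [mul_assoc, dist_eq_norm]
    exact norm_le_of_abs_apply_le fun i => hu₀ i x y
  set H₀ := (eHolderNorm α u₀).toReal
  have hH₀ : 0 ≤ H₀ := ENNReal.toReal_nonneg
  have hu₀H : ∀ x y, ‖u₀ x - u₀ y‖ ≤ H₀ * ‖x - y‖ ^ (α : ℝ) :=
    norm_sub_le_of_eHolderNorm_lt_top hu₀'
  -- the solution at the good times and at time zero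
  let w : ℝ → Sp d → Sp d := fun t => if t = 0 then u₀ else u t
  let A : Set ℝ := insert 0 B
  have hA : ∀ t ∈ A, t ∈ halfOpenTime T ∧ SatisfiesModes ν u₀ u t (w t) ∧ Continuous (w t) ∧
      IsPeriodic (w t) ∧ ∀ i x y, |w t x i - w t y i| ≤ H * ‖x - y‖ ^ (α : ℝ) := by
    rintro t (rfl | ht)
    · simp only [w, if_true]
      exact ⟨h0T, fun i n => by simp, h.init_continuous, h.init_periodic, hu₀⟩
    · have ht0 : t ≠ 0 := ht.1.1.ne'
      simp only [w, if_neg ht0]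
      exact ⟨⟨ht.1.1.le, ht.1.2⟩, ht.2.2.2, continuous_of_holder hα' ht.2.2.1, h.periodic t ht.1,
        fun i x y => (PiLp.norm_apply_le (u t x - u t y) i).trans (ht.2.2.1 x y)⟩
  -- The factor `d` comes from passing from components to the Euclidean norm.
  set K := d * (C * (U ^ (α : ℝ) * H))
  have hK : 0 ≤ K := by positivity
  have hlt : ∀ s ∈ A, ∀ t ∈ A, s < t → ∀ x, ‖(w t x - heatFlow (ν * t) u₀ x)
      - (w s x - heatFlow (ν * s) u₀ x)‖ ≤ K * (t - s) ^ (α : ℝ) := by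
    intro s hs t ht hst x
    obtain ⟨hs1, hs2, hs3, hs4, hs5⟩ := hA s hs
    obtain ⟨ht1, ht2, ht3, ht4, ht5⟩ := hA t ht
    simp only [K]
    rw [mul_assoc]
    exact norm_le_of_abs_apply_le fun i => hmain ν hν T u₀ u h U H hU0 hH0 hbU hbH hu₀ s t hs1.1 hst
      ht1.2 (w s) (w t) hs2 ht2 hs3 ht3 hs4 ht4 hs5 ht5 i x
  -- The difference is extended rather than the velocity, because its Hölder bound in time is
  -- uniform down to time zero; the heat flow, defined at all times, is added back.
  have hext : ∀ x, ∃ g : ℝ → Sp d, (∀ t ∈ A, g t = w t x - heatFlow (ν * t) u₀ x) ∧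
      ∀ s ∈ closure A, ∀ t ∈ closure A, ‖g s - g t‖ ≤ K * |s - t| ^ (α : ℝ) := by
    intro x
    refine exists_holder_extension hα' fun s hs t ht => ?_
    rcases lt_trichotomy s t with hst | rfl | hst
    · rw [norm_sub_rev, abs_sub_comm, abs_of_pos (sub_pos.mpr hst)]
      exact hlt s hs t ht hst x
    · simp [Real.zero_rpow hα'.ne']
    · rw [abs_of_pos (sub_pos.mpr hst)]
      exact hlt t ht s hs hst x
  choose g hgA hg using hext
  have hAcl : halfOpenTime T ⊆ closure A := hB.trans (closure_mono (subset_insert 0 B))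
  let v : ℝ → Sp d → Sp d := fun t x => g x t + heatFlow (ν * t) u₀ x
  have hvA : ∀ t ∈ A, v t = w t := by
    intro t ht
    ext1 x
    simp only [v, hgA x t ht, sub_add_cancel]
  have hvB : ∀ t ∈ B, v t = u t := by
    intro t ht
    rw [hvA t (Or.inr ht)]
    exact if_neg ht.1.1.ne'
  have hheat : ∀ s t, 0 ≤ s → 0 ≤ t → ∀ x, ‖heatFlow (ν * s) u₀ x - heatFlow (ν * t) u₀ x‖
      ≤ M * |√(ν * s) - √(ν * t)| ^ (α : ℝ) * H₀ := fun s t hs ht x =>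
    norm_heatFlow_sub_le hα' hα1'.le hu₀H h.init_periodic (mul_nonneg hν.le hs)
      (mul_nonneg hν.le ht) x
  have htime : ∀ s ∈ halfOpenTime T, ∀ t ∈ halfOpenTime T, ∀ x, ‖v s x - v t x‖
      ≤ K * |s - t| ^ (α : ℝ) + M * |√(ν * s) - √(ν * t)| ^ (α : ℝ) * H₀ := by
    intro s hs t ht x
    have : v s x - v t x = (g x s - g x t)
        + (heatFlow (ν * s) u₀ x - heatFlow (ν * t) u₀ x) := by simp only [v]; abel
    rw [this]
    exact (norm_add_le _ _).trans (add_le_add (hg x s (hAcl hs) t (hAcl ht))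
      (hheat s t hs.1 ht.1 x))
  have hmod : ∀ t : ℝ, Filter.Tendsto (fun s : ℝ => K * |s - t| ^ (α : ℝ)
      + M * |√(ν * s) - √(ν * t)| ^ (α : ℝ) * H₀) (nhds t) (nhds 0) := by
    intro t
    have h1 : Continuous fun s : ℝ => |s - t| ^ (α : ℝ) :=
      (by fun_prop : Continuous fun s : ℝ => |s - t|).rpow_const fun _ => Or.inr hα'.le
    have h2 : Continuous fun s : ℝ => |√(ν * s) - √(ν * t)| ^ (α : ℝ) :=
      (by fun_prop : Continuous fun s : ℝ => |√(ν * s) - √(ν * t)|).rpow_const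
        fun _ => Or.inr hα'.le
    have h3 := ((continuous_const.mul h1).add
      ((continuous_const.mul h2).mul continuous_const) : Continuous fun s : ℝ =>
        K * |s - t| ^ (α : ℝ) + M * |√(ν * s) - √(ν * t)| ^ (α : ℝ) * H₀).tendsto t
    have h4 : K * |t - t| ^ (α : ℝ) + M * |√(ν * t) - √(ν * t)| ^ (α : ℝ) * H₀ = 0 := by
      rw [sub_self, sub_self, abs_zero, Real.zero_rpow hα'.ne']
      ring
    exact h3.mono_right (congrArg nhds h4).le
  have hBhalf : B ⊆ halfOpenTime T := fun t ht => ⟨ht.1.1.le, ht.1.2⟩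
  have hvlim : ∀ t ∈ halfOpenTime T, ∀ x,
      Filter.Tendsto (fun s => v s x) (nhdsWithin t B) (nhds (v t x)) := by
    intro t ht x
    rw [tendsto_iff_norm_sub_tendsto_zero]
    exact squeeze_zero' (Filter.Eventually.of_forall fun _ => norm_nonneg _)
      (eventually_nhdsWithin_of_forall fun s hs => htime s (hBhalf hs) t ht x)
      ((hmod t).mono_left nhdsWithin_le_nhds)
  -- The limit is taken along `B`, without time zero, since there the bound with constant `H` is
  -- known for the norm and not only for each component.
  have hspace : ∀ t ∈ halfOpenTime T, ∀ x y, ‖v t x - v t y‖ ≤ H * ‖x - y‖ ^ (α : ℝ) := by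
    intro t ht x y
    have hne : (nhdsWithin t B).NeBot := mem_closure_iff_nhdsWithin_neBot.mp (hB ht)
    refine le_of_tendsto ((hvlim t ht x).sub (hvlim t ht y)).norm
      (eventually_nhdsWithin_of_forall fun s hs => ?_)
    rw [hvB s hs]
    exact hs.2.2.1 x y
  have hbound : ∀ t ∈ halfOpenTime T, ∀ x, ‖v t x‖ ≤ L := by
    intro t ht x
    have hne : (nhdsWithin t B).NeBot := mem_closure_iff_nhdsWithin_neBot.mp (hB ht)
    refine le_of_tendsto (hvlim t ht x).norm
      (eventually_nhdsWithin_of_forall fun s hs => ?_)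
    rw [hvB s hs]
    exact hs.2.1 x
  have hKe : ENNReal.ofReal K = ENNReal.ofReal (d * C)
      * (normLinfty T u ^ (α : ℝ) * normLinftyHolderDot α T u) := by
    simp only [K]
    rw [← mul_assoc, ENNReal.ofReal_mul (p := d * C) (by positivity),
      ENNReal.ofReal_mul (p := U ^ (α : ℝ)) (by positivity),
      ← ENNReal.ofReal_rpow_of_nonneg hU0 hα'.le, ENNReal.ofReal_toReal hUfin,
      ENNReal.ofReal_toReal hHfin]
  have hCe : ((d * C + 2 + M).toNNReal : ℝ≥0∞) = ENNReal.ofReal (d * C + 2 + M) := rfl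
  refine ⟨v, ?_, ?_, ?_, ?_, ?_⟩
  · rintro ⟨t, x⟩ ⟨ht, -⟩
    rw [ContinuousWithinAt, tendsto_iff_norm_sub_tendsto_zero]
    have h1 : Filter.Tendsto (fun p : ℝ × Sp d => (K * |p.1 - t| ^ (α : ℝ)
        + M * |√(ν * p.1) - √(ν * t)| ^ (α : ℝ) * H₀) + H * dist p.2 x ^ (α : ℝ))
        (nhds (t, x)) (nhds (0 + 0)) := by
      rw [nhds_prod_eq]
      exact ((hmod t).comp Filter.tendsto_fst).add
        ((tendsto_mul_rpow_dist H hα' x).comp Filter.tendsto_snd)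
    rw [add_zero] at h1
    refine squeeze_zero' (Filter.Eventually.of_forall fun _ => norm_nonneg _)
      (eventually_nhdsWithin_of_forall fun p hp => ?_) (h1.mono_left nhdsWithin_le_nhds)
    have : Function.uncurry v p - Function.uncurry v (t, x)
        = (v p.1 p.2 - v t p.2) + (v t p.2 - v t x) := by
      simp only [Function.uncurry]; abel
    rw [this, dist_eq_norm]
    exact (norm_add_le _ _).trans (add_le_add (htime _ hp.1 t ht _) (hspace t ht _ _))
  · filter_upwards [hP, ae_restrict_mem (measurableSet_openTime 0 T)] with t h1 h2
    exact hvB t ⟨h2, h1⟩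
  · rw [hvA 0 (mem_insert 0 B)]
    exact if_pos rfl
  · refine iSup_le fun x => ?_
    refine (eHolderNorm_le_ofReal hK fun s t => ?_).trans ?_
    · simp only [Set.domRestrict, v, add_sub_cancel_right]
      exact hg x s (hAcl s.2) t (hAcl t.2)
    · rw [hKe, hCe]
      gcongr
      linarith
  · intro a ha
    have hsub : ∀ t ∈ openTime (a * ν) T, t ∈ halfOpenTime T := fun t ht =>
      ⟨(by positivity : 0 ≤ a * ν).trans ht.1.le, ht.2⟩
    have hsup : (⨆ p : (openTime (a * ν) T ×ˢ (univ : Set (Sp d)) : Set (ℝ × Sp d)),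
        ‖(openTime (a * ν) T ×ˢ (univ : Set (Sp d))).domRestrict (Function.uncurry v) p‖ₑ)
        ≤ normLinftyHolder α T u := by
      refine iSup_le fun p => ?_
      rw [← ENNReal.ofReal_toReal hfin.ne, ← ofReal_norm]
      exact ENNReal.ofReal_le_ofReal (hbound _ (hsub _ p.2.1) _)
    have hhol : eHolderNorm α ((openTime (a * ν) T ×ˢ (univ : Set (Sp d))).domRestrict
        (Function.uncurry v)) ≤ ENNReal.ofReal (K + L + M * (a ^ (-(α : ℝ) / 2) * H₀)) := by
      have hL0 : 0 ≤ L := hH0.trans hHL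
      refine eHolderNorm_le_ofReal (by positivity) fun p q => ?_
      obtain ⟨⟨s, x⟩, hs, -⟩ := p
      obtain ⟨⟨t, y⟩, ht, -⟩ := q
      have hD : dist (⟨(s, x), hs, mem_univ _⟩ : (openTime (a * ν) T ×ˢ (univ : Set (Sp d)) :
          Set (ℝ × Sp d))) ⟨(t, y), ht, mem_univ _⟩ = max |s - t| ‖x - y‖ := by
        rw [Subtype.dist_eq, Prod.dist_eq, Real.dist_eq, dist_eq_norm]
      rw [hD]
      set D := max |s - t| ‖x - y‖
      have hD1 : |s - t| ≤ D := le_max_left _ _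
      have hD2 : ‖x - y‖ ≤ D := le_max_right _ _
      have hD0 : 0 ≤ D := (abs_nonneg _).trans hD1
      change ‖v s x - v t y‖ ≤ _
      have hsplit : v s x - v t y = (v s x - v t x) + (v t x - v t y) := by abel
      rw [hsplit]
      refine (norm_add_le _ _).trans ((add_le_add (htime s (hsub s hs) t (hsub t ht) x)
        (hspace t (hsub t ht) x y)).trans ?_)
      -- This is the only place where the restriction to times beyond `aν` is needed.
      have hsq : |√(ν * s) - √(ν * t)| ^ (α : ℝ) ≤ a ^ (-(α : ℝ) / 2) * D ^ (α : ℝ) := by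
        have hsa := Real.sqrt_pos.mpr ha
        calc _ ≤ (D / √a) ^ (α : ℝ) := by
              refine Real.rpow_le_rpow (abs_nonneg _) ?_ hα'.le
              refine (abs_sqrt_sub_sqrt_le hν ha hs.1.le ht.1.le).trans ?_
              gcongr
          _ = _ := by
              rw [Real.div_rpow hD0 hsa.le, Real.sqrt_eq_rpow, ← Real.rpow_mul ha.le,
                div_eq_mul_inv, ← Real.rpow_neg ha.le, mul_comm]
              congr 2; ring
      calc _ ≤ K * D ^ (α : ℝ) + M * (a ^ (-(α : ℝ) / 2) * D ^ (α : ℝ)) * H₀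
            + L * D ^ (α : ℝ) := by gcongr
        _ = _ := by ring
    refine (add_le_add hsup hhol).trans ?_
    have hL0 : 0 ≤ L := hH0.trans hHL
    rw [ENNReal.ofReal_add (by positivity) (by positivity), ENNReal.ofReal_add hK hL0, hKe,
      ENNReal.ofReal_mul hM, ENNReal.ofReal_mul (p := a ^ (-(α : ℝ) / 2)) (by positivity),
      ENNReal.ofReal_toReal hu₀'.ne,
      ENNReal.ofReal_toReal hfin.ne, hCe]
    set X := normLinfty T u ^ (α : ℝ) * normLinftyHolderDot α T u
    set Y := normLinftyHolder α T u
    set Z := ENNReal.ofReal (a ^ (-(α : ℝ) / 2)) * eHolderNorm α u₀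
    have h1 : ENNReal.ofReal (d * C) ≤ ENNReal.ofReal (d * C + 2 + M) :=
      ENNReal.ofReal_le_ofReal (by linarith)
    have h2 : 2 ≤ ENNReal.ofReal (d * C + 2 + M) := by
      rw [← ENNReal.ofReal_ofNat]
      exact ENNReal.ofReal_le_ofReal (by nlinarith [mul_nonneg (Nat.cast_nonneg (α := ℝ) d) hC])
    have h3 : ENNReal.ofReal M ≤ ENNReal.ofReal (d * C + 2 + M) :=
      ENNReal.ofReal_le_ofReal (by nlinarith [mul_nonneg (Nat.cast_nonneg (α := ℝ) d) hC])
    calc _ = ENNReal.ofReal (d * C) * X + 2 * Y + ENNReal.ofReal M * Z := by ring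
      _ ≤ ENNReal.ofReal (d * C + 2 + M) * X + ENNReal.ofReal (d * C + 2 + M) * Y
          + ENNReal.ofReal (d * C + 2 + M) * Z := by gcongr
      _ = _ := by ring
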